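/- Let $H$ be a finite simple graph in which every vertex has degree at least $2$. Let $M_H\in\mathbb F_2^{V(H)\times E(H)}$ be its incidence matrix and let $S_k=\{i\in E(H): k\in i\}$ be the set of edges at $k\in V(H)$. *The group.* $\Gamma_H=\Gamma(M_H,0)$ is the homogeneous solution group: it is generated by $x_i$, $i\in E(H)$, with relations $x_i^2=1$; $x_ix_j=x_jx_i$ whenever $i,j\in S_k$ for some $k$; and $\prod_{i\in S_k}x_i=1$ for every $k\in V(H)$. Its dual $\widehat{\Gamma_H}$ is the compact quantum group $(C^*(\Gamma_H),\Delta)$, where $C^*(\Gamma_H)$ is the full group $C^*$-algebra with canonical unitaries $u_g$ and $\Delta(u_g)=u_g\otimes u_g$. *The colored graph $G_*(M_H,0)$.* Its vertices are the pairs $(k,\alpha)$ with $k\in V(H)$, $\alpha:S_k\to\{\pm1\}$ and $\prod_{i\in S_k}\alpha_i=1$; the vertex $(k,\alpha)$ has color $k$. Any two distinct vertices $(k,\alpha),(k,\beta)$ are adjacent, and the edge between them has as color the function $\alpha\triangle\beta:S_k\to\{\pm1\}$, $i\mapsto\alpha_i\beta_i$. For $k\neq l$, the vertices $(l,\alpha)$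 and $(k,\beta)$ are adjacent if and only if $S_l\cap S_k=\{i\}$ for some $i$ with $\alpha_i\beta_i=-1$; such an edge has the color $-1$ (a color different from all the colors $\alpha\triangle\beta$). *The uncolored graph $G_*''(M_H,0)$.* Choose lengths $n_c\in\mathbb N_0$ for the vertex colors $c$, with $n_c\ne n_{c'}$ for $c\neq c'$, and lengths $m_c\in\mathbb N_0$ for the edge colors $c\neq-1$ that occur, with $m_c\neq m_{c'}$ for $c\ne c'$. Attach to every vertex of color $c$ a path of length $n_c$, whose edges get the color $-1$. Then subdivide every edge of color $c\neq-1$ by a new vertex, attach to this new vertex a path of length $m_c$, and forget all colors. For a finite graph $G$, the quantum automorphism group $\mathrm{Qut}(G)$ is given by the universal unital $C^*$-algebra $C(\mathrm{Qut}(G))$ with generators $u_{ij}$, $i,j\in V(G)$, and relations $u_{ij}=u_{ij}^*=u_{ij}^2$, $\sum_l u_{il}=1=\sum_l u_{li}$, $A_Gu=uA_G$ (where $A_G$ is the adjacency matrix), with the comultiplication $\Delta(u_{ij})=\sum_k u_{ik}\otimes u_{kj}$. Then, for every such choice of the lengths, $\mathrm{Qut}(G_*''(M_H,0))\cong\widehat{\Gamma_H}$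 as compact quantum groups: there is a $*$-isomorphism $\varphi:C(\mathrm{Qut}(G_*''(M_H,0)))\to C^*(\Gamma_H)$ with $\Delta\circ\varphi=(\varphi\otimes\varphi)\circ\Delta$, where the comultiplications take values in minimal tensor products. -/

import Mathlib

noncomputable section

open scoped TensorProduct

universe u v w

/-! ### The free unital `*`-algebra on a set of generators -/

/-- The free unital complex `*`-algebra on a set `X`: noncommutative polynomials in the letters
`x` (`Sum.inl x`) and their adjoints `x*` (`Sum.inr x`). -/
def FreeStarAlgebra (X : Type u) : Type u := FreeAlgebra ℂ (X ⊕ X)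

namespace FreeStarAlgebra

variable {X : Type u}

instance : Ring (FreeStarAlgebra X) := inferInstanceAs (Ring (FreeAlgebra ℂ (X ⊕ X)))

instance : Algebra ℂ (FreeStarAlgebra X) := inferInstanceAs (Algebra ℂ (FreeAlgebra ℂ (X ⊕ X)))

/-- The letter `x`. -/
def gen (x : X) : FreeStarAlgebra X := FreeAlgebra.ι ℂ (Sum.inl x)

/-- The letter `x*`. -/
def genStar (x : X) : FreeStarAlgebra X := FreeAlgebra.ι ℂ (Sum.inr x)

theorem induct {P : FreeStarAlgebra X → Prop} (hsc : ∀ z : ℂ, P (algebraMap ℂ _ z))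
    (hgen : ∀ x, P (gen x)) (hgenStar : ∀ x, P (genStar x))
    (hadd : ∀ a b, P a → P b → P (a + b)) (hmul : ∀ a b, P a → P b → P (a * b))
    (a : FreeStarAlgebra X) : P a :=
  FreeAlgebra.induction ℂ (X ⊕ X) (motive := P) hsc
    (fun x => by cases x with | inl x => exact hgen x | inr x => exact hgenStar x) hmul hadd a

/-- The opposite of the free algebra, with scalars acting through complex conjugation. -/
abbrev conjOpAlgebra (X : Type u) : Algebra ℂ (FreeStarAlgebra X)ᵐᵒᵖ :=
  RingHom.toAlgebra' ((algebraMap ℂ (FreeStarAlgebra X)ᵐᵒᵖ).comp (starRingEnd ℂ))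
    (fun z a => Algebra.commutes (starRingEnd ℂ z) a)

/-- The conjugate-linear anti-endomorphism exchanging `x` and `x*`. -/
def starHom (X : Type u) : FreeStarAlgebra X →+* (FreeStarAlgebra X)ᵐᵒᵖ :=
  letI := conjOpAlgebra X
  let g : FreeAlgebra ℂ (X ⊕ X) →ₐ[ℂ] (FreeStarAlgebra X)ᵐᵒᵖ :=
    FreeAlgebra.lift ℂ (Sum.elim (fun x => MulOpposite.op (genStar x))
      (fun x => MulOpposite.op (gen x)))
  { toFun := g
    map_one' := map_one g
    map_mul' := map_mul g
    map_zero' := map_zero g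
    map_add' := map_add g }

theorem starHom_gen (x : X) : starHom X (gen x) = MulOpposite.op (genStar x) :=
  let _ := conjOpAlgebra X
  FreeAlgebra.lift_ι_apply (R := ℂ) (A := (FreeStarAlgebra X)ᵐᵒᵖ)
    (Sum.elim (fun x => MulOpposite.op (genStar x)) (fun x => MulOpposite.op (gen x))) (Sum.inl x)

theorem starHom_genStar (x : X) : starHom X (genStar x) = MulOpposite.op (gen x) :=
  let _ := conjOpAlgebra X
  FreeAlgebra.lift_ι_apply (R := ℂ) (A := (FreeStarAlgebra X)ᵐᵒᵖ)
    (Sum.elim (fun x => MulOpposite.op (genStar x)) (fun x => MulOpposite.op (gen x))) (Sum.inr x)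

theorem starHom_algebraMap (z : ℂ) :
    starHom X (algebraMap ℂ _ z) = MulOpposite.op (algebraMap ℂ _ (starRingEnd ℂ z)) :=
  let _ := conjOpAlgebra X
  AlgHom.commutes (FreeAlgebra.lift ℂ (Sum.elim (fun x => MulOpposite.op (genStar x))
    (fun x => MulOpposite.op (gen x))) :
      FreeAlgebra ℂ (X ⊕ X) →ₐ[ℂ] (FreeStarAlgebra X)ᵐᵒᵖ) z

instance : StarRing (FreeStarAlgebra X) where
  star a := (starHom X a).unop
  star_involutive a := by
    induction a using induct with
    | hsc z => simp [starHom_algebraMap]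
    | hgen x => simp [starHom_gen, starHom_genStar]
    | hgenStar x => simp [starHom_gen, starHom_genStar]
    | hadd a b ha hb => simp only [map_add, MulOpposite.unop_add, ha, hb]
    | hmul a b ha hb => simp only [map_mul, MulOpposite.unop_mul, ha, hb]
  star_mul a b := by simp
  star_add a b := by simp

theorem star_def (a : FreeStarAlgebra X) : star a = (starHom X a).unop := rfl

@[simp] theorem star_gen (x : X) : star (gen x) = genStar x := by
  rw [star_def, starHom_gen, MulOpposite.unop_op]

instance : StarModule ℂ (FreeStarAlgebra X) where
  star_smul z a := by
    rw [Algebra.smul_def, Algebra.smul_def, star_mul, star_def (algebraMap _ _ z),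
      starHom_algebraMap, MulOpposite.unop_op]
    exact (Algebra.commutes _ _).symm

variable {B : Type v} [Ring B] [StarRing B] [Algebra ℂ B] [StarModule ℂ B]

/-- Evaluation of noncommutative `*`-polynomials at a family of elements of a `*`-algebra. -/
def eval (f : X → B) : FreeStarAlgebra X →⋆ₐ[ℂ] B :=
  let g : FreeAlgebra ℂ (X ⊕ X) →ₐ[ℂ] B := FreeAlgebra.lift ℂ (Sum.elim f (fun x => star (f x)))
  have hgen : ∀ x, g (gen x) = f x := fun x => FreeAlgebra.lift_ι_apply (R := ℂ) _ (Sum.inl x)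
  have hgenStar : ∀ x, g (genStar x) = star (f x) :=
    fun x => FreeAlgebra.lift_ι_apply (R := ℂ) _ (Sum.inr x)
  { toFun := g
    map_one' := map_one g
    map_mul' := map_mul g
    map_zero' := map_zero g
    map_add' := map_add g
    commutes' := AlgHom.commutes g
    map_star' := fun a => by
      induction a using induct with
      | hsc z =>
        have h : star (algebraMap ℂ (FreeStarAlgebra X) z) = algebraMap ℂ _ (star z) :=
          (algebraMap_star_comm z).symm
        rw [h]
        exact (AlgHom.commutes g _).trans ((algebraMap_star_comm z).trans
          (congrArg star (AlgHom.commutes g z).symm))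
      | hgen x => rw [star_gen, hgen, hgenStar]
      | hgenStar x => rw [← star_gen, star_star, star_gen, hgen, hgenStar, star_star]
      | hadd a b ha hb =>
        rw [star_add]
        refine (map_add g _ _).trans ?_
        rw [ha, hb, ← star_add]
        exact congrArg star (map_add g a b).symm
      | hmul a b ha hb =>
        rw [star_mul]
        refine (map_mul g _ _).trans ?_
        rw [ha, hb, ← star_mul]
        exact congrArg star (map_mul g a b).symm }

@[simp] theorem eval_gen (f : X → B) (x : X) : eval f (gen x) = f x :=
  FreeAlgebra.lift_ι_apply (R := ℂ) (Sum.elim f (fun x => star (f x))) (Sum.inl x)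

end FreeStarAlgebra

/-! ### `C*`-seminorms and the `C*`-algebras they generate -/

/-- A `C*`-seminorm on a unital complex `*`-algebra. -/
structure CStarSeminorm (F : Type u) [Ring F] [StarRing F] [Algebra ℂ F] [StarModule ℂ F]
    extends Seminorm ℂ F where
  mul_le' : ∀ a b, toFun (a * b) ≤ toFun a * toFun b
  star_mul_self' : ∀ a, toFun (star a * a) = toFun a * toFun a

namespace CStarSeminorm

variable {F : Type u} [Ring F] [StarRing F] [Algebra ℂ F] [StarModule ℂ F]

instance : CoeFun (CStarSeminorm F) (fun _ => F → ℝ) := ⟨fun p => p.toFun⟩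

variable (p : CStarSeminorm F)

theorem nonneg (a : F) : 0 ≤ p a := apply_nonneg p.toSeminorm a

theorem add_le (a b : F) : p (a + b) ≤ p a + p b := p.add_le' a b

theorem mul_le (a b : F) : p (a * b) ≤ p a * p b := p.mul_le' a b

theorem star_mul_self (a : F) : p (star a * a) = p a * p a := p.star_mul_self' a

theorem le_star (a : F) : p a ≤ p (star a) := by
  rcases (p.nonneg a).eq_or_lt with h | h
  · rw [← h]; exact p.nonneg _
  · refine le_of_mul_le_mul_right ?_ h
    rw [← p.star_mul_self]
    exact p.mul_le _ _

theorem map_star (a : F) : p (star a) = p a :=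
  le_antisymm (by simpa using p.le_star (star a)) (p.le_star a)

/-- The pointwise supremum of a pointwise bounded set of `C*`-seminorms. -/
def sup (S : Set (CStarSeminorm F)) (hS : ∀ a, BddAbove ((fun p : CStarSeminorm F => p a) '' S)) :
    CStarSeminorm F :=
  have le : ∀ {p : CStarSeminorm F} (a : F), p ∈ S → p a ≤ sSup ((fun p => p.toFun a) '' S) :=
    fun a hp => le_csSup (hS a) ⟨_, hp, rfl⟩
  have nn : ∀ a : F, 0 ≤ sSup ((fun p : CStarSeminorm F => p a) '' S) := fun a =>
    Real.sSup_nonneg (by rintro _ ⟨p, -, rfl⟩; exact p.nonneg a)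
  have ub : ∀ (a : F) (r : ℝ), 0 ≤ r → (∀ p ∈ S, p.toFun a ≤ r) →
      sSup ((fun p : CStarSeminorm F => p a) '' S) ≤ r := fun a r hr h =>
    Real.sSup_le (by rintro _ ⟨p, hp, rfl⟩; exact h p hp) hr
  { toFun := fun a => sSup ((fun p : CStarSeminorm F => p a) '' S)
    map_zero' := le_antisymm
      (ub 0 0 le_rfl fun p _ => (map_zero p.toSeminorm).le) (nn 0)
    add_le' := fun a b => ub _ _ (add_nonneg (nn a) (nn b)) fun p hp =>
      (p.add_le a b).trans (add_le_add (le a hp) (le b hp))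
    neg' := fun a => by
      congr 1
      refine Set.image_congr fun p _ => ?_
      exact map_neg_eq_map p.toSeminorm a
    smul' := fun z a => by
      have key : ∀ (z : ℂ) (a : F), sSup ((fun p : CStarSeminorm F => p (z • a)) '' S) ≤
          ‖z‖ * sSup ((fun p : CStarSeminorm F => p a) '' S) := fun z a =>
        ub _ _ (mul_nonneg (norm_nonneg z) (nn a)) fun p hp =>
          (p.smul' z a).le.trans (mul_le_mul_of_nonneg_left (le a hp) (norm_nonneg z))
      refine le_antisymm (key z a) ?_
      rcases eq_or_ne z 0 with rfl | hz
      · rw [norm_zero, zero_mul]; exact nn _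
      · have h := key z⁻¹ (z • a)
        rw [smul_smul, inv_mul_cancel₀ hz, one_smul, norm_inv] at h
        rw [← le_inv_mul_iff₀ (norm_pos_iff.mpr hz)]
        exact h
    mul_le' := fun a b => ub _ _ (mul_nonneg (nn a) (nn b)) fun p hp =>
      (p.mul_le a b).trans (mul_le_mul (le a hp) (le b hp) (p.nonneg b) (nn a))
    star_mul_self' := fun a => by
      refine le_antisymm (ub _ _ (mul_nonneg (nn a) (nn a)) fun p hp => ?_) ?_
      · rw [p.star_mul_self]
        exact mul_le_mul (le a hp) (le a hp) (p.nonneg a) (nn a)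
      · rw [← sq, ← Real.le_sqrt (nn a) (nn _)]
        refine ub _ _ (Real.sqrt_nonneg _) fun p hp => ?_
        refine Real.le_sqrt_of_sq_le ?_
        rw [sq, ← p.star_mul_self]
        exact le _ hp }

theorem sup_apply (S : Set (CStarSeminorm F)) (hS) (a : F) :
    sup S hS a = sSup ((fun p : CStarSeminorm F => p a) '' S) := rfl

theorem le_sup {S : Set (CStarSeminorm F)} (hS) {p : CStarSeminorm F} (hp : p ∈ S) (a : F) :
    p a ≤ sup S hS a := le_csSup (hS a) ⟨p, hp, rfl⟩

theorem sup_le {S : Set (CStarSeminorm F)} (hS) {a : F} {r : ℝ} (hr : 0 ≤ r)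
    (h : ∀ p ∈ S, p.toFun a ≤ r) : sup S hS a ≤ r :=
  Real.sSup_le (by rintro _ ⟨p, hp, rfl⟩; exact h p hp) hr

/-- The `C*`-seminorm `a ↦ ‖f a‖` of a unital `*`-homomorphism `f` to a `C*`-algebra. -/
def ofHom {B : Type v} [CStarAlgebra B] (f : F →⋆ₐ[ℂ] B) : CStarSeminorm F where
  toFun a := ‖f a‖
  map_zero' := by simp
  add_le' a b := by rw [map_add]; exact norm_add_le _ _
  neg' a := by rw [map_neg, norm_neg]
  smul' z a := by rw [map_smul, norm_smul]
  mul_le' a b := by rw [map_mul]; exact norm_mul_le _ _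
  star_mul_self' a := by rw [map_mul, StarHomClass.map_star, CStarRing.norm_star_mul_self]

/-- The pullback of a `C*`-seminorm along a unital `*`-homomorphism. -/
def comap {G : Type v} [Ring G] [StarRing G] [Algebra ℂ G] [StarModule ℂ G]
    (p : CStarSeminorm F) (f : G →⋆ₐ[ℂ] F) : CStarSeminorm G where
  toFun a := p (f a)
  map_zero' := by rw [map_zero]; exact map_zero p.toSeminorm
  add_le' a b := by rw [map_add]; exact p.add_le _ _
  neg' a := by rw [map_neg]; exact map_neg_eq_map p.toSeminorm _
  smul' z a := by rw [map_smul]; exact p.smul' _ _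
  mul_le' a b := by rw [map_mul]; exact p.mul_le _ _
  star_mul_self' a := by rw [map_mul, StarHomClass.map_star, p.star_mul_self]

/-- The algebra `F`, regarded as a seminormed algebra with the seminorm `p`. -/
def Carrier (_ : CStarSeminorm F) : Type u := F

instance : Ring p.Carrier := inferInstanceAs (Ring F)

instance : StarRing p.Carrier := inferInstanceAs (StarRing F)

instance : Algebra ℂ p.Carrier := inferInstanceAs (Algebra ℂ F)

instance : StarModule ℂ p.Carrier := inferInstanceAs (StarModule ℂ F)

instance : SeminormedRing p.Carrier :=
  { (inferInstance : Ring p.Carrier),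
    (p.toSeminorm.toAddGroupSeminorm.toSeminormedAddCommGroup :
      @SeminormedAddCommGroup F) with
    norm_mul_le := p.mul_le }

theorem norm_carrier (a : p.Carrier) : ‖a‖ = p.toFun a := rfl

instance : NormedSpace ℂ p.Carrier where
  norm_smul_le z a := (p.smul' z a).le

/-- The Hausdorff completion of `F` with respect to a `C*`-seminorm `p`. -/
def Completion (p : CStarSeminorm F) : Type u := UniformSpace.Completion p.Carrier

end CStarSeminorm

namespace CStarSeminorm

open UniformSpace

variable {F : Type u} [Ring F] [StarRing F] [Algebra ℂ F] [StarModule ℂ F] (p : CStarSeminorm F)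

instance : NormedStarGroup p.Carrier where
  norm_star_le a := (p.map_star a).le

theorem isometry_star : Isometry (star : p.Carrier → p.Carrier) :=
  AddMonoidHomClass.isometry_of_norm (starAddEquiv : p.Carrier ≃+ p.Carrier) fun a => p.map_star a

theorem uniformContinuous_star : UniformContinuous (star : p.Carrier → p.Carrier) :=
  p.isometry_star.uniformContinuous

instance : NormedRing p.Completion :=
  inferInstanceAs (NormedRing (UniformSpace.Completion p.Carrier))

instance : CompleteSpace p.Completion :=
  inferInstanceAs (CompleteSpace (UniformSpace.Completion p.Carrier))

instance : NormedAlgebra ℂ p.Completion :=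
  { (inferInstanceAs (Algebra ℂ (UniformSpace.Completion p.Carrier)) : Algebra ℂ p.Completion) with
    norm_smul_le := fun z a => norm_smul_le (β := UniformSpace.Completion p.Carrier) z a }

/-- The canonical map from `F` to its completion, as a function. -/
def coe (a : F) : p.Completion := UniformSpace.Completion.coe' (α := p.Carrier) a

theorem norm_coe (a : F) : ‖p.coe a‖ = p a := UniformSpace.Completion.norm_coe (E := p.Carrier) a

theorem denseRange_coe : DenseRange p.coe :=
  UniformSpace.Completion.denseRange_coe (α := p.Carrier)

theorem completion_induction {P : p.Completion → Prop} (a : p.Completion)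
    (hc : IsClosed {a | P a}) (h : ∀ a : F, P (p.coe a)) : P a :=
  UniformSpace.Completion.induction_on a hc h

theorem coe_mul (a b : F) : p.coe (a * b) = p.coe a * p.coe b :=
  UniformSpace.Completion.coe_mul (α := p.Carrier) a b

theorem coe_add (a b : F) : p.coe (a + b) = p.coe a + p.coe b :=
  UniformSpace.Completion.coe_add (α := p.Carrier) a b

theorem coe_algebraMap (z : ℂ) : p.coe (algebraMap ℂ F z) = algebraMap ℂ p.Completion z := rfl

instance : Star p.Completion :=
  ⟨UniformSpace.Completion.map (star : p.Carrier → p.Carrier)⟩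

theorem coe_star (a : F) : p.coe (star a) = star (p.coe a) :=
  (UniformSpace.Completion.map_coe p.uniformContinuous_star a).symm

instance : ContinuousStar p.Completion :=
  ⟨UniformSpace.Completion.continuous_map⟩

instance : StarRing p.Completion where
  star_involutive a := by
    refine p.completion_induction (P := fun a => star (star a) = a) a
      (isClosed_eq (continuous_star.comp continuous_star) continuous_id) fun a => ?_
    rw [← coe_star, ← coe_star, star_star]
  star_mul a b := by
    refine p.completion_induction (P := fun a => star (a * b) = star b * star a) a
      (isClosed_eq (continuous_star.comp (continuous_id.mul continuous_const))
        (continuous_const.mul continuous_star)) fun a => ?_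
    refine p.completion_induction (P := fun b => star (p.coe a * b) = star b * star (p.coe a)) b
      (isClosed_eq (continuous_star.comp (continuous_const.mul continuous_id))
        (continuous_star.mul continuous_const)) fun b => ?_
    rw [← coe_mul, ← coe_star, ← coe_star, ← coe_star, star_mul, coe_mul]
  star_add a b := by
    refine p.completion_induction (P := fun a => star (a + b) = star a + star b) a
      (isClosed_eq (continuous_star.comp (continuous_id.add continuous_const))
        (continuous_star.add continuous_const)) fun a => ?_
    refine p.completion_induction (P := fun b => star (p.coe a + b) = star (p.coe a) + star b) b
      (isClosed_eq (continuous_star.comp (continuous_const.add continuous_id))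
        (continuous_const.add continuous_star)) fun b => ?_
    rw [← coe_add, ← coe_star, ← coe_star, ← coe_star, star_add, coe_add]

instance : StarModule ℂ p.Completion where
  star_smul z a := by
    rw [Algebra.smul_def, Algebra.smul_def, star_mul, ← coe_algebraMap, ← coe_algebraMap,
      ← coe_star, ← algebraMap_star_comm]
    refine p.completion_induction (P := fun a => star a * p.coe (algebraMap ℂ F (star z)) =
        p.coe (algebraMap ℂ F (star z)) * star a) a
      (isClosed_eq (continuous_star.mul continuous_const) (continuous_const.mul continuous_star)) fun a => ?_
    rw [← coe_star, ← coe_mul, ← coe_mul, Algebra.commutes]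

instance : CStarRing p.Completion :=
  CStarRing.of_le_norm_mul_star_self fun a => by
    refine p.completion_induction (P := fun a => ‖a‖ * ‖a‖ ≤ ‖a * star a‖) a
      (isClosed_le (continuous_norm.mul continuous_norm)
        (continuous_norm.comp (continuous_id.mul continuous_star))) fun a => ?_
    rw [← coe_star, ← coe_mul, norm_coe, norm_coe, ← p.map_star a, ← p.star_mul_self, star_star]

/-- The completion of a `*`-algebra with respect to a `C*`-seminorm is a `C*`-algebra. -/
instance : CStarAlgebra p.Completion where

/-- The canonical unital `*`-homomorphism from `F` to its completion. -/
def toCompletion : F →⋆ₐ[ℂ] p.Completion where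
  toFun := p.coe
  map_one' := rfl
  map_mul' := p.coe_mul
  map_zero' := rfl
  map_add' := p.coe_add
  commutes' _ := rfl
  map_star' := p.coe_star

theorem norm_toCompletion (a : F) : ‖p.toCompletion a‖ = p a := p.norm_coe a

theorem denseRange_toCompletion : DenseRange p.toCompletion := p.denseRange_coe

variable {B : Type v} [CStarAlgebra B]

/-- A unital `*`-homomorphism to a `C*`-algebra that is dominated by the seminorm extends to the
completion. -/
def lift (f : F →⋆ₐ[ℂ] B) (hf : ∀ a, ‖f a‖ ≤ p a) : p.Completion →⋆ₐ[ℂ] B :=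
  let g : p.Carrier → B := f
  have hg : UniformContinuous g :=
    AddMonoidHomClass.uniformContinuous_of_bound
      (show p.Carrier →+ B from (f : F →+ B)) 1 fun a => by rw [one_mul]; exact hf a
  let e : p.Completion → B := UniformSpace.Completion.extension g
  have he : Continuous e := UniformSpace.Completion.continuous_extension
  have hc : ∀ a : F, e (p.coe a) = f a := fun a => UniformSpace.Completion.extension_coe hg a
  { toFun := e
    map_one' := (hc 1).trans (map_one f)
    map_zero' := (hc 0).trans (map_zero f)
    map_mul' := fun a b => by
      refine p.completion_induction (P := fun a => e (a * b) = e a * e b) a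
        (isClosed_eq (he.comp (continuous_id.mul continuous_const)) (he.mul continuous_const)) fun a => ?_
      refine p.completion_induction (P := fun b => e (p.coe a * b) = e (p.coe a) * e b) b
        (isClosed_eq (he.comp (continuous_const.mul continuous_id)) (continuous_const.mul he)) fun b => ?_
      rw [← coe_mul, hc, hc, hc, map_mul]
    map_add' := fun a b => by
      refine p.completion_induction (P := fun a => e (a + b) = e a + e b) a
        (isClosed_eq (he.comp (continuous_id.add continuous_const)) (he.add continuous_const)) fun a => ?_
      refine p.completion_induction (P := fun b => e (p.coe a + b) = e (p.coe a) + e b) b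
        (isClosed_eq (he.comp (continuous_const.add continuous_id)) (continuous_const.add he)) fun b => ?_
      rw [← coe_add, hc, hc, hc, map_add]
    commutes' := fun z => (hc _).trans (AlgHomClass.commutes f z)
    map_star' := fun a => by
      refine p.completion_induction (P := fun a => e (star a) = star (e a)) a
        (isClosed_eq (he.comp continuous_star) (continuous_star.comp he)) fun a => ?_
      rw [← coe_star, hc, hc, StarHomClass.map_star] }

@[simp] theorem lift_toCompletion (f : F →⋆ₐ[ℂ] B) (hf) (a : F) :
    p.lift f hf (p.toCompletion a) = f a :=
  UniformSpace.Completion.extension_coe (α := p.Carrier)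
    (AddMonoidHomClass.uniformContinuous_of_bound
      (show p.Carrier →+ B from (f : F →+ B)) 1 fun a => by rw [one_mul]; exact hf a) a

end CStarSeminorm

/-! ### Universal `C*`-algebras given by generators and relations -/

/-- The `C*`-seminorms on the free `*`-algebra that vanish on the relations. -/
def relSeminorms {X : Type u} (R : Set (FreeStarAlgebra X)) :
    Set (CStarSeminorm (FreeStarAlgebra X)) :=
  {q | ∀ r ∈ R, q r = 0}

/-- The relations bound the norm of every `*`-polynomial in the generators, so that the universal
`C*`-algebra exists. -/
class BoundedRelations {X : Type u} (R : Set (FreeStarAlgebra X)) : Prop where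
  bddAbove : ∀ a, BddAbove ((fun q : CStarSeminorm (FreeStarAlgebra X) => q a) '' relSeminorms R)

/-- It is enough to bound the generators. -/
theorem BoundedRelations.of_gen {X : Type u} {R : Set (FreeStarAlgebra X)}
    (h : ∀ x, ∃ C, ∀ q ∈ relSeminorms R, q.toFun (FreeStarAlgebra.gen x) ≤ C) :
    BoundedRelations R := by
  have key : ∀ a, ∃ C, ∀ q ∈ relSeminorms R, q.toFun a ≤ C := by
    intro a
    induction a using FreeStarAlgebra.induct with
    | hsc z =>
      refine ⟨‖z‖, fun q _ => ?_⟩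
      have h1 : q.toFun 1 ≤ 1 := by
        have h2 := q.star_mul_self 1
        rw [star_one, one_mul] at h2
        by_contra! h3
        nlinarith
      rw [Algebra.algebraMap_eq_smul_one]
      exact (q.smul' z 1).le.trans (by nlinarith [norm_nonneg z])
    | hgen x => exact h x
    | hgenStar x =>
      obtain ⟨C, hC⟩ := h x
      refine ⟨C, fun q hq => ?_⟩
      rw [← FreeStarAlgebra.star_gen, q.map_star]
      exact hC q hq
    | hadd a b ha hb =>
      obtain ⟨C, hC⟩ := ha
      obtain ⟨D, hD⟩ := hb
      exact ⟨C + D, fun q hq => (q.add_le a b).trans (add_le_add (hC q hq) (hD q hq))⟩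
    | hmul a b ha hb =>
      obtain ⟨C, hC⟩ := ha
      obtain ⟨D, hD⟩ := hb
      exact ⟨C * D, fun q hq => (q.mul_le a b).trans (mul_le_mul (hC q hq) (hD q hq) (q.nonneg b)
        ((q.nonneg a).trans (hC q hq)))⟩
  refine ⟨fun a => ?_⟩
  obtain ⟨C, hC⟩ := key a
  exact ⟨C, by rintro _ ⟨q, hq, rfl⟩; exact hC q hq⟩

section Universal

variable {X : Type u} (R : Set (FreeStarAlgebra X)) [BoundedRelations R]

/-- The largest `C*`-seminorm on the free `*`-algebra that vanishes on the relations. -/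
def universalSeminorm : CStarSeminorm (FreeStarAlgebra X) :=
  CStarSeminorm.sup (relSeminorms R) BoundedRelations.bddAbove

/-- The universal unital `C*`-algebra `C*(X | R)` with generators `X` and relations `r = 0`,
`r ∈ R`: the Hausdorff completion of the free `*`-algebra with respect to the largest
`C*`-seminorm that vanishes on `R`. -/
def UniversalCStarAlgebra : Type u := (universalSeminorm R).Completion

namespace UniversalCStarAlgebra

instance : CStarAlgebra (UniversalCStarAlgebra R) :=
  inferInstanceAs (CStarAlgebra (universalSeminorm R).Completion)

/-- The canonical `*`-homomorphism from the free `*`-algebra. -/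
def mk : FreeStarAlgebra X →⋆ₐ[ℂ] UniversalCStarAlgebra R := (universalSeminorm R).toCompletion

theorem denseRange_mk : DenseRange (mk R) := (universalSeminorm R).denseRange_toCompletion

/-- The generator corresponding to `x`. -/
def of (x : X) : UniversalCStarAlgebra R := mk R (FreeStarAlgebra.gen x)

variable {R}

theorem mk_eq_zero {r : FreeStarAlgebra X} (hr : r ∈ R) : mk R r = 0 := by
  rw [← norm_le_zero_iff]
  refine ((universalSeminorm R).norm_toCompletion r).le.trans ?_
  exact CStarSeminorm.sup_le _ le_rfl fun q hq => (hq r hr).le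

variable {B : Type v} [CStarAlgebra B]

/-- The universal property: elements of a `C*`-algebra that satisfy the relations define a
`*`-homomorphism. -/
def lift (f : X → B) (hf : ∀ r ∈ R, FreeStarAlgebra.eval f r = 0) :
    UniversalCStarAlgebra R →⋆ₐ[ℂ] B :=
  (universalSeminorm R).lift (FreeStarAlgebra.eval f) fun a =>
    CStarSeminorm.le_sup _ (p := CStarSeminorm.ofHom (FreeStarAlgebra.eval f))
      (fun r hr => by
        change ‖FreeStarAlgebra.eval f r‖ = 0
        rw [hf r hr, norm_zero]) a

theorem lift_mk (f : X → B) (hf : ∀ r ∈ R, FreeStarAlgebra.eval f r = 0) (a : FreeStarAlgebra X) :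
    lift f hf (mk R a) = FreeStarAlgebra.eval f a :=
  (universalSeminorm R).lift_toCompletion _ _ a

@[simp] theorem lift_of (f : X → B) (hf : ∀ r ∈ R, FreeStarAlgebra.eval f r = 0) (x : X) :
    lift f hf (of R x) = f x := by
  rw [of, lift_mk, FreeStarAlgebra.eval_gen]

end UniversalCStarAlgebra

end Universal

/-! ### The minimal tensor product of `C*`-algebras -/

/-- A `*`-representation on a pre-Hilbert space by bounded operators defines a `C*`-seminorm, the
operator norm of the image. -/
def CStarSeminorm.ofRep {F : Type w} [Ring F] [StarRing F] [Algebra ℂ F] [StarModule ℂ F]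
    {E : Type u} [NormedAddCommGroup E] [InnerProductSpace ℂ E] (Φ : F →ₐ[ℂ] (E →L[ℂ] E))
    (hΦ : ∀ x v w, inner ℂ (Φ (star x) v) w = inner ℂ v (Φ x w)) : CStarSeminorm F where
  toFun x := ‖Φ x‖
  map_zero' := by simp
  add_le' a b := by rw [map_add]; exact norm_add_le _ _
  neg' a := by rw [map_neg, norm_neg]
  smul' z a := by rw [map_smul, norm_smul]
  mul_le' a b := by rw [map_mul]; exact norm_mul_le _ _
  star_mul_self' x := by
    have key : ∀ x : F, ‖Φ x‖ * ‖Φ x‖ ≤ ‖Φ (star x * x)‖ := by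
      intro x
      rw [← sq, ← Real.le_sqrt (norm_nonneg _) (norm_nonneg _)]
      refine ContinuousLinearMap.opNorm_le_bound _ (Real.sqrt_nonneg _) fun v => ?_
      refine le_of_sq_le_sq ?_ (by positivity)
      rw [mul_pow, Real.sq_sqrt (norm_nonneg _), ← inner_self_eq_norm_sq (𝕜 := ℂ), ← hΦ]
      refine (Complex.re_le_norm _).trans ((norm_inner_le_norm _ _).trans ?_)
      rw [sq, ← mul_assoc]
      refine mul_le_mul_of_nonneg_right ?_ (norm_nonneg _)
      rw [map_mul]
      exact ContinuousLinearMap.le_opNorm (Φ (star x) * Φ x) v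
    have hstar : ∀ x : F, ‖Φ x‖ ≤ ‖Φ (star x)‖ := by
      intro x
      rcases (norm_nonneg (Φ x)).eq_or_lt with h | h
      · rw [← h]; exact norm_nonneg _
      · refine le_of_mul_le_mul_right ((key x).trans ?_) h
        rw [map_mul]
        exact norm_mul_le _ _
    refine le_antisymm ?_ (key x)
    rw [map_mul]
    refine (norm_mul_le _ _).trans (mul_le_mul_of_nonneg_right ?_ (norm_nonneg _))
    simpa using hstar (star x)

section MinTensor

variable {A : Type u} {B : Type v} [CStarAlgebra A] [CStarAlgebra B]

section ProductRep

variable {H : Type u} {K : Type v} [NormedAddCommGroup H] [InnerProductSpace ℂ H] [CompleteSpace H]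
  [NormedAddCommGroup K] [InnerProductSpace ℂ K] [CompleteSpace K]

/-- The representation `π ⊗ ρ` of the algebraic tensor product `A ⊙ B` on the (pre-Hilbert)
tensor product `H ⊗ K`, given by `a ⊗ b ↦ π a ⊗ ρ b`. -/
def productRep (π : A →⋆ₐ[ℂ] (H →L[ℂ] H)) (ρ : B →⋆ₐ[ℂ] (K →L[ℂ] K)) :
    A ⊗[ℂ] B →ₐ[ℂ] ((H ⊗[ℂ] K) →L[ℂ] (H ⊗[ℂ] K)) :=
  Algebra.TensorProduct.lift
    { toFun := fun a => TensorProduct.mapL (π a) (1 : K →L[ℂ] K)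
      map_one' := by rw [map_one]; exact TensorProduct.mapL_id_id
      map_mul' := fun a b => by rw [map_mul, ← TensorProduct.mapL_mul, one_mul]
      map_zero' := by rw [map_zero, TensorProduct.mapL_zero_left]
      map_add' := fun a b => by rw [map_add, TensorProduct.mapL_add_left]
      commutes' := fun z => by
        rw [AlgHomClass.commutes, Algebra.algebraMap_eq_smul_one, TensorProduct.mapL_smul_left,
          Algebra.algebraMap_eq_smul_one]
        exact congrArg (z • ·) TensorProduct.mapL_id_id }
    { toFun := fun b => TensorProduct.mapL (1 : H →L[ℂ] H) (ρ b)
      map_one' := by rw [map_one]; exact TensorProduct.mapL_id_id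
      map_mul' := fun a b => by rw [map_mul, ← TensorProduct.mapL_mul, one_mul]
      map_zero' := by rw [map_zero, TensorProduct.mapL_zero_right]
      map_add' := fun a b => by rw [map_add, TensorProduct.mapL_add_right]
      commutes' := fun z => by
        rw [AlgHomClass.commutes, Algebra.algebraMap_eq_smul_one, TensorProduct.mapL_smul_right,
          Algebra.algebraMap_eq_smul_one]
        exact congrArg (z • ·) TensorProduct.mapL_id_id }
    (fun a b => by
      change TensorProduct.mapL _ _ * TensorProduct.mapL _ _ =
        TensorProduct.mapL _ _ * TensorProduct.mapL _ _
      rw [← TensorProduct.mapL_mul, ← TensorProduct.mapL_mul, one_mul, mul_one, one_mul, mul_one])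

theorem productRep_tmul (π : A →⋆ₐ[ℂ] (H →L[ℂ] H)) (ρ : B →⋆ₐ[ℂ] (K →L[ℂ] K)) (a : A) (b : B) :
    productRep π ρ (a ⊗ₜ b) = TensorProduct.mapL (π a) (ρ b) := by
  rw [productRep, Algebra.TensorProduct.lift_tmul]
  change TensorProduct.mapL _ _ * TensorProduct.mapL _ _ = _
  rw [← TensorProduct.mapL_mul, one_mul, mul_one]

theorem inner_productRep (π : A →⋆ₐ[ℂ] (H →L[ℂ] H)) (ρ : B →⋆ₐ[ℂ] (K →L[ℂ] K))
    (x : A ⊗[ℂ] B) (v w : H ⊗[ℂ] K) :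
    inner ℂ (productRep π ρ (star x) v) w = inner ℂ v (productRep π ρ x w) := by
  induction x with
  | zero => simp
  | add x y hx hy => simp only [star_add, map_add, add_apply, inner_add_left,
      inner_add_right, hx, hy]
  | tmul a b =>
    rw [TensorProduct.star_tmul, productRep_tmul, productRep_tmul]
    induction v with
    | zero => simp
    | add v v' hv hv' => simp only [map_add, inner_add_left, hv, hv']
    | tmul h k =>
      induction w with
      | zero => simp
      | add w w' hw hw' => simp only [map_add, inner_add_right, hw, hw']
      | tmul h' k' =>
        rw [TensorProduct.mapL_tmul, TensorProduct.mapL_tmul, TensorProduct.inner_tmul,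
          TensorProduct.inner_tmul, StarHomClass.map_star, StarHomClass.map_star,
          ContinuousLinearMap.star_eq_adjoint, ContinuousLinearMap.star_eq_adjoint,
          ContinuousLinearMap.adjoint_inner_left, ContinuousLinearMap.adjoint_inner_left]

/-- The `C*`-seminorm `x ↦ ‖(π ⊗ ρ) x‖` on `A ⊙ B`. -/
def productRepSeminorm (π : A →⋆ₐ[ℂ] (H →L[ℂ] H)) (ρ : B →⋆ₐ[ℂ] (K →L[ℂ] K)) :
    CStarSeminorm (A ⊗[ℂ] B) :=
  CStarSeminorm.ofRep (E := H ⊗[ℂ] K) (productRep π ρ) (inner_productRep π ρ)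

theorem productRepSeminorm_apply (π : A →⋆ₐ[ℂ] (H →L[ℂ] H)) (ρ : B →⋆ₐ[ℂ] (K →L[ℂ] K))
    (x : A ⊗[ℂ] B) : productRepSeminorm π ρ x = ‖productRep π ρ x‖ := rfl

end ProductRep

variable (A B)

/-- The `C*`-seminorms on `A ⊙ B` given by pairs of representations of `A` and `B` on Hilbert
spaces. -/
def spatialSeminorms : Set (CStarSeminorm (A ⊗[ℂ] B)) :=
  {q | ∃ (H : Type u) (K : Type v) (_ : NormedAddCommGroup H) (_ : InnerProductSpace ℂ H)
      (_ : CompleteSpace H) (_ : NormedAddCommGroup K) (_ : InnerProductSpace ℂ K)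
      (_ : CompleteSpace K) (π : A →⋆ₐ[ℂ] (H →L[ℂ] H)) (ρ : B →⋆ₐ[ℂ] (K →L[ℂ] K)),
      q = productRepSeminorm π ρ}

theorem bddAbove_spatialSeminorms (x : A ⊗[ℂ] B) :
    BddAbove ((fun q : CStarSeminorm (A ⊗[ℂ] B) => q x) '' spatialSeminorms A B) := by
  have key : ∃ C, ∀ q ∈ spatialSeminorms A B, q.toFun x ≤ C := by
    induction x with
    | zero => exact ⟨0, fun q _ => (map_zero q.toSeminorm).le⟩
    | add x y hx hy =>
      obtain ⟨C, hC⟩ := hx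
      obtain ⟨D, hD⟩ := hy
      exact ⟨C + D, fun q hq => (q.add_le x y).trans (add_le_add (hC q hq) (hD q hq))⟩
    | tmul a b =>
      refine ⟨‖a‖ * ‖b‖, ?_⟩
      rintro q ⟨H, K, _, _, _, _, _, _, π, ρ, rfl⟩
      rw [productRepSeminorm_apply, productRep_tmul]
      refine (TensorProduct.norm_mapL_le _ _).trans ?_
      exact mul_le_mul (NonUnitalStarAlgHom.norm_apply_le π a)
        (NonUnitalStarAlgHom.norm_apply_le ρ b) (norm_nonneg _) (norm_nonneg _)
  obtain ⟨C, hC⟩ := key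
  exact ⟨C, by rintro _ ⟨q, hq, rfl⟩; exact hC q hq⟩

/-- The minimal (spatial) `C*`-norm on `A ⊙ B`:
`‖x‖ = sup {‖(π ⊗ ρ) x‖ | π, ρ representations of A, B}`. -/
def minSeminorm : CStarSeminorm (A ⊗[ℂ] B) :=
  CStarSeminorm.sup (spatialSeminorms A B) (bddAbove_spatialSeminorms A B)

/-- The minimal tensor product `A ⊗ B` of two unital `C*`-algebras. -/
def MinTensor : Type (max u v) := (minSeminorm A B).Completion

instance : CStarAlgebra (MinTensor A B) :=
  inferInstanceAs (CStarAlgebra (minSeminorm A B).Completion)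

namespace MinTensor

/-- The canonical map from the algebraic tensor product. -/
def mk : A ⊗[ℂ] B →⋆ₐ[ℂ] MinTensor A B := (minSeminorm A B).toCompletion

theorem denseRange_mk : DenseRange (mk A B) := (minSeminorm A B).denseRange_toCompletion

variable {A B}

/-- The tensor product `φ ⊗ ψ` of unital `*`-homomorphisms on algebraic tensor products. -/
def algMap {A' : Type u} {B' : Type v} [CStarAlgebra A'] [CStarAlgebra B']
    (φ : A →⋆ₐ[ℂ] A') (ψ : B →⋆ₐ[ℂ] B') : A ⊗[ℂ] B →⋆ₐ[ℂ] A' ⊗[ℂ] B' :=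
  { Algebra.TensorProduct.map φ.toAlgHom ψ.toAlgHom with
    map_star' := fun x => by
      change Algebra.TensorProduct.map φ.toAlgHom ψ.toAlgHom (star x) =
        star (Algebra.TensorProduct.map φ.toAlgHom ψ.toAlgHom x)
      induction x with
      | zero => simp
      | add x y hx hy => simp only [star_add, map_add, hx, hy]
      | tmul a b =>
        rw [TensorProduct.star_tmul, Algebra.TensorProduct.map_tmul,
          Algebra.TensorProduct.map_tmul, TensorProduct.star_tmul]
        exact congrArg₂ _ (StarHomClass.map_star φ a) (StarHomClass.map_star ψ b) }

theorem algMap_tmul {A' : Type u} {B' : Type v} [CStarAlgebra A'] [CStarAlgebra B']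
    (φ : A →⋆ₐ[ℂ] A') (ψ : B →⋆ₐ[ℂ] B') (a : A) (b : B) :
    algMap φ ψ (a ⊗ₜ b) = φ a ⊗ₜ ψ b := rfl

theorem minSeminorm_algMap_le {A' : Type u} {B' : Type v} [CStarAlgebra A'] [CStarAlgebra B']
    (φ : A →⋆ₐ[ℂ] A') (ψ : B →⋆ₐ[ℂ] B') (x : A ⊗[ℂ] B) :
    minSeminorm A' B' (algMap φ ψ x) ≤ minSeminorm A B x := by
  refine CStarSeminorm.sup_le _ ((minSeminorm A B).nonneg x) ?_
  rintro q ⟨H, K, _, _, _, _, _, _, π, ρ, rfl⟩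
  have h : productRepSeminorm π ρ (algMap φ ψ x) =
      productRepSeminorm (π.comp φ) (ρ.comp ψ) x := by
    rw [productRepSeminorm_apply, productRepSeminorm_apply]
    congr 1
    induction x with
    | zero => simp
    | add x y hx hy => simp only [map_add, hx, hy]
    | tmul a b => rw [algMap_tmul, productRep_tmul, productRep_tmul]; rfl
  rw [h]
  exact CStarSeminorm.le_sup _ (p := productRepSeminorm (π.comp φ) (ρ.comp ψ))
    (show _ ∈ spatialSeminorms A B from ⟨H, K, _, _, _, _, _, _, _, _, rfl⟩) x

/-- The tensor product `φ ⊗ ψ : A ⊗ B → A' ⊗ B'` of unital `*`-homomorphisms on minimal tensor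
products. -/
def map {A' : Type u} {B' : Type v} [CStarAlgebra A'] [CStarAlgebra B']
    (φ : A →⋆ₐ[ℂ] A') (ψ : B →⋆ₐ[ℂ] B') : MinTensor A B →⋆ₐ[ℂ] MinTensor A' B' :=
  (minSeminorm A B).lift ((mk A' B').comp (algMap φ ψ)) fun x =>
    ((minSeminorm A' B').norm_toCompletion (algMap φ ψ x)).le.trans (minSeminorm_algMap_le φ ψ x)

theorem map_mk {A' : Type u} {B' : Type v} [CStarAlgebra A'] [CStarAlgebra B']
    (φ : A →⋆ₐ[ℂ] A') (ψ : B →⋆ₐ[ℂ] B') (x : A ⊗[ℂ] B) :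
    map φ ψ (mk A B x) = mk A' B' (algMap φ ψ x) :=
  (minSeminorm A B).lift_toCompletion _ _ x

end MinTensor

end MinTensor

/-! ### Compact quantum groups and their isomorphisms -/

/-- The pair `(C(𝔾), Δ)` underlying a compact quantum group `𝔾`: a unital `C*`-algebra together
with a comultiplication `Δ : C(𝔾) → C(𝔾) ⊗ C(𝔾)` (minimal tensor product). -/
structure QuantumGroup where
  /-- The `C*`-algebra `C(𝔾)`. -/
  algebra : Type u
  [cstarAlgebra : CStarAlgebra algebra]
  /-- The comultiplication. -/
  comul : algebra →⋆ₐ[ℂ] MinTensor algebra algebra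

attribute [instance] QuantumGroup.cstarAlgebra

/-- `𝔾` and `ℍ` are isomorphic as compact quantum groups: there is a `*`-isomorphism
`φ : C(𝔾) → C(ℍ)` with `Δ_ℍ ∘ φ = (φ ⊗ φ) ∘ Δ_𝔾`. -/
def QuantumGroup.Isomorphic (G H : QuantumGroup.{u}) : Prop :=
  ∃ φ : G.algebra ≃⋆ₐ[ℂ] H.algebra,
    ∀ a, H.comul (φ a) =
      MinTensor.map (φ : G.algebra →⋆ₐ[ℂ] H.algebra) (φ : G.algebra →⋆ₐ[ℂ] H.algebra) (G.comul a)

/-! ### The quantum automorphism group of a graph -/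

section Qut

variable {W : Type u} [Fintype W] (G : SimpleGraph W)

/-- The matrix of generators `u_{ij}`, `i, j ∈ W`. -/
def genMatrix (W : Type u) : Matrix W W (FreeStarAlgebra (W × W)) :=
  Matrix.of fun i j => FreeStarAlgebra.gen (i, j)

open Classical in
/-- The relations of the quantum automorphism group of a finite graph: the `u_{ij}` are
projections, the rows and the columns of `u` sum to `1`, and `u` commutes with the adjacency
matrix. -/
inductive QutRel : FreeStarAlgebra (W × W) → Prop
  | selfAdjoint (i j : W) : QutRel (genMatrix W i j - star (genMatrix W i j))
  | idempotent (i j : W) : QutRel (genMatrix W i j - genMatrix W i j * genMatrix W i j)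
  | row (i : W) : QutRel (∑ l, genMatrix W i l - 1)
  | column (i : W) : QutRel (∑ l, genMatrix W l i - 1)
  | adjacency (i j : W) : QutRel
      ((G.adjMatrix (FreeStarAlgebra (W × W)) * genMatrix W) i j -
        (genMatrix W * G.adjMatrix (FreeStarAlgebra (W × W))) i j)

/-- The set of relations of the quantum automorphism group. -/
def qutRelations : Set (FreeStarAlgebra (W × W)) := {r | QutRel G r}

instance : BoundedRelations (qutRelations G) :=
  BoundedRelations.of_gen fun x => ⟨1, fun q hq => by
    obtain ⟨i, j⟩ := x
    have key : ∀ a b : FreeStarAlgebra (W × W), q.toFun (a - b) = 0 → q.toFun a ≤ q.toFun b := by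
      intro a b h
      have := q.add_le (a - b) b
      rwa [sub_add_cancel, h, zero_add] at this
    have key' : ∀ a b : FreeStarAlgebra (W × W), q.toFun (a - b) = 0 → q.toFun b ≤ q.toFun a :=
      fun a b h => key b a (by rw [← h, ← neg_sub]; exact map_neg_eq_map q.toSeminorm _)
    set a : FreeStarAlgebra (W × W) := FreeStarAlgebra.gen (i, j)
    have h1 : q.toFun (a - star a) = 0 := hq _ (QutRel.selfAdjoint i j)
    have h2 : q.toFun (a - a * a) = 0 := hq _ (QutRel.idempotent i j)
    have h3 : q.toFun (star a * a - a * a) = 0 := by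
      refine le_antisymm ?_ (q.nonneg _)
      rw [← sub_mul, ← neg_sub, neg_mul]
      refine (map_neg_eq_map q.toSeminorm _).le.trans ((q.mul_le _ _).trans ?_)
      rw [h1, zero_mul]
    have h4 : q.toFun (star a * a) ≤ q.toFun a := (key _ _ h3).trans (key' _ _ h2)
    rw [q.star_mul_self] at h4
    by_contra! h5
    nlinarith⟩

/-- The `C*`-algebra `C(Qut(G))`. -/
abbrev QutAlgebra : Type u := UniversalCStarAlgebra (qutRelations G)

/-- The fundamental representation `u` of `Qut(G)`. -/
def qutMatrix : Matrix W W (QutAlgebra G) :=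
  Matrix.of fun i j => UniversalCStarAlgebra.of (qutRelations G) (i, j)

theorem qutMatrix_star (i j : W) : star (qutMatrix G i j) = qutMatrix G i j := by
  have h := UniversalCStarAlgebra.mk_eq_zero (R := qutRelations G) (QutRel.selfAdjoint i j)
  rw [map_sub, StarHomClass.map_star, sub_eq_zero] at h
  exact h.symm

theorem qutMatrix_mul_self (i j : W) :
    qutMatrix G i j * qutMatrix G i j = qutMatrix G i j := by
  have h := UniversalCStarAlgebra.mk_eq_zero (R := qutRelations G) (QutRel.idempotent i j)
  rw [map_sub, map_mul, sub_eq_zero] at h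
  exact h.symm

theorem qutMatrix_row (i : W) : ∑ l, qutMatrix G i l = 1 := by
  have h := UniversalCStarAlgebra.mk_eq_zero (R := qutRelations G) (QutRel.row i)
  rw [map_sub, map_sum, map_one, sub_eq_zero] at h
  exact h

theorem qutMatrix_column (i : W) : ∑ l, qutMatrix G l i = 1 := by
  have h := UniversalCStarAlgebra.mk_eq_zero (R := qutRelations G) (QutRel.column i)
  rw [map_sub, map_sum, map_one, sub_eq_zero] at h
  exact h

open Classical in
theorem qutMatrix_adjacency (i j : W) :
    ∑ k, (if G.Adj i k then qutMatrix G k j else 0) =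
      ∑ k, (if G.Adj k j then qutMatrix G i k else 0) := by
  have h := UniversalCStarAlgebra.mk_eq_zero (R := qutRelations G) (QutRel.adjacency i j)
  rw [map_sub, sub_eq_zero, Matrix.mul_apply, Matrix.mul_apply, map_sum, map_sum] at h
  simp only [SimpleGraph.adjMatrix_apply, apply_ite, map_zero, ite_mul, one_mul, zero_mul,
    mul_one, mul_zero] at h
  exact h

/-- Projections in a `C*`-algebra that sum to `1` are pairwise orthogonal. -/
theorem mul_eq_zero_of_sum_eq_one {A : Type v} [CStarAlgebra A] {p : W → A}
    (hstar : ∀ i, star (p i) = p i) (hmul : ∀ i, p i * p i = p i) (hsum : ∑ i, p i = 1)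
    {k l : W} (hkl : k ≠ l) : p k * p l = 0 := by
  classical
  let _ : PartialOrder A := CStarAlgebra.spectralOrder A
  have _ : StarOrderedRing A := CStarAlgebra.spectralOrderedRing A
  have h0 : ∑ i ∈ Finset.univ.erase l, star (p i * p l) * (p i * p l) = 0 := by
    have h1 : ∑ i, star (p i * p l) * (p i * p l) = p l := by
      have h2 : ∀ i, star (p i * p l) * (p i * p l) = p l * p i * p l := fun i => by
        rw [star_mul, hstar, hstar, mul_assoc, ← mul_assoc (p i), hmul, mul_assoc]
      simp_rw [h2, ← Finset.sum_mul, ← Finset.mul_sum, hsum, mul_one, hmul]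
    rw [← Finset.add_sum_erase _ _ (Finset.mem_univ l)] at h1
    rw [hmul, hstar, hmul] at h1
    exact left_eq_add.mp h1.symm
  have h3 := (Finset.sum_eq_zero_iff_of_nonneg fun i _ => star_mul_self_nonneg (p i * p l)).mp h0 k
    (Finset.mem_erase.mpr ⟨hkl, Finset.mem_univ k⟩)
  exact CStarRing.star_mul_self_eq_zero_iff _ |>.mp h3

/-- The element `∑ k, u_{ik} ⊗ u_{kj}`. -/
def qutComulGen (x : W × W) : QutAlgebra G ⊗[ℂ] QutAlgebra G :=
  ∑ k, qutMatrix G x.1 k ⊗ₜ qutMatrix G k x.2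

theorem qutComulGen_relations (r : FreeStarAlgebra (W × W)) (hr : r ∈ qutRelations G) :
    FreeStarAlgebra.eval (fun x => MinTensor.mk _ _ (qutComulGen G x)) r = 0 := by
  classical
  have hgen : ∀ i j, FreeStarAlgebra.eval (fun x => MinTensor.mk _ _ (qutComulGen G x))
      (genMatrix W i j) = MinTensor.mk _ _ (qutComulGen G (i, j)) := fun i j =>
    FreeStarAlgebra.eval_gen _ (i, j)
  cases hr with
  | selfAdjoint i j =>
    rw [map_sub, StarHomClass.map_star, hgen, ← StarHomClass.map_star, sub_eq_zero]
    congr 1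
    simp only [qutComulGen, star_sum, TensorProduct.star_tmul, qutMatrix_star]
  | idempotent i j =>
    rw [map_sub, map_mul, hgen, ← map_mul, sub_eq_zero]
    congr 1
    simp only [qutComulGen, Finset.sum_mul_sum, Algebra.TensorProduct.tmul_mul_tmul]
    refine Finset.sum_congr rfl fun k _ => ?_
    rw [Finset.sum_eq_single k]
    · rw [qutMatrix_mul_self, qutMatrix_mul_self]
    · intro l _ hl
      rw [mul_eq_zero_of_sum_eq_one (qutMatrix_star G i) (qutMatrix_mul_self G i)
        (qutMatrix_row G i) hl.symm, TensorProduct.zero_tmul]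
    · exact fun h => absurd (Finset.mem_univ k) h
  | row i =>
    rw [map_sub, map_sum, map_one, sub_eq_zero]
    simp_rw [hgen]
    rw [← map_sum, ← map_one (MinTensor.mk (QutAlgebra G) (QutAlgebra G))]
    congr 1
    simp only [qutComulGen]
    rw [Finset.sum_comm]
    simp_rw [← TensorProduct.tmul_sum, qutMatrix_row, ← TensorProduct.sum_tmul, qutMatrix_row]
    rfl
  | column i =>
    rw [map_sub, map_sum, map_one, sub_eq_zero]
    simp_rw [hgen]
    rw [← map_sum, ← map_one (MinTensor.mk (QutAlgebra G) (QutAlgebra G))]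
    congr 1
    simp only [qutComulGen]
    rw [Finset.sum_comm]
    simp_rw [← TensorProduct.sum_tmul, qutMatrix_column, ← TensorProduct.tmul_sum,
      qutMatrix_column]
    rfl
  | adjacency i j =>
    rw [map_sub, sub_eq_zero, Matrix.mul_apply, Matrix.mul_apply, map_sum, map_sum]
    simp only [SimpleGraph.adjMatrix_apply, apply_ite, map_zero, ite_mul, one_mul, zero_mul,
      mul_one, mul_zero, hgen]
    have h1 : ∀ (P : W → Prop) (f : W → W × W),
        ∑ k, (if P k then MinTensor.mk (QutAlgebra G) (QutAlgebra G) (qutComulGen G (f k)) else 0) =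
        MinTensor.mk _ _ (∑ k, if P k then qutComulGen G (f k) else 0) := by
      intro P f
      rw [map_sum]
      refine Finset.sum_congr rfl fun k _ => ?_
      split_ifs
      · rfl
      · rw [map_zero]
    rw [h1, h1]
    congr 1
    simp only [qutComulGen]
    have h2 : ∀ k, (if G.Adj i k then ∑ l, qutMatrix G k l ⊗ₜ[ℂ] qutMatrix G l j else 0) =
        ∑ l, (if G.Adj i k then qutMatrix G k l else 0) ⊗ₜ[ℂ] qutMatrix G l j := fun k => by
      split_ifs <;> simp
    have h3 : ∀ k, (if G.Adj k j then ∑ l, qutMatrix G i l ⊗ₜ[ℂ] qutMatrix G l k else 0) =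
        ∑ l, qutMatrix G i l ⊗ₜ[ℂ] (if G.Adj k j then qutMatrix G l k else 0) := fun k => by
      split_ifs <;> simp
    simp_rw [h2, h3]
    rw [Finset.sum_comm]
    conv_rhs => rw [Finset.sum_comm]
    simp_rw [← TensorProduct.sum_tmul, ← TensorProduct.tmul_sum, qutMatrix_adjacency,
      TensorProduct.sum_tmul, ← qutMatrix_adjacency, TensorProduct.tmul_sum]
    rw [Finset.sum_comm]
    refine Finset.sum_congr rfl fun k _ => Finset.sum_congr rfl fun l _ => ?_
    by_cases h : G.Adj k l
    · rw [if_pos h, if_pos h]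
    · rw [if_neg h, if_neg h, TensorProduct.zero_tmul, TensorProduct.tmul_zero]

/-- The quantum automorphism group `Qut(G)` of a finite graph `G`, with comultiplication
`Δ(u_{ij}) = ∑ k, u_{ik} ⊗ u_{kj}`. -/
def qut : QuantumGroup.{u} where
  algebra := QutAlgebra G
  comul := UniversalCStarAlgebra.lift (fun x => MinTensor.mk _ _ (qutComulGen G x))
    (qutComulGen_relations G)

end Qut

/-! ### The dual of a discrete group -/

section Dual

variable (Γ : Type u) [Group Γ]

/-- The relations of the group `C*`-algebra: the `u_g` are unitary, `u_{gh} = u_g u_h` and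
`u_{g⁻¹} = u_g*`. -/
inductive GroupRel : FreeStarAlgebra Γ → Prop
  | star_mul (g : Γ) : GroupRel (star (FreeStarAlgebra.gen g) * FreeStarAlgebra.gen g - 1)
  | mul_star (g : Γ) : GroupRel (FreeStarAlgebra.gen g * star (FreeStarAlgebra.gen g) - 1)
  | mul (g h : Γ) : GroupRel
      (FreeStarAlgebra.gen (g * h) - FreeStarAlgebra.gen g * FreeStarAlgebra.gen h)
  | inv (g : Γ) : GroupRel (FreeStarAlgebra.gen g⁻¹ - star (FreeStarAlgebra.gen g))

/-- The set of relations of the group `C*`-algebra. -/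
def groupRelations : Set (FreeStarAlgebra Γ) := {r | GroupRel Γ r}

instance : BoundedRelations (groupRelations Γ) :=
  BoundedRelations.of_gen fun g => ⟨1, fun q hq => by
    set a : FreeStarAlgebra Γ := FreeStarAlgebra.gen g
    have h1 : q.toFun (star a * a - 1) = 0 := hq _ (GroupRel.star_mul g)
    have h2 : q.toFun (star a * a) ≤ q.toFun 1 := by
      have := q.add_le (star a * a - 1) 1
      rwa [sub_add_cancel, h1, zero_add] at this
    have h3 : q.toFun 1 = q.toFun 1 * q.toFun 1 := by
      have := q.star_mul_self 1
      rwa [star_one, one_mul] at this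
    rw [q.star_mul_self] at h2
    have h4 : q.toFun 1 ≤ 1 := by
      by_contra! h5
      nlinarith
    by_contra! h5
    nlinarith⟩

/-- The (full) group `C*`-algebra `C*(Γ)`. -/
abbrev GroupCStarAlgebra : Type u := UniversalCStarAlgebra (groupRelations Γ)

variable {Γ}

/-- The unitary `u_g` of `C*(Γ)`. -/
def groupUnitary (g : Γ) : GroupCStarAlgebra Γ := UniversalCStarAlgebra.of (groupRelations Γ) g

theorem groupUnitary_star_mul (g : Γ) : star (groupUnitary g) * groupUnitary g = 1 := by
  have h := UniversalCStarAlgebra.mk_eq_zero (R := groupRelations Γ) (GroupRel.star_mul g)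
  rw [map_sub, map_mul, StarHomClass.map_star, map_one, sub_eq_zero] at h
  exact h

theorem groupUnitary_mul_star (g : Γ) : groupUnitary g * star (groupUnitary g) = 1 := by
  have h := UniversalCStarAlgebra.mk_eq_zero (R := groupRelations Γ) (GroupRel.mul_star g)
  rw [map_sub, map_mul, StarHomClass.map_star, map_one, sub_eq_zero] at h
  exact h

theorem groupUnitary_mul (g h : Γ) : groupUnitary (g * h) = groupUnitary g * groupUnitary h := by
  have h := UniversalCStarAlgebra.mk_eq_zero (R := groupRelations Γ) (GroupRel.mul g h)
  rw [map_sub, map_mul, sub_eq_zero] at h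
  exact h

theorem groupUnitary_inv (g : Γ) : groupUnitary g⁻¹ = star (groupUnitary g) := by
  have h := UniversalCStarAlgebra.mk_eq_zero (R := groupRelations Γ) (GroupRel.inv g)
  rw [map_sub, StarHomClass.map_star, sub_eq_zero] at h
  exact h

theorem groupComul_relations (r : FreeStarAlgebra Γ) (hr : r ∈ groupRelations Γ) :
    FreeStarAlgebra.eval (fun g : Γ => MinTensor.mk (GroupCStarAlgebra Γ) (GroupCStarAlgebra Γ)
      (groupUnitary g ⊗ₜ groupUnitary g)) r = 0 := by
  cases hr with
  | star_mul g =>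
    rw [map_sub, map_mul, StarHomClass.map_star, FreeStarAlgebra.eval_gen, map_one,
      ← StarHomClass.map_star, ← map_mul, TensorProduct.star_tmul,
      Algebra.TensorProduct.tmul_mul_tmul, groupUnitary_star_mul, sub_eq_zero]
    exact map_one (MinTensor.mk (GroupCStarAlgebra Γ) (GroupCStarAlgebra Γ))
  | mul_star g =>
    rw [map_sub, map_mul, StarHomClass.map_star, FreeStarAlgebra.eval_gen, map_one,
      ← StarHomClass.map_star, ← map_mul, TensorProduct.star_tmul,
      Algebra.TensorProduct.tmul_mul_tmul, groupUnitary_mul_star, sub_eq_zero]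
    exact map_one (MinTensor.mk (GroupCStarAlgebra Γ) (GroupCStarAlgebra Γ))
  | mul g h =>
    rw [map_sub, map_mul, FreeStarAlgebra.eval_gen, FreeStarAlgebra.eval_gen,
      FreeStarAlgebra.eval_gen, ← map_mul, Algebra.TensorProduct.tmul_mul_tmul, groupUnitary_mul,
      sub_self]
  | inv g =>
    rw [map_sub, StarHomClass.map_star, FreeStarAlgebra.eval_gen, FreeStarAlgebra.eval_gen,
      ← StarHomClass.map_star, TensorProduct.star_tmul, groupUnitary_inv, sub_self]

variable (Γ)

/-- The dual `Γ̂` of a discrete group `Γ`: the `C*`-algebra `C*(Γ)` with the comultiplication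
`Δ(u_g) = u_g ⊗ u_g`. -/
def groupDual : QuantumGroup.{u} where
  algebra := GroupCStarAlgebra Γ
  comul := UniversalCStarAlgebra.lift
    (fun g : Γ => MinTensor.mk _ _ (groupUnitary g ⊗ₜ groupUnitary g)) groupComul_relations

end Dual

/-! ### Solution groups -/

/-- The relations of the homogeneous solution group of `M x = 0`: the generators `x_i` are
involutions, generators occurring in a common equation commute, and for each row `k` the product of
the `x_i` with `M k i = 1` (in any order) is trivial. -/
inductive SolutionRel {m : Type v} {n : Type u} (M : Matrix m n (ZMod 2)) : FreeGroup n → Prop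
  | sq (i : n) : SolutionRel M (FreeGroup.of i ^ 2)
  | comm (k : m) (i j : n) (hi : M k i = 1) (hj : M k j = 1) :
      SolutionRel M (FreeGroup.of i * FreeGroup.of j * (FreeGroup.of i)⁻¹ * (FreeGroup.of j)⁻¹)
  | prod (k : m) (l : List n) (hl : l.Nodup) (h : ∀ i, i ∈ l ↔ M k i = 1) :
      SolutionRel M (l.map FreeGroup.of).prod

/-- The homogeneous solution group `Γ(M, 0)` of the linear system `M x = 0` over `𝔽₂`. -/
abbrev HomogeneousSolutionGroup {m : Type v} {n : Type u} (M : Matrix m n (ZMod 2)) : Type u :=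
  PresentedGroup {r | SolutionRel M r}

/-! ### Colored graphs and decoloring -/

/-- An edge-colored graph. Only the values of `edgeColor` on edges are meaningful. -/
structure EdgeColoredGraph (V : Type u) (D : Type v) where
  graph : SimpleGraph V
  edgeColor : Sym2 V → D

/-- A vertex- and edge-colored graph. -/
structure ColoredGraph (V : Type u) (C : Type w) (D : Type v) extends EdgeColoredGraph V D where
  vertexColor : V → C

/-- The colors that occur on edges. -/
def EdgeColoredGraph.colors {V : Type u} {D : Type v} (G : EdgeColoredGraph V D) : Set D :=
  G.edgeColor '' G.graph.edgeSet

/-- The vertices of the graph obtained from `G` by attaching to every vertex `v` a path of length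
`ℓ (c v)`: the pair `(v, i)` is the vertex at distance `i` from `v = (v, 0)` on the path at `v`. -/
abbrev PathVertex {V : Type u} {C : Type w} {D : Type v} (G : ColoredGraph V C D) (ℓ : C → ℕ) :
    Type u := Σ v : V, Fin (ℓ (G.vertexColor v) + 1)

/-- The edge-colored graph `G'`: attach a path of length `ℓ c` to every vertex of color `c`, give
the edges of these paths the color `c₀`, and forget the vertex colors. -/
def ColoredGraph.attachPaths {V : Type u} {C : Type w} {D : Type v} (G : ColoredGraph V C D)
    (ℓ : C → ℕ) (c₀ : D) : EdgeColoredGraph (PathVertex G ℓ) D where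
  graph :=
    { Adj := fun x y =>
        ((x.2 : ℕ) = 0 ∧ (y.2 : ℕ) = 0 ∧ G.graph.Adj x.1 y.1) ∨
          (x.1 = y.1 ∧ ((x.2 : ℕ) + 1 = y.2 ∨ (y.2 : ℕ) + 1 = x.2))
      symm := ⟨by
        rintro x y (⟨hx, hy, h⟩ | ⟨h, h'⟩)
        · exact Or.inl ⟨hy, hx, h.symm⟩
        · exact Or.inr ⟨h.symm, h'.symm⟩⟩
      loopless := ⟨by
        rintro x (⟨-, -, h⟩ | ⟨-, h⟩)
        · exact G.graph.irrefl h
        · omega⟩ }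
  edgeColor := Sym2.lift ⟨fun x y =>
      if (x.2 : ℕ) = 0 ∧ (y.2 : ℕ) = 0 then G.edgeColor s(x.1, y.1) else c₀, by
    intro x y
    dsimp only
    rw [Sym2.eq_swap]
    exact if_congr and_comm rfl rfl⟩

/-- The vertices of the graph obtained by subdividing every edge `e` of color different from `c₀`
and attaching a path of length `ℓ (c e)` to the subdividing vertex: `inl v` is the old vertex `v`,
and `inr (e, i)` is the vertex at distance `i` from the subdividing vertex `inr (e, 0)` of `e`. -/
abbrev SubdivisionVertex {V : Type u} {D : Type v} (G : EdgeColoredGraph V D) (ℓ : D → ℕ)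
    (c₀ : D) : Type u :=
  V ⊕ Σ e : {e : Sym2 V // e ∈ G.graph.edgeSet ∧ G.edgeColor e ≠ c₀},
    Fin (ℓ (G.edgeColor e.1) + 1)

/-- Subdivide every edge of color `c ≠ c₀`, attach a path of length `ℓ c` to the subdividing
vertex, and forget the edge colors. -/
def EdgeColoredGraph.subdivide {V : Type u} {D : Type v} (G : EdgeColoredGraph V D) (ℓ : D → ℕ)
    (c₀ : D) : SimpleGraph (SubdivisionVertex G ℓ c₀) where
  Adj x y :=
    match x, y with
    | Sum.inl v, Sum.inl w => G.graph.Adj v w ∧ G.edgeColor s(v, w) = c₀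
    | Sum.inl v, Sum.inr f => v ∈ f.1.1 ∧ (f.2 : ℕ) = 0
    | Sum.inr e, Sum.inl w => w ∈ e.1.1 ∧ (e.2 : ℕ) = 0
    | Sum.inr e, Sum.inr f => e.1 = f.1 ∧ ((e.2 : ℕ) + 1 = f.2 ∨ (f.2 : ℕ) + 1 = e.2)
  symm := ⟨by
    rintro (v | e) (w | f) h
    · exact ⟨h.1.symm, by rw [Sym2.eq_swap]; exact h.2⟩
    · exact h
    · exact h
    · exact ⟨h.1.symm, h.2.symm⟩⟩
  loopless := ⟨by
    rintro (v | e) h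
    · exact G.graph.irrefl h.1
    · have := h.2
      omega⟩

/-- The uncolored graph `G''` obtained from a vertex- and edge-colored graph `G` by decoloring
first the vertices, with paths of lengths `ℓV`, and then the edges, with paths of lengths `ℓE`;
`c₀` is the edge color that is used for the paths at the vertices and that is not subdivided. -/
def ColoredGraph.decolor {V : Type u} {C : Type w} {D : Type v} (G : ColoredGraph V C D)
    (ℓV : C → ℕ) (ℓE : D → ℕ) (c₀ : D) :
    SimpleGraph (SubdivisionVertex (G.attachPaths ℓV c₀) ℓE c₀) :=
  (G.attachPaths ℓV c₀).subdivide ℓE c₀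

instance {V : Type u} {D : Type v} [Finite V] (G : EdgeColoredGraph V D) (ℓ : D → ℕ) (c₀ : D) :
    Fintype (SubdivisionVertex G ℓ c₀) :=
  Fintype.ofFinite _

/-! ### The colored graphs of a linear system -/

section LinearSystem

variable {m : Type v} {n : Type u} [Fintype n] [DecidableEq n]

/-- The set `S_k` of the variables that occur in the equation `k`. -/
def equationSupport (M : Matrix m n (ZMod 2)) (k : m) : Finset n := {i | M k i = 1}

/-- The vertices of `G(M, b)`: pairs `(k, α)` with `α : S_k → {1, -1}` such that
`∏ i, α i = (-1)^(b k)`. -/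
abbrev SystemVertex (M : Matrix m n (ZMod 2)) (b : m → ZMod 2) : Type (max u v) :=
  Σ k : m, {α : equationSupport M k → ℤˣ // ∏ i, α i = if b k = 0 then 1 else -1}

variable (n) in
/-- The edge colors of `G(M, b)`: functions `S → {1, -1}` on sets `S` of variables. -/
abbrev SignFunction : Type u := Σ S : Finset n, (S → ℤˣ)

/-- The function `α △ β : S_l ∩ S_k → {1, -1}`, `(α △ β) i = α i * β i`. -/
def signProduct {M : Matrix m n (ZMod 2)} {b : m → ZMod 2} (v w : SystemVertex M b) :
    SignFunction n :=
  ⟨equationSupport M v.1 ∩ equationSupport M w.1, fun i =>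
    v.2.1 ⟨i, (Finset.mem_inter.mp i.2).1⟩ * w.2.1 ⟨i, (Finset.mem_inter.mp i.2).2⟩⟩

theorem signProduct_comm {M : Matrix m n (ZMod 2)} {b : m → ZMod 2} (v w : SystemVertex M b) :
    signProduct v w = signProduct w v := by
  refine Sigma.ext (Finset.inter_comm _ _) ?_
  refine Function.hfunext (by simp only [signProduct, Finset.inter_comm]) ?_
  rintro ⟨i, hi⟩ ⟨j, hj⟩ hij
  have h : i = j := by
    refine (Subtype.heq_iff_coe_eq fun x => ?_).mp hij
    simp only [signProduct, Finset.mem_inter, and_comm]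
  subst h
  exact heq_of_eq (mul_comm _ _)

/-- The colored graph `G(M, b)` of the linear system `M x = b`: the vertex `(k, α)` has color `k`,
the vertices `(l, α) ≠ (k, β)` are adjacent if and only if `S_l ∩ S_k ≠ ∅`, and then the edge
between them has color `α △ β`. -/
def systemGraph (M : Matrix m n (ZMod 2)) (b : m → ZMod 2) :
    ColoredGraph (SystemVertex M b) m (SignFunction n) where
  graph :=
    { Adj := fun v w => v ≠ w ∧ (equationSupport M v.1 ∩ equationSupport M w.1).Nonempty
      symm := ⟨fun v w h => ⟨h.1.symm, by rw [Finset.inter_comm]; exact h.2⟩⟩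
      loopless := ⟨fun _ h => h.1 rfl⟩ }
  edgeColor := Sym2.lift ⟨signProduct, signProduct_comm⟩
  vertexColor v := v.1

variable (n) in
/-- The edge colors of `G_*(M, b)`: `none` is the color `-1` of the edges between different parts
`V_l` and `V_k`; the edges inside a part `V_k` keep their color. -/
abbrev ReducedColor : Type u := Option (SignFunction n)

open Classical in
/-- The colored graph `G_*(M, b)`, for systems in which any two equations have at most one common
variable: an edge of `G(M, b)` between `(l, α)` and `(k, β)` with `l ≠ k` and `S_l ∩ S_k = {i}` is
recolored by the number `α i * β i`, and the edges of color `1` are then removed. -/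
def reducedSystemGraph (M : Matrix m n (ZMod 2)) (b : m → ZMod 2) :
    ColoredGraph (SystemVertex M b) m (ReducedColor n) where
  graph :=
    { Adj := fun v w => (systemGraph M b).graph.Adj v w ∧
        (v.1 ≠ w.1 → ∀ i, (signProduct v w).2 i = -1)
      symm := ⟨fun v w h => ⟨h.1.symm, fun hne => by
        rw [signProduct_comm]; exact h.2 hne.symm⟩⟩
      loopless := ⟨fun _ h => h.1.1 rfl⟩ }
  edgeColor := Sym2.lift ⟨fun v w => if v.1 = w.1 then some (signProduct v w) else none, by
    intro v w
    dsimp only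
    rw [signProduct_comm]
    exact if_congr eq_comm rfl rfl⟩
  vertexColor v := v.1

end LinearSystem

/-- The incidence matrix `M_H` of a graph `H` over `𝔽₂`, with rows indexed by the vertices and
columns indexed by the edges of `H`. -/
def incidenceMatrix {V : Type u} (H : SimpleGraph V) [DecidableEq V] [DecidableRel H.Adj] :
    Matrix V H.edgeSet (ZMod 2) :=
  (H.incMatrix (ZMod 2)).submatrix id Subtype.val

end

noncomputable section

open scoped TensorProduct

universe u v w

/-! ### Quantum automorphisms of a graph in a `C*`-algebra -/

/-! The graph is studied through a model: the vertices over an equation `k` form the group `A k` of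
sign functions on `S_k` with product `1`, a group of exponent two, and the color of the edge between
`a` and `b` in `A k` is determined by the product `a * b`. Thus translations of `A k` preserve all
labels inside the part `k`, and the question is which noncommuting families of translations also
preserve the edges between the parts.

Rigidity. If a property of vertices is respected by a quantum automorphism `q`, so is the number of
neighbours with that property (`card_nbrs_eq`). A few rounds of such counting separate group
elements, subdividing vertices and path vertices (`respects_old`, `respects_sub`); the path lengths
then reveal the part of a group element and the label of a subdivided edge (`type_eq`). Preservation
of labels forces `q a b * q a' b' = 0` unless `a * a' = b * b'` (`mul_old_eq`). Hence on the group
`A k` the entries depend only on the product: `q a b = P k (a * b)` for a projection-valued measure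
`P k` on `A k`, and `P k c` acts as the translation by `c` on everything over `k`, subdividing
vertices and paths included (`mul_firstRow`). The edges between two parts give one more condition:
if `P k c * P l d ≠ 0`, then translating by `c` and `d` preserves the adjacency between the parts
`k` and `l`. Conversely, every such compatible family defines a quantum automorphism
(`CompatiblePVM.isQuantumAut`), and it is recovered from it (`eq_quantumAut`).

Spectral theory. A projection-valued measure on the sign functions on `S_k` with product `1` is the
joint spectral measure of commuting symmetries `x i`, `i ∈ S_k`, whose product is `1`. Compatibility
says that nonzero products occur only for `c` and `d` that agree at the common variable, which means
that the symmetry `x i` is the same computed from any equation containing `i`. So compatible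
families are the same as solutions of the system in a C*-algebra, that is, representations of the
solution group (`IsSolution.exists_spectral`, `CompatiblePVM.exists_solution`). The two universal
algebras are therefore isomorphic.

Comultiplication. On first rows the comultiplication of `Qut` is the convolution `P k c ↦ ∑ d, P k d
⊗ P k (d * c)`. The symmetry `x i` is the sum of the `P k c` weighted by the character `c ↦ c i` of
`A k`, so it is group-like, as in the dual of the group. -/

open Classical in
/-- A magic unitary `q` with entries in a `C*`-algebra that commutes with the adjacency matrix
of the graph `G`. -/
structure IsQuantumAut {W : Type u} [Fintype W] (G : SimpleGraph W) {B : Type v} [CStarAlgebra B]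
    (q : W → W → B) : Prop where
  star_eq : ∀ x y, star (q x y) = q x y
  idem : ∀ x y, q x y * q x y = q x y
  row : ∀ x, ∑ y, q x y = 1
  column : ∀ y, ∑ x, q x y = 1
  adjacency : ∀ x y, ∑ z, (if G.Adj x z then q z y else 0) = ∑ z, (if G.Adj z y then q x z else 0)

theorem qutMatrix_isQuantumAut {W : Type u} [Fintype W] (G : SimpleGraph W) :
    IsQuantumAut G (fun x y => qutMatrix G x y) where
  star_eq := qutMatrix_star G
  idem := qutMatrix_mul_self G
  row := qutMatrix_row G
  column := qutMatrix_column G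
  adjacency := qutMatrix_adjacency G

/-- The relations of `C(Qut(G))` hold for the entries of a quantum automorphism. -/
theorem IsQuantumAut.eval_relations {W : Type u} [Fintype W] {G : SimpleGraph W} {B : Type v}
    [CStarAlgebra B] {q : W → W → B} (h : IsQuantumAut G q) (r : FreeStarAlgebra (W × W))
    (hr : r ∈ qutRelations G) : FreeStarAlgebra.eval (fun x : W × W => q x.1 x.2) r = 0 := by
  classical
  have hgen : ∀ i j, FreeStarAlgebra.eval (fun x : W × W => q x.1 x.2) (genMatrix W i j) = q i j :=
    fun i j => FreeStarAlgebra.eval_gen _ (i, j)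
  cases hr with
  | selfAdjoint i j => rw [map_sub, StarHomClass.map_star, hgen, h.star_eq, sub_self]
  | idempotent i j => rw [map_sub, map_mul, hgen, h.idem, sub_self]
  | row i => simp_rw [map_sub, map_sum, map_one, hgen, h.row, sub_self]
  | column i => simp_rw [map_sub, map_sum, map_one, hgen, h.column, sub_self]
  | adjacency i j =>
    rw [map_sub, sub_eq_zero, Matrix.mul_apply, Matrix.mul_apply, map_sum, map_sum]
    simp only [SimpleGraph.adjMatrix_apply, apply_ite, map_zero, ite_mul, one_mul, zero_mul,
      mul_one, mul_zero, hgen]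
    convert h.adjacency i j

/-! ### Vertex properties respected by a quantum automorphism. -/

namespace IsQuantumAut

section Respects

variable {W : Type u} {B : Type v} [Zero B] {q : W → W → B}

/-- A property of the vertices of a graph that is respected by a quantum automorphism. -/
def Respects (q : W → W → B) (p : W → Prop) : Prop := ∀ x y, q x y ≠ 0 → (p x ↔ p y)

theorem Respects.not {p : W → Prop} (hp : Respects q p) : Respects q (fun x => ¬ p x) :=
  fun x y hne => not_congr (hp x y hne)

theorem Respects.and {p p' : W → Prop} (hp : Respects q p) (hp' : Respects q p') :
    Respects q (fun x => p x ∧ p' x) :=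
  fun x y hne => and_congr (hp x y hne) (hp' x y hne)

theorem Respects.or {p p' : W → Prop} (hp : Respects q p) (hp' : Respects q p') :
    Respects q (fun x => p x ∨ p' x) :=
  fun x y hne => or_congr (hp x y hne) (hp' x y hne)

theorem Respects.congr {p p' : W → Prop} (hp : Respects q p) (h : ∀ x, p' x ↔ p x) :
    Respects q p' :=
  fun x y hne => (h x).trans ((hp x y hne).trans (h y).symm)

end Respects

variable {W : Type u} [Fintype W] {G : SimpleGraph W} {B : Type v} [CStarAlgebra B]
  {q : W → W → B}

/-- Relabelling the vertices of a graph along an isomorphism. -/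
theorem comp_equiv (h : IsQuantumAut G q) {W' : Type w} [Fintype W'] {G' : SimpleGraph W'}
    (e : W' ≃ W) (he : ∀ x y, G.Adj (e x) (e y) ↔ G'.Adj x y) :
    IsQuantumAut G' (fun x y => q (e x) (e y)) where
  star_eq _ _ := h.star_eq _ _
  idem _ _ := h.idem _ _
  row x := by rw [← h.row (e x)]; exact e.sum_comp _
  column y := by rw [← h.column (e y)]; exact e.sum_comp (fun x => q x (e y))
  adjacency x y := by
    classical
    have := h.adjacency (e x) (e y)
    rw [← e.sum_comp, ← e.sum_comp] at this
    simpa only [he] using this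

theorem mul_row (h : IsQuantumAut G q) (x : W) {y y' : W} (hy : y ≠ y') :
    q x y * q x y' = 0 :=
  mul_eq_zero_of_sum_eq_one (h.star_eq x) (h.idem x) (h.row x) hy

theorem mul_column (h : IsQuantumAut G q) (y : W) {x x' : W} (hx : x ≠ x') :
    q x y * q x' y = 0 :=
  mul_eq_zero_of_sum_eq_one (fun x => h.star_eq x y) (fun x => h.idem x y) (h.column y) hx

/-- Sandwich the adjacency relation at `(x, w)` between `q x y` and `q z w`. Orthogonality in the
column `w` leaves only `z' = z` on one side, orthogonality in the row `x` leaves only `y' = y` on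
the other, so the two 0-1 adjacency entries multiply the same nonzero element. -/
theorem mul_ne_zero_adj (h : IsQuantumAut G q) {x y z w : W} (hne : q x y * q z w ≠ 0) :
    G.Adj x z ↔ G.Adj y w := by
  classical
  have key : q x y * (∑ z', (if G.Adj x z' then q z' w else 0)) * q z w =
      q x y * (∑ y', (if G.Adj y' w then q x y' else 0)) * q z w := by rw [h.adjacency]
  have h1 : q x y * (∑ z', (if G.Adj x z' then q z' w else 0)) * q z w =
      if G.Adj x z then q x y * q z w else 0 := by
    rw [mul_assoc, Finset.sum_mul, Finset.sum_eq_single z]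
    · split_ifs
      · rw [h.idem]
      · simp
    · intro z' _ hz'
      split_ifs
      · exact h.mul_column w hz'
      · simp
    · simp
  have h2 : q x y * (∑ y', (if G.Adj y' w then q x y' else 0)) * q z w =
      if G.Adj y w then q x y * q z w else 0 := by
    rw [Finset.mul_sum, Finset.sum_eq_single y]
    · split_ifs
      · rw [h.idem]
      · simp
    · intro y' _ hy'
      split_ifs
      · exact h.mul_row x hy'.symm
      · simp
    · simp
  rw [h1, h2] at key
  split_ifs at key with ha hb hb <;> simp_all

open Classical in
/-- The neighbours of `x` with property `p`. -/
def nbrs (G : SimpleGraph W) (p : W → Prop) (x : W) : Finset W := {z | G.Adj x z ∧ p z}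

theorem mem_nbrs {p : W → Prop} {x z : W} : z ∈ nbrs G p x ↔ G.Adj x z ∧ p z := by
  simp [nbrs]

/-- Double counting: multiply `q x y` by the sum of `q z w` over neighbours `z` of `x` and `w` of
`y` with property `p`. The factor `q x y` kills every entry with only one of `z`, `w` in its set, so
for a fixed `z` the sum over `w` may be extended to a full row, and for a fixed `w` the sum over `z`
to a full column. -/
theorem card_nbrs_eq (h : IsQuantumAut G q) {p : W → Prop} (hp : Respects q p) {x y : W}
    (hne : q x y ≠ 0) : (nbrs G p x).card = (nbrs G p y).card := by
  classical
  have h1 : q x y * ∑ z ∈ nbrs G p x, ∑ w ∈ nbrs G p y, q z w = (nbrs G p x).card • q x y := by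
    rw [Finset.mul_sum, ← Finset.sum_const]
    refine Finset.sum_congr rfl fun z hz => ?_
    have hz := mem_nbrs.mp hz
    rw [Finset.mul_sum]
    conv_rhs => rw [← mul_one (q x y), ← h.row z, Finset.mul_sum]
    refine Finset.sum_subset (Finset.subset_univ _) fun w _ hw => ?_
    by_contra hne'
    refine hw (mem_nbrs.mpr ⟨(h.mul_ne_zero_adj hne').mp hz.1, (hp z w ?_).mp hz.2⟩)
    exact fun h0 => hne' (by rw [h0, mul_zero])
  have h2 : q x y * ∑ z ∈ nbrs G p x, ∑ w ∈ nbrs G p y, q z w = (nbrs G p y).card • q x y := by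
    rw [Finset.sum_comm, Finset.mul_sum, ← Finset.sum_const]
    refine Finset.sum_congr rfl fun w hw => ?_
    have hw := mem_nbrs.mp hw
    rw [Finset.mul_sum]
    conv_rhs => rw [← mul_one (q x y), ← h.column w, Finset.mul_sum]
    refine Finset.sum_subset (Finset.subset_univ _) fun z _ hz => ?_
    by_contra hne'
    refine hz (mem_nbrs.mpr ⟨(h.mul_ne_zero_adj hne').mpr hw.1, (hp z w ?_).mpr hw.2⟩)
    exact fun h0 => hne' (by rw [h0, mul_zero])
  have h3 := h1.symm.trans h2
  -- Over `ℂ`, the nonzero vector `q x y` can be cancelled from the two multiples.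
  rw [← Nat.cast_smul_eq_nsmul ℂ, ← Nat.cast_smul_eq_nsmul ℂ, ← sub_eq_zero, ← sub_smul,
    smul_eq_zero, or_iff_left hne, sub_eq_zero] at h3
  exact_mod_cast h3

/-- One round of color refinement: respected properties are closed under counting neighbours. -/
theorem respects_card (h : IsQuantumAut G q) {p : W → Prop} (hp : Respects q p) (n : ℕ) :
    Respects q (fun x => n ≤ (nbrs G p x).card) :=
  fun x y hne => by simp only [h.card_nbrs_eq hp hne]

theorem respects_exists (h : IsQuantumAut G q) {p : W → Prop} (hp : Respects q p) :
    Respects q (fun x => ∃ z, G.Adj x z ∧ p z) :=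
  (h.respects_card hp 1).congr fun x => by
    rw [Finset.one_le_card]
    exact exists_congr fun z => mem_nbrs.symm

theorem sum_row_mul (h : IsQuantumAut G q) (x : W) (b : B) : ∑ y, q x y * b = b := by
  rw [← Finset.sum_mul, h.row, one_mul]

end IsQuantumAut

/-! ### Graphs with paths attached to their vertices -/

/-- The vertices of the graph obtained by attaching to every `b : β` a path of length `len b`. -/
@[ext] structure PathPoint {β : Type u} (len : β → ℕ) where
  base : β
  pos : ℕ
  le : pos ≤ len base

/-- The graph obtained from `Γ` by attaching to every vertex `b` a path of length `len b`. -/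
def pathsGraph {β : Type u} (Γ : SimpleGraph β) (len : β → ℕ) : SimpleGraph (PathPoint len) where
  Adj x y := (x.pos = 0 ∧ y.pos = 0 ∧ Γ.Adj x.base y.base) ∨
    (x.base = y.base ∧ (x.pos + 1 = y.pos ∨ y.pos + 1 = x.pos))
  symm := ⟨by
    rintro x y (⟨hx, hy, h⟩ | ⟨h, h'⟩)
    · exact Or.inl ⟨hy, hx, h.symm⟩
    · exact Or.inr ⟨h.symm, h'.symm⟩⟩
  loopless := ⟨by
    rintro x (⟨-, -, h⟩ | ⟨-, h⟩)
    · exact Γ.irrefl h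
    · omega⟩

namespace PathPoint

variable {β : Type u} {Γ : SimpleGraph β} {len : β → ℕ}

theorem adj_iff {x y : PathPoint len} : (pathsGraph Γ len).Adj x y ↔
    (x.pos = 0 ∧ y.pos = 0 ∧ Γ.Adj x.base y.base) ∨
    (x.base = y.base ∧ (x.pos + 1 = y.pos ∨ y.pos + 1 = x.pos)) := Iff.rfl

/-- The vertex `b`, as a vertex of the graph with paths. -/
def root (len : β → ℕ) (b : β) : PathPoint len := ⟨b, 0, Nat.zero_le _⟩

theorem eq_root {x : PathPoint len} (hx : x.pos = 0) : x = root len x.base := by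
  ext
  · rfl
  · exact hx

theorem root_injective : Function.Injective (root len) := fun _ _ h => congrArg base h

variable [Fintype (PathPoint len)] {B : Type v} [CStarAlgebra B]
  {q : PathPoint len → PathPoint len → B}

open IsQuantumAut

/-- Walking along the paths: a vertex has position at most `j + 1` if and only if it is a root or a
non-root with a neighbour of position at most `j`. All neighbours of a non-root lie on its own path,
so `p` of the base is carried along. -/
theorem respects_le (h : IsQuantumAut (pathsGraph Γ len) q)
    (h0 : Respects q (fun x => x.pos = 0)) {p : β → Prop}
    (hp : Respects q (fun x => x.pos = 0 ∧ p x.base)) (j : ℕ) :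
    Respects q (fun x => x.pos ≤ j ∧ p x.base) := by
  induction j with
  | zero => exact hp.congr fun x => by rw [Nat.le_zero]
  | succ j ih =>
    refine (hp.or (h0.not.and (h.respects_exists ih))).congr fun x => ?_
    constructor
    · rintro ⟨hx, hpx⟩
      rcases Nat.eq_zero_or_pos x.pos with h1 | h1
      · exact Or.inl ⟨h1, hpx⟩
      · have := x.le
        exact Or.inr ⟨h1.ne', ⟨x.base, x.pos - 1, by omega⟩, Or.inr ⟨rfl, Or.inr (by
          change x.pos - 1 + 1 = x.pos; omega)⟩, by change x.pos - 1 ≤ j; omega, hpx⟩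
    · rintro (⟨h1, h2⟩ | ⟨h1, z, hz, h2, h3⟩)
      · exact ⟨by omega, h2⟩
      · rcases adj_iff.mp hz with h4 | h4
        · exact absurd h4.1 h1
        · exact ⟨by omega, h4.1 ▸ h3⟩

theorem respects_eq (h : IsQuantumAut (pathsGraph Γ len) q)
    (h0 : Respects q (fun x => x.pos = 0)) {p : β → Prop}
    (hp : Respects q (fun x => x.pos = 0 ∧ p x.base)) (j : ℕ) :
    Respects q (fun x => x.pos = j ∧ p x.base) := by
  cases j with
  | zero => exact hp
  | succ j =>
    refine ((respects_le h h0 hp (j + 1)).and (respects_le h h0 hp j).not).congr fun x => ?_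
    constructor
    · rintro ⟨h1, h2⟩
      exact ⟨⟨h1.le, h2⟩, fun h3 => by omega⟩
    · rintro ⟨⟨h1, h2⟩, h3⟩
      refine ⟨?_, h2⟩
      by_contra h4
      exact h3 ⟨by omega, h2⟩

/-- Looking ahead on the path: at least `r + 1` more steps are possible from position `j` if and
only if some neighbour at position `j + 1` admits `r` more. Such a neighbour is not a root, hence
lies on the same path. -/
theorem respects_len (h : IsQuantumAut (pathsGraph Γ len) q)
    (h0 : Respects q (fun x => x.pos = 0)) {p : β → Prop}
    (hp : Respects q (fun x => x.pos = 0 ∧ p x.base)) (r j : ℕ) :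
    Respects q (fun x => x.pos = j ∧ p x.base ∧ j + r ≤ len x.base) := by
  induction r generalizing j with
  | zero =>
    refine (respects_eq h h0 hp j).congr fun x => ?_
    constructor
    · rintro ⟨h1, h2, -⟩
      exact ⟨h1, h2⟩
    · rintro ⟨h1, h2⟩
      exact ⟨h1, h2, by rw [add_zero, ← h1]; exact x.le⟩
  | succ r ih =>
    refine ((respects_eq h h0 hp j).and (h.respects_exists (ih (j + 1)))).congr fun x => ?_
    constructor
    · rintro ⟨h1, h2, h3⟩
      refine ⟨⟨h1, h2⟩, ⟨x.base, j + 1, by omega⟩, Or.inr ⟨rfl, Or.inl (by rw [h1])⟩, rfl, h2, ?_⟩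
      change j + 1 + r ≤ len x.base
      omega
    · rintro ⟨⟨h1, h2⟩, z, hz, h3, h4, h5⟩
      refine ⟨h1, h2, ?_⟩
      rcases adj_iff.mp hz with h6 | h6
      · omega
      · rw [h6.1]
        omega

/-- The length of a path is the largest number of steps possible from its root, so each of the two
lengths bounds the other by `respects_len` at position `0`. -/
theorem len_eq (h : IsQuantumAut (pathsGraph Γ len) q)
    (h0 : Respects q (fun x => x.pos = 0)) {p : β → Prop}
    (hp : Respects q (fun x => x.pos = 0 ∧ p x.base)) {x y : PathPoint len} (hne : q x y ≠ 0)
    (hx : x.pos = 0) (hpx : p x.base) : len x.base = len y.base := by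
  have hy := (hp x y hne).mp ⟨hx, hpx⟩
  refine le_antisymm ?_ ?_
  · have := ((respects_len h h0 hp (len x.base) 0) x y hne).mp ⟨hx, hpx, by omega⟩
    have := this.2.2
    omega
  · have := ((respects_len h h0 hp (len y.base) 0) x y hne).mpr ⟨hy.1, hy.2, by omega⟩
    have := this.2.2
    omega

/-- A property of the vertices of `Γ` that is respected extends to the attached paths. -/
theorem respects_base (h : IsQuantumAut (pathsGraph Γ len) q)
    (h0 : Respects q (fun x => x.pos = 0)) {p : β → Prop}
    (hp : Respects q (fun x => x.pos = 0 ∧ p x.base)) : Respects q (fun x => p x.base) := by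
  intro x y hne
  refine ⟨fun hx => ?_, fun hy => ?_⟩
  · exact ((respects_eq h h0 hp x.pos x y hne).mp ⟨rfl, hx⟩).2
  · exact ((respects_eq h h0 hp y.pos x y hne).mpr ⟨rfl, hy⟩).2

theorem pos_eq (h : IsQuantumAut (pathsGraph Γ len) q)
    (h0 : Respects q (fun x => x.pos = 0)) {x y : PathPoint len} (hne : q x y ≠ 0) :
    x.pos = y.pos :=
  ((respects_eq (p := fun _ => True) h h0 (h0.congr fun x => by simp) x.pos x y hne).mp
    ⟨rfl, trivial⟩).1.symm

end PathPoint

/-! ### The graph of a family of groups of exponent two -/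

/-- The data that define the model graph: groups `A k` of exponent two, indexed by the parts `k`,
the adjacency relation between elements of different parts, and the lengths of the paths. -/
structure PartData (K : Type u) (A : K → Type v) [∀ k, CommGroup (A k)] where
  mul_self : ∀ {k} (a : A k), a * a = 1
  cross : ∀ {k l}, A k → A l → Prop
  cross_symm : ∀ {k l} {a : A k} {b : A l}, cross a b → cross b a
  lenV : K → ℕ
  lenE : ∀ {k}, A k → ℕ

/-- The product of the two ends of an edge. -/
def Sym2.label {M : Type v} [CommMonoid M] : Sym2 M → M :=
  Sym2.lift ⟨fun a b => a * b, fun a b => mul_comm a b⟩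

@[simp] theorem Sym2.label_mk {M : Type v} [CommMonoid M] (a b : M) : s(a, b).label = a * b := rfl

namespace PartData

variable {K : Type u} {A : K → Type v} [∀ k, CommGroup (A k)]

/-- The vertices `a : A k`, and the vertices subdividing the edges between different elements of
the same part `A k`. -/
inductive Base (A : K → Type v) [∀ k, CommGroup (A k)] : Type (max u v)
  | old (k : K) (a : A k) : Base A
  | sub (k : K) (s : Sym2 (A k)) (h : s.label ≠ 1) : Base A

/-- The part of a vertex. -/
def Base.part : Base A → K
  | old k _ => k
  | sub k _ _ => k

theorem eq_of_mul_eq_one (D : PartData K A) {k : K} {a b : A k} (h : a * b = 1) : a = b :=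
  mul_right_cancel (h.trans (D.mul_self b).symm)

variable (D : PartData K A)

/-- The length of the path attached to a vertex. -/
def len : Base A → ℕ
  | .old k _ => D.lenV k
  | .sub _ s _ => D.lenE s.label

/-- Adjacency between the vertices `a : A k` and the subdividing vertices. -/
def baseGraph : SimpleGraph (Base A) where
  Adj
    | .old k a, .old l b => k ≠ l ∧ D.cross a b
    | .old k a, .sub l s _ => ∃ h : k = l, h ▸ a ∈ s
    | .sub l s _, .old k a => ∃ h : k = l, h ▸ a ∈ s
    | .sub _ _ _, .sub _ _ _ => False
  symm := ⟨by
    rintro (⟨k, a⟩ | ⟨k, s, hs⟩) (⟨l, b⟩ | ⟨l, t, ht⟩) h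
    · exact ⟨h.1.symm, D.cross_symm h.2⟩
    · exact h
    · exact h
    · exact h⟩
  loopless := ⟨by
    rintro (⟨k, a⟩ | ⟨k, s, hs⟩) h
    · exact h.1 rfl
    · exact h⟩

theorem baseGraph_old_old {k l : K} {a : A k} {b : A l} :
    D.baseGraph.Adj (.old k a) (.old l b) ↔ k ≠ l ∧ D.cross a b := Iff.rfl

theorem baseGraph_old_sub {k : K} {a : A k} {s : Sym2 (A k)} {hs : s.label ≠ 1} :
    D.baseGraph.Adj (.old k a) (.sub k s hs) ↔ a ∈ s :=
  ⟨fun h => h.2, fun h => ⟨rfl, h⟩⟩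

theorem baseGraph_old_sub_part {k l : K} {a : A k} {s : Sym2 (A l)} {hs : s.label ≠ 1}
    (h : D.baseGraph.Adj (.old k a) (.sub l s hs)) : k = l := h.1

theorem not_baseGraph_sub_sub {k l : K} {t : Sym2 (A k)} {ht : t.label ≠ 1} {s : Sym2 (A l)}
    {hs : s.label ≠ 1} : ¬ D.baseGraph.Adj (.sub k t ht) (.sub l s hs) := id

/-- The vertices of the model graph. -/
abbrev Vertex : Type (max u v) := PathPoint D.len

/-- The model graph: the base graph with paths attached. -/
abbrev graph : SimpleGraph D.Vertex := pathsGraph D.baseGraph D.len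

abbrev root (b : Base A) : D.Vertex := PathPoint.root D.len b

theorem graph_root_root {b c : Base A} :
    D.graph.Adj (D.root b) (D.root c) ↔ D.baseGraph.Adj b c := by
  rw [PathPoint.adj_iff]
  simp [PathPoint.root]

/-- The conditions under which the quantum automorphisms of the model graph can be determined. -/
structure Admissible : Prop where
  nontrivial : ∀ k, ∃ a : A k, a ≠ 1
  two_cross : ∀ k (a : A k), ∃ (l l' : K) (b : A l) (b' : A l'), k ≠ l ∧ k ≠ l' ∧ l ≠ l' ∧
    D.cross a b ∧ D.cross a b'
  lenV_injective : Function.Injective D.lenV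
  lenE_injective : ∀ {k l} (a : A k) (b : A l), a ≠ 1 → b ≠ 1 → D.lenE a = D.lenE b →
    (⟨k, a⟩ : Σ k, A k) = ⟨l, b⟩

end PartData

/-! ### Recovering position, part and label of a vertex from degrees and path lengths. -/

namespace PartData

variable {K : Type u} {A : K → Type v} [∀ k, CommGroup (A k)]

/-- The vertices that belong to a group. -/
def Base.IsOld : Base A → Prop
  | .old _ _ => True
  | .sub _ _ _ => False

variable (D : PartData K A)

open IsQuantumAut PathPoint

theorem exists_root {x : D.Vertex} (hx : x.pos = 0) : ∃ b, x = D.root b := ⟨x.base, eq_root hx⟩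

theorem root_old_ne {k l : K} (h : k ≠ l) (a : A k) (b : A l) :
    D.root (.old k a) ≠ D.root (.old l b) := fun h' =>
  h (congrArg Base.part (root_injective h'))

theorem root_old_ne_sub {k l : K} (a : A k) (s : Sym2 (A l)) (hs : s.label ≠ 1) :
    D.root (.old k a) ≠ D.root (.sub l s hs) := fun h' => by
  have := root_injective h'
  simp at this

theorem root_old_ne' {k : K} {a b : A k} (h : a ≠ b) :
    D.root (.old k a) ≠ D.root (.old k b) := fun h' => by
  have := root_injective h'
  simp at this
  exact h this

variable [Fintype D.Vertex]

theorem card_nbrs_le_two (p : D.Vertex → Prop) {x : D.Vertex} (hx : x.pos ≠ 0) :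
    (nbrs D.graph p x).card ≤ 2 := by
  classical
  refine (Finset.card_le_card_of_injOn (t := {x.pos - 1, x.pos + 1}) PathPoint.pos
    (fun z hz => ?_) fun z hz z' hz' h => ?_).trans Finset.card_le_two
  · have hz := (mem_nbrs.mp hz).1
    rcases adj_iff.mp hz with h | h
    · exact absurd h.1 hx
    · simp only [Finset.coe_insert, Finset.coe_singleton, Set.mem_insert_iff,
        Set.mem_singleton_iff]
      omega
  · have hz := (mem_nbrs.mp hz).1
    have hz' := (mem_nbrs.mp hz').1
    have e := (adj_iff.mp hz).resolve_left fun h => hx h.1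
    have e' := (adj_iff.mp hz').resolve_left fun h => hx h.1
    exact PathPoint.ext (e.1.symm.trans e'.1) h

theorem card_nbrs_le_one {p : D.Vertex → Prop} (hp : ∀ z, p z → z.pos = 0) {x : D.Vertex}
    (hx : x.pos ≠ 0) : (nbrs D.graph p x).card ≤ 1 := by
  refine Finset.card_le_one.mpr fun z hz z' hz' => ?_
  have hz := mem_nbrs.mp hz
  have hz' := mem_nbrs.mp hz'
  have e := (adj_iff.mp hz.1).resolve_left fun h => hx h.1
  have e' := (adj_iff.mp hz'.1).resolve_left fun h => hx h.1
  exact PathPoint.ext (e.1.symm.trans e'.1) ((hp z hz.2).trans (hp z' hz'.2).symm)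

variable {D} in
theorem Admissible.two_le_card_old (hD : D.Admissible) {p : D.Vertex → Prop}
    (hp : ∀ k a, p (D.root (.old k a))) {k : K} (a : A k) :
    2 ≤ (nbrs D.graph p (D.root (.old k a))).card := by
  obtain ⟨l, l', b, b', hl, hl', hne, hb, hb'⟩ := hD.two_cross k a
  exact Finset.one_lt_card.mpr ⟨D.root (.old l b),
    mem_nbrs.mpr ⟨D.graph_root_root.mpr ⟨hl, hb⟩, hp _ _⟩, D.root (.old l' b'),
    mem_nbrs.mpr ⟨D.graph_root_root.mpr ⟨hl', hb'⟩, hp _ _⟩, D.root_old_ne hne _ _⟩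

variable {D} in
theorem Admissible.three_le_card_old (hD : D.Admissible) {p : D.Vertex → Prop}
    (hp : ∀ b, p (D.root b)) {k : K} (a : A k) :
    3 ≤ (nbrs D.graph p (D.root (.old k a))).card := by
  obtain ⟨l, l', b, b', hl, hl', hne, hb, hb'⟩ := hD.two_cross k a
  obtain ⟨c, hc⟩ := hD.nontrivial k
  -- The third neighbour subdivides the edge from `a` to `a * c`, whose label is `c`.
  have hs : s(a, a * c).label ≠ 1 := by
    rwa [Sym2.label_mk, ← mul_assoc, D.mul_self, one_mul]
  exact Finset.two_lt_card.mpr ⟨D.root (.old l b),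
    mem_nbrs.mpr ⟨D.graph_root_root.mpr ⟨hl, hb⟩, hp _⟩, D.root (.old l' b'),
    mem_nbrs.mpr ⟨D.graph_root_root.mpr ⟨hl', hb'⟩, hp _⟩, D.root (.sub k s(a, a * c) hs),
    mem_nbrs.mpr ⟨D.graph_root_root.mpr (D.baseGraph_old_sub.mpr (Sym2.mem_mk_left _ _)), hp _⟩,
    D.root_old_ne hne _ _, D.root_old_ne_sub _ _ _, D.root_old_ne_sub _ _ _⟩

theorem two_le_card_sub {p : D.Vertex → Prop} (hp : ∀ k a, p (D.root (.old k a))) {k : K}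
    (s : Sym2 (A k)) (hs : s.label ≠ 1) :
    2 ≤ (nbrs D.graph p (D.root (.sub k s hs))).card := by
  induction s with
  | _ a b =>
    refine Finset.one_lt_card.mpr ⟨D.root (.old k a), mem_nbrs.mpr
      ⟨(D.graph_root_root.mpr (D.baseGraph_old_sub.mpr (Sym2.mem_mk_left _ _))).symm, hp _ _⟩,
      D.root (.old k b), mem_nbrs.mpr
      ⟨(D.graph_root_root.mpr (D.baseGraph_old_sub.mpr (Sym2.mem_mk_right _ _))).symm, hp _ _⟩, ?_⟩
    refine D.root_old_ne' ?_
    rintro rfl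
    exact hs (D.mul_self a)

/-- Among the roots, a subdividing vertex sees only the two ends of its edge; its possible neighbour
on the attached path is excluded by `hp`. -/
theorem card_le_two_sub {p : D.Vertex → Prop} (hp : ∀ x, p x → x.pos = 0) {k : K}
    (s : Sym2 (A k)) (hs : s.label ≠ 1) :
    (nbrs D.graph p (D.root (.sub k s hs))).card ≤ 2 := by
  classical
  induction s with
  | _ a b =>
    refine (Finset.card_le_card (t := {D.root (.old k a), D.root (.old k b)})
      fun z hz => ?_).trans Finset.card_le_two
    have hz := mem_nbrs.mp hz
    obtain ⟨c, j, hc⟩ := z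
    obtain rfl : j = 0 := hp _ hz.2
    have h1 : D.baseGraph.Adj (.sub k s(a, b) hs) c := D.graph_root_root.mp hz.1
    cases c with
    | sub l t ht => exact absurd h1 (D.not_baseGraph_sub_sub)
    | old l c =>
      obtain rfl := D.baseGraph_old_sub_part h1.symm
      have h2 := D.baseGraph_old_sub.mp h1.symm
      rcases Sym2.mem_iff.mp h2 with rfl | rfl
      · exact Finset.mem_insert_self _ _
      · exact Finset.mem_insert_of_mem (Finset.mem_singleton_self _)

variable {D} {B : Type w} [CStarAlgebra B] {q : D.Vertex → D.Vertex → B}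

namespace Admissible

variable (hD : D.Admissible) (h : IsQuantumAut D.graph q)
include hD h

/-- Three rounds of refinement. Degree at least `3` holds for all group elements, perhaps for some
subdividing vertices (if a path is attached), and for no vertex inside a path. Having two neighbours
of that kind then singles out exactly the roots, because a path vertex is adjacent to at most one
root. Finally, three neighbours among the roots exist for group elements (two in other parts and a
subdividing vertex), but not for subdividing vertices. -/
theorem respects_old : Respects q (fun x => x.pos = 0 ∧ x.base.IsOld) := by
  have h0 : Respects q (fun _ => True) := fun _ _ _ => Iff.rfl
  have h1 := h.respects_card h0 3
  have h2 := h.respects_card h1 2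
  have h3 := h.respects_card h2 3
  have f1 : ∀ x : D.Vertex, 3 ≤ (nbrs D.graph (fun _ => True) x).card → x.pos = 0 := by
    intro x hx
    by_contra hne
    have := D.card_nbrs_le_two (fun _ => True) hne
    omega
  have f2 : ∀ x : D.Vertex, 2 ≤ (nbrs D.graph
      (fun x => 3 ≤ (nbrs D.graph (fun _ => True) x).card) x).card → x.pos = 0 := by
    intro x hx
    by_contra hne
    have := D.card_nbrs_le_one f1 hne
    omega
  have f3 : ∀ k a, 3 ≤ (nbrs D.graph (fun _ => True) (D.root (.old k a))).card := fun k a =>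
    hD.three_le_card_old (fun _ => trivial) a
  have f4 : ∀ b, 2 ≤ (nbrs D.graph
      (fun x => 3 ≤ (nbrs D.graph (fun _ => True) x).card) (D.root b)).card := by
    rintro (⟨k, a⟩ | ⟨k, s, hs⟩)
    · exact hD.two_le_card_old f3 a
    · exact D.two_le_card_sub f3 s hs
  refine h3.congr fun x => ⟨?_, fun hx => ?_⟩
  · rintro ⟨hx, hold⟩
    obtain ⟨b, rfl⟩ := D.exists_root hx
    cases b with
    | old k a => exact hD.three_le_card_old f4 a
    | sub k s hs => exact hold.elim
  · have hpos : x.pos = 0 := by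
      by_contra hne
      have := D.card_nbrs_le_two (fun x => 2 ≤ (nbrs D.graph
        (fun x => 3 ≤ (nbrs D.graph (fun _ => True) x).card) x).card) hne
      omega
    obtain ⟨b, rfl⟩ := D.exists_root hpos
    cases b with
    | old k a => exact ⟨rfl, trivial⟩
    | sub k s hs =>
      have := D.card_le_two_sub f2 s hs
      omega

/-- Among the vertices other than group elements, the subdividing ones are those with two group
elements as neighbours; a path vertex has at most one. -/
theorem respects_sub : Respects q (fun x => x.pos = 0 ∧ ¬ x.base.IsOld) := by
  have h1 := hD.respects_old h
  refine (h1.not.and (h.respects_card h1 2)).congr fun x => ⟨?_, ?_⟩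
  · rintro ⟨hx, hold⟩
    obtain ⟨b, rfl⟩ := D.exists_root hx
    cases b with
    | old k a => exact absurd trivial hold
    | sub k s hs => exact ⟨fun h => hold h.2, D.two_le_card_sub (fun _ _ => ⟨rfl, trivial⟩) s hs⟩
  · rintro ⟨hold, hcard⟩
    have hx : x.pos = 0 := by
      by_contra hne
      have := D.card_nbrs_le_one (p := fun x => x.pos = 0 ∧ x.base.IsOld) (fun z hz => hz.1) hne
      omega
    exact ⟨hx, fun h => hold ⟨hx, h⟩⟩

theorem respects_pos : Respects q (fun x => x.pos = 0) :=
  ((hD.respects_old h).or (hD.respects_sub h)).congr fun x => by tauto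

theorem pos_eq {x y : D.Vertex} (hne : q x y ≠ 0) : x.pos = y.pos :=
  PathPoint.pos_eq h (hD.respects_pos h) hne

end Admissible

/-- The type of a vertex of the base graph: its part, and the label of the edge that it
subdivides. -/
def Base.type : Base A → K ⊕ Σ k, A k
  | .old k _ => Sum.inl k
  | .sub k s _ => Sum.inr ⟨k, s.label⟩

namespace Admissible

variable (hD : D.Admissible) (h : IsQuantumAut D.graph q)
include hD h

/-- The path length encodes the type. Group elements and subdividing vertices have to be separated
beforehand, since a length `lenV` may coincide with a length `lenE`. -/
theorem type_eq_of_pos_eq_zero {x y : D.Vertex} (hne : q x y ≠ 0) (hx : x.pos = 0) :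
    x.base.type = y.base.type := by
  have hy : y.pos = 0 := (hD.pos_eq h hne).symm.trans hx
  have hold := hD.respects_old h x y hne
  have hsub := hD.respects_sub h x y hne
  have hlen := PathPoint.len_eq h (hD.respects_pos h) (hD.respects_old h) hne hx
  have hlen' := PathPoint.len_eq h (hD.respects_pos h) (p := fun b => ¬ b.IsOld)
    (hD.respects_sub h) hne hx
  obtain ⟨b, rfl⟩ := D.exists_root hx
  obtain ⟨c, rfl⟩ := D.exists_root hy
  rcases b with ⟨k, a⟩ | ⟨k, s, hs⟩ <;> rcases c with ⟨l, b⟩ | ⟨l, t, ht⟩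
  · exact congrArg Sum.inl (hD.lenV_injective (hlen trivial))
  · exact (hold.mp ⟨rfl, trivial⟩).2.elim
  · exact (hold.mpr ⟨rfl, trivial⟩).2.elim
  · exact congrArg Sum.inr (hD.lenE_injective _ _ hs ht (hlen' id))

theorem type_eq {x y : D.Vertex} (hne : q x y ≠ 0) : x.base.type = y.base.type := by
  refine ((PathPoint.respects_base h (hD.respects_pos h) (p := fun b => x.base.type = b.type)
    fun z w hzw => ?_) x y hne).mp rfl
  constructor
  · rintro ⟨h1, h2⟩
    exact ⟨(hD.pos_eq h hzw).symm.trans h1, h2.trans (hD.type_eq_of_pos_eq_zero h hzw h1)⟩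
  · rintro ⟨h1, h2⟩
    have h3 := (hD.pos_eq h hzw).trans h1
    exact ⟨h3, h2.trans (hD.type_eq_of_pos_eq_zero h hzw h3).symm⟩

end Admissible

end PartData

namespace PartData

variable {K : Type u} {A : K → Type v} [∀ k, CommGroup (A k)] (D : PartData K A)

/-! ### The action of the groups `A k` on the model graph -/

include D in
theorem label_map_mul {k : K} (c : A k) (s : Sym2 (A k)) :
    (s.map (c * ·)).label = s.label := by
  induction s with
  | _ a b =>
    rw [Sym2.map_mk, Sym2.label_mk, Sym2.label_mk, mul_mul_mul_comm, D.mul_self, one_mul]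

/-- The action of a family of elements of the groups `A k` on the base graph. -/
def actBase (g : ∀ k, A k) : Base A → Base A
  | .old k a => .old k (g k * a)
  | .sub k s hs => .sub k (s.map (g k * ·)) (by rwa [D.label_map_mul])

theorem len_actBase (g : ∀ k, A k) (b : Base A) : D.len (D.actBase g b) = D.len b := by
  cases b with
  | old k a => rfl
  | sub k s hs => exact congrArg D.lenE (D.label_map_mul (g k) s)

theorem part_actBase (g : ∀ k, A k) (b : Base A) : (D.actBase g b).part = b.part := by
  cases b <;> rfl

theorem actBase_actBase (g : ∀ k, A k) (b : Base A) : D.actBase g (D.actBase g b) = b := by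
  cases b with
  | old k a => simp only [actBase, ← mul_assoc, D.mul_self, one_mul]
  | sub k s hs =>
    induction s with
    | _ a b => simp only [actBase, Sym2.map_mk, ← mul_assoc, D.mul_self, one_mul]

/-- The action of a family of elements of the groups `A k` on the model graph. -/
def act (g : ∀ k, A k) (x : D.Vertex) : D.Vertex :=
  ⟨D.actBase g x.base, x.pos, by rw [D.len_actBase]; exact x.le⟩

theorem act_act (g : ∀ k, A k) (x : D.Vertex) : D.act g (D.act g x) = x :=
  PathPoint.ext (D.actBase_actBase g x.base) rfl

/-- Within one part the only edges of the base graph are incidences between elements and subdivided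
pairs, and a translation preserves these. Between different parts adjacency need not be preserved,
hence the restriction `h`. -/
theorem actBase_adj {g : ∀ k, A k} {b c : Base A} (h : b.part = c.part) :
    D.baseGraph.Adj (D.actBase g b) (D.actBase g c) ↔ D.baseGraph.Adj b c := by
  rcases b with ⟨k, a⟩ | ⟨k, s, hs⟩ <;> rcases c with ⟨l, b⟩ | ⟨l, t, ht⟩ <;>
    obtain rfl : k = l := h
  · exact iff_of_false (fun h => h.1 rfl) (fun h => h.1 rfl)
  · simp only [actBase]
    rw [D.baseGraph_old_sub, D.baseGraph_old_sub, Sym2.mem_map]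
    simp
  · simp only [actBase]
    rw [D.baseGraph.adj_comm, D.baseGraph.adj_comm (.sub _ _ _), D.baseGraph_old_sub,
      D.baseGraph_old_sub, Sym2.mem_map]
    simp
  · exact Iff.rfl

theorem act_adj {g : ∀ k, A k} {x y : D.Vertex} (h : x.base.part = y.base.part) :
    D.graph.Adj (D.act g x) (D.act g y) ↔ D.graph.Adj x y := by
  rw [PathPoint.adj_iff, PathPoint.adj_iff]
  refine or_congr ?_ ?_
  · exact and_congr Iff.rfl (and_congr Iff.rfl (D.actBase_adj h))
  · exact and_congr (Function.LeftInverse.injective (D.actBase_actBase g)).eq_iff Iff.rfl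

open Classical in
/-- The action of an element of `A k` on the part `k` of the model graph. -/
def move (k : K) (c : A k) : D.Vertex → D.Vertex := D.act (Pi.mulSingle k c)

theorem move_move (k : K) (c : A k) (x : D.Vertex) : D.move k c (D.move k c x) = x :=
  D.act_act _ x

theorem move_eq_comm {k : K} {c : A k} {x y : D.Vertex} : D.move k c x = y ↔ x = D.move k c y :=
  ⟨fun h => by rw [← h, move_move], fun h => by rw [h, move_move]⟩

@[simp] theorem part_move (k : K) (c : A k) (x : D.Vertex) :
    (D.move k c x).base.part = x.base.part := D.part_actBase _ _

theorem move_root_old (k : K) (c a : A k) :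
    D.move k c (D.root (.old k a)) = D.root (.old k (c * a)) := by
  refine PathPoint.ext ?_ rfl
  change D.actBase _ (.old k a) = .old k (c * a)
  simp [actBase]

theorem move_root_sub (k : K) (c a b : A k) (hs : s(a, b).label ≠ 1) :
    D.move k c (D.root (.sub k s(a, b) hs)) =
      D.root (.sub k s(c * a, c * b) (by rwa [← Sym2.map_mk, D.label_map_mul])) := by
  refine PathPoint.ext ?_ rfl
  change D.actBase _ (.sub k s(a, b) hs) = .sub k s(c * a, c * b) _
  simp [actBase]

theorem adj_move_of_eq {k : K} {c : A k} {x y : D.Vertex} (h : x.base.part = y.base.part) :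
    D.graph.Adj (D.move k c x) (D.move k c y) ↔ D.graph.Adj x y := D.act_adj h

theorem adj_of_part_ne {x y : D.Vertex} (h : x.base.part ≠ y.base.part) (hadj : D.graph.Adj x y) :
    ∃ k l a b, k ≠ l ∧ D.cross a b ∧ x = D.root (.old k a) ∧ y = D.root (.old l b) := by
  obtain ⟨b, i, hi⟩ := x
  obtain ⟨c, j, hj⟩ := y
  rcases PathPoint.adj_iff.mp hadj with ⟨rfl, rfl, h1⟩ | h1
  · rcases b with ⟨k, a⟩ | ⟨k, s, hs⟩ <;> rcases c with ⟨l, b⟩ | ⟨l, t, ht⟩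
    · exact ⟨k, l, a, b, h1.1, h1.2, rfl, rfl⟩
    · exact absurd (D.baseGraph_old_sub_part h1) h
    · exact absurd (D.baseGraph_old_sub_part h1.symm).symm h
    · exact h1.elim
  · exact absurd (congrArg Base.part h1.1) h

theorem adj_move_of_part_ne {x y : D.Vertex} {k l : K} {c : A k} {d : A l}
    (h : x.base.part ≠ y.base.part) (hx : x.base.part = k) (hy : y.base.part = l)
    (hcd : ∀ (a : A k) (b : A l), D.cross a b ↔ D.cross (c * a) (d * b)) :
    D.graph.Adj (D.move k c x) (D.move l d y) ↔ D.graph.Adj x y := by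
  have key : ∀ {x y : D.Vertex}, x.base.part ≠ y.base.part → x.base.part = k → y.base.part = l →
      D.graph.Adj x y → D.graph.Adj (D.move k c x) (D.move l d y) := by
    intro x y h hx hy hadj
    obtain ⟨k', l', a, b, hkl, hab, rfl, rfl⟩ := D.adj_of_part_ne h hadj
    obtain rfl : k' = k := hx
    obtain rfl : l' = l := hy
    rw [D.move_root_old, D.move_root_old]
    exact D.graph_root_root.mpr ⟨hkl, (hcd a b).mp hab⟩
  -- Translations are involutions, so the converse is the same implication for the moved vertices.
  refine ⟨fun hadj => ?_, key h hx hy⟩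
  have := key (by simpa only [D.part_move] using h) ((D.part_move _ _ _).trans hx)
    ((D.part_move _ _ _).trans hy) hadj
  rwa [D.move_move, D.move_move] at this

/-! ### Families of projection-valued measures -/

variable [∀ k, Fintype (A k)] {B : Type w} [CStarAlgebra B]

/-- Projection-valued measures on the groups `A k` that are compatible with the cross adjacency. -/
structure CompatiblePVM (P : ∀ k, A k → B) : Prop where
  star_eq : ∀ k c, star (P k c) = P k c
  idem : ∀ k c, P k c * P k c = P k c
  sum_eq : ∀ k, ∑ c, P k c = 1
  compat : ∀ {k l c d}, k ≠ l → P k c * P l d ≠ 0 →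
    ∀ (a : A k) (b : A l), D.cross a b ↔ D.cross (c * a) (d * b)

open Classical in
/-- The matrix with entries `∑ P k c`, over the `c` that map the vertex `x` of the part `k`
to `y`. -/
def quantumAut (P : ∀ k, A k → B) (x y : D.Vertex) : B :=
  ∑ c : A x.base.part, if D.move x.base.part c x = y then P x.base.part c else 0

namespace CompatiblePVM

variable {D} {P : ∀ k, A k → B} (hP : D.CompatiblePVM P)
include hP

theorem mul_eq_zero (k : K) {c d : A k} (h : c ≠ d) : P k c * P k d = 0 :=
  mul_eq_zero_of_sum_eq_one (hP.star_eq k) (hP.idem k) (hP.sum_eq k) h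

open Classical in
omit hP in
theorem quantumAut_of_part {x : D.Vertex} {k : K} (hx : x.base.part = k) (y : D.Vertex) :
    D.quantumAut P x y = ∑ c : A k, if D.move k c x = y then P k c else 0 := by
  subst hx
  rfl

omit hP in
theorem quantumAut_of_part_ne {x y : D.Vertex} (h : x.base.part ≠ y.base.part) :
    D.quantumAut P x y = 0 := by
  refine Finset.sum_eq_zero fun c _ => if_neg ?_
  rintro rfl
  exact h (D.part_move _ _ _).symm

open Classical in
/-- Sums of the projections `P k c` over subsets of `A k` are multiplicative. -/
theorem sum_ite_mul_eq {k : K} (f : A k → Prop) (g : A k → Prop) :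
    (∑ c, if f c then P k c else 0) * (∑ c, if g c then P k c else 0) =
      ∑ c, if f c ∧ g c then P k c else 0 := by
  rw [Finset.sum_mul]
  refine Finset.sum_congr rfl fun c _ => ?_
  rw [Finset.mul_sum, Finset.sum_eq_single c]
  · by_cases h1 : f c <;> by_cases h2 : g c <;> simp [h1, h2, hP.idem]
  · intro d _ hd
    by_cases h1 : f c <;> by_cases h2 : g d <;> simp [h1, h2, hP.mul_eq_zero k hd.symm]
  · simp

variable [Fintype D.Vertex]

theorem sum_row (x : D.Vertex) : ∑ y, D.quantumAut P x y = 1 := by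
  classical
  simp only [quantumAut]
  rw [Finset.sum_comm, ← hP.sum_eq x.base.part]
  exact Finset.sum_congr rfl fun c _ => by simp

open Classical in
omit hP in
/-- The `y`-th column, multiplied by a function of the vertices of its part. -/
theorem sum_column_ite (y : D.Vertex) {k : K} (hy : y.base.part = k) (p : D.Vertex → Prop) :
    ∑ x, (if x.base.part = k ∧ p x then D.quantumAut P x y else 0) =
      ∑ c : A k, if p (D.move k c y) then P k c else 0 := by
  -- As moves are involutions, `c` maps `x` to `y` if and only if `x` is the image of `y` under `c`;
  -- a column can thus be parametrized by the group, just like a row.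
  have h1 : ∀ x, (if x.base.part = k ∧ p x then D.quantumAut P x y else 0) =
      ∑ c : A k, if x = D.move k c y then (if p x then P k c else 0) else 0 := by
    intro x
    by_cases hx : x.base.part = k
    · rw [quantumAut_of_part hx]
      by_cases hp : p x
      · simp [hx, hp, D.move_eq_comm]
      · simp [hp]
    · rw [if_neg fun h => hx h.1]
      refine (Finset.sum_eq_zero fun c _ => if_neg ?_).symm
      rintro rfl
      exact hx ((D.part_move _ _ _).trans hy)
  simp_rw [h1]
  rw [Finset.sum_comm]
  exact Finset.sum_congr rfl fun c _ => by simp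

theorem sum_column (y : D.Vertex) : ∑ x, D.quantumAut P x y = 1 := by
  classical
  have := sum_column_ite (P := P) y rfl (fun _ => True)
  simp only [and_true, if_true, hP.sum_eq] at this
  rw [← this]
  refine Finset.sum_congr rfl fun x _ => ?_
  split_ifs with hx
  · rfl
  · exact quantumAut_of_part_ne hx

open Classical in
omit hP in
theorem sum_row_ite (x : D.Vertex) {k : K} (hx : x.base.part = k) (p : D.Vertex → Prop) :
    ∑ y, (if p y then D.quantumAut P x y else 0) =
      ∑ c : A k, if p (D.move k c x) then P k c else 0 := by
  have h1 : ∀ y, (if p y then D.quantumAut P x y else 0) =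
      ∑ c : A k, if D.move k c x = y then (if p y then P k c else 0) else 0 := by
    intro y
    rw [quantumAut_of_part hx]
    by_cases hp : p y <;> simp [hp]
  simp_rw [h1]
  rw [Finset.sum_comm]
  exact Finset.sum_congr rfl fun c _ => by simp

/-- A compatible family of projection-valued measures defines a quantum automorphism of the model
graph. -/
theorem isQuantumAut : IsQuantumAut D.graph (D.quantumAut P) where
  star_eq x y := by
    simp only [quantumAut, star_sum]
    refine Finset.sum_congr rfl fun c _ => ?_
    split_ifs
    · exact hP.star_eq _ c
    · exact star_zero _
  idem x y := by
    classical
    exact (hP.sum_ite_mul_eq _ _).trans (Finset.sum_congr rfl fun c _ =>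
      if_congr (and_self_iff) rfl rfl)
  row := hP.sum_row
  column := hP.sum_column
  adjacency x y := by
    classical
    -- Entries between different parts vanish, so only vertices `z` in the part of `y` contribute.
    have h1 : ∑ z, (if D.graph.Adj x z then D.quantumAut P z y else 0) =
        ∑ d : A y.base.part, if D.graph.Adj x (D.move y.base.part d y) then P _ d else 0 := by
      rw [← sum_column_ite y rfl (fun z => D.graph.Adj x z)]
      refine Finset.sum_congr rfl fun z _ => ?_
      by_cases hz : z.base.part = y.base.part
      · simp [hz]
      · simp [hz, quantumAut_of_part_ne hz]
    rw [h1, sum_row_ite x rfl (fun z => D.graph.Adj z y)]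
    -- In a common part the two sums agree term by term, because a translation is an involutive
    -- automorphism of the part.
    by_cases hxy : x.base.part = y.base.part
    · obtain ⟨k, hk⟩ : ∃ k, k = y.base.part := ⟨_, rfl⟩
      have hk' := hk.trans hxy.symm
      have key : ∀ c : A k, D.graph.Adj x (D.move k c y) ↔ D.graph.Adj (D.move k c x) y := by
        intro c
        rw [← D.adj_move_of_eq (c := c) (x := x)]
        · rw [D.move_move]
        · rw [D.part_move, hxy]
      rw [← hk', ← hk]
      simp only [key]
    -- For different parts, insert the resolution of `1` by the other measure on each side. Both
    -- sides become double sums of products `P k c * P l d`, and wherever such a product is nonzero,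
    -- compatibility identifies the two adjacency conditions.
    · have h2 : ∀ d : A y.base.part, (if D.graph.Adj x (D.move y.base.part d y) then P _ d else 0) =
          ∑ c : A x.base.part, if D.graph.Adj x (D.move y.base.part d y) then P _ c * P _ d
            else 0 := by
        intro d
        split_ifs
        · rw [← Finset.sum_mul, hP.sum_eq, one_mul]
        · simp
      have h3 : ∀ c : A x.base.part, (if D.graph.Adj (D.move x.base.part c x) y then P _ c else 0) =
          ∑ d : A y.base.part, if D.graph.Adj (D.move x.base.part c x) y then P _ c * P _ d
            else 0 := by
        intro d
        split_ifs
        · rw [← Finset.mul_sum, hP.sum_eq, mul_one]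
        · simp
      simp_rw [h2, h3]
      rw [Finset.sum_comm]
      refine Finset.sum_congr rfl fun c _ => Finset.sum_congr rfl fun d _ => ?_
      by_cases h0 : P x.base.part c * P y.base.part d = 0
      · simp [h0]
      · refine if_congr ?_ rfl rfl
        rw [← D.adj_move_of_part_ne (y := y) (by rwa [D.part_move])
          (D.part_move x.base.part c x) rfl (hP.compat hxy h0), D.move_move]

end CompatiblePVM

end PartData

/-! ### Rigidity: a quantum automorphism of the model graph is given by compatible projection-valued
measures. -/

namespace PartData

section

variable {K : Type u} {A : K → Type v} [∀ k, CommGroup (A k)] (D : PartData K A)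
  [∀ k, Fintype (A k)] {B : Type w} [CStarAlgebra B]

theorem CompatiblePVM.quantumAut_old (P : ∀ k, A k → B) {k : K} (a b : A k) :
    D.quantumAut P (D.root (.old k a)) (D.root (.old k b)) = P k (a * b) := by
  classical
  rw [quantumAut_of_part (k := k) rfl, Finset.sum_eq_single (a * b)]
  · rw [if_pos]
    rw [D.move_root_old, mul_comm a b, mul_assoc, D.mul_self, mul_one]
  · intro c _ hc
    refine if_neg fun h => hc ?_
    rw [D.move_root_old] at h
    by_contra hne
    refine D.root_old_ne' (fun h' => hne ?_) h
    rw [← h', mul_comm c, ← mul_assoc, D.mul_self, one_mul]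
  · exact fun h => absurd (Finset.mem_univ _) h

theorem CompatiblePVM.quantumAut_old_ne (P : ∀ k, A k → B) {k : K} (a : A k) {y : D.Vertex}
    (hne : D.quantumAut P (D.root (.old k a)) y ≠ 0) : ∃ b : A k, y = D.root (.old k b) := by
  classical
  rw [quantumAut_of_part (k := k) rfl] at hne
  obtain ⟨c, -, hc⟩ := Finset.exists_ne_zero_of_sum_ne_zero hne
  have hc := (ite_ne_right_iff.mp hc).1
  exact ⟨c * a, by rw [← hc, D.move_root_old]⟩

end

variable {K : Type u} {A : K → Type v} [∀ k, CommGroup (A k)] {D : PartData K A}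
  {B : Type w} [CStarAlgebra B] [Fintype D.Vertex]

variable (D) in
/-- The first rows of the blocks of a quantum automorphism of the model graph. -/
def firstRow (q : D.Vertex → D.Vertex → B) (k : K) (c : A k) : B :=
  q (D.root (.old k 1)) (D.root (.old k c))

namespace Admissible

variable {q : D.Vertex → D.Vertex → B} (hD : D.Admissible) (h : IsQuantumAut D.graph q)
include hD h

theorem eq_root_old {k : K} {a : A k} {y : D.Vertex} (hne : q (D.root (.old k a)) y ≠ 0) :
    ∃ b : A k, y = D.root (.old k b) := by
  obtain ⟨c, rfl⟩ := D.exists_root (hD.pos_eq h hne).symm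
  have := hD.type_eq h hne
  rcases c with ⟨l, b⟩ | ⟨l, t, ht⟩
  · obtain rfl : k = l := Sum.inl_injective this
    exact ⟨b, rfl⟩
  · exact absurd this (by simp [Base.type, root, PathPoint.root])

theorem eq_root_sub {k : K} {s : Sym2 (A k)} {hs : s.label ≠ 1} {y : D.Vertex}
    (hne : q (D.root (.sub k s hs)) y ≠ 0) :
    ∃ (t : Sym2 (A k)) (ht : t.label ≠ 1), t.label = s.label ∧ y = D.root (.sub k t ht) := by
  obtain ⟨c, rfl⟩ := D.exists_root (hD.pos_eq h hne).symm
  have := hD.type_eq h hne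
  rcases c with ⟨l, b⟩ | ⟨l, t, ht⟩
  · exact absurd this (by simp [Base.type, root, PathPoint.root])
  · have h1 := Sum.inr_injective this
    obtain rfl : k = l := congrArg Sigma.fst h1
    exact ⟨t, ht, (eq_of_heq (Sigma.mk.inj h1).2).symm, rfl⟩

/-- Quantum automorphisms preserve edge labels. The vertex subdividing the edge between `a` and `a'`
must go to a subdividing vertex with the same label that is adjacent to both `b` and `b'`, hence to
the one between `b` and `b'`. -/
theorem mul_old_eq {k : K} {a a' b b' : A k}
    (hne : q (D.root (.old k a)) (D.root (.old k b)) *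
      q (D.root (.old k a')) (D.root (.old k b')) ≠ 0) : a * a' = b * b' := by
  by_cases haa : a = a'
  · subst haa
    by_cases hbb : b = b'
    · rw [hbb, D.mul_self, D.mul_self]
    · exact absurd (h.mul_row _ (D.root_old_ne' hbb)) hne
  · have hbb : b ≠ b' := by
      rintro rfl
      exact hne (h.mul_column _ (D.root_old_ne' haa))
    have hs : s(a, a').label ≠ 1 := fun h1 => haa (D.eq_of_mul_eq_one h1)
    set e := D.root (.sub k s(a, a') hs)
    -- Insert the row of the subdividing vertex `e`, which sums to `1`, between the two factors;
    -- some term survives, and adjacency can be read off from each of its two consecutive products.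
    have h1 : ∑ y, q (D.root (.old k a)) (D.root (.old k b)) * q e y *
        q (D.root (.old k a')) (D.root (.old k b')) ≠ 0 := by
      rwa [← Finset.sum_mul, ← Finset.mul_sum, h.row, mul_one]
    obtain ⟨y, -, hy⟩ := Finset.exists_ne_zero_of_sum_ne_zero h1
    have hy1 := left_ne_zero_of_mul hy
    have hy2 : q e y * q (D.root (.old k a')) (D.root (.old k b')) ≠ 0 := by
      rw [mul_assoc] at hy
      exact right_ne_zero_of_mul hy
    obtain ⟨t, ht, hlab, rfl⟩ := hD.eq_root_sub h (right_ne_zero_of_mul hy1)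
    have hb : b ∈ t := D.baseGraph_old_sub.mp (D.graph_root_root.mp
      ((h.mul_ne_zero_adj hy1).mp (D.graph_root_root.mpr
        (D.baseGraph_old_sub.mpr (Sym2.mem_mk_left _ _)))))
    have hb' : b' ∈ t := D.baseGraph_old_sub.mp (D.graph_root_root.mp
      ((h.mul_ne_zero_adj hy2).mp (D.graph_root_root.mpr
        (D.baseGraph_old_sub.mpr (Sym2.mem_mk_right _ _))).symm).symm)
    obtain rfl := (Sym2.mem_and_mem_iff hbb).mp ⟨hb, hb'⟩
    exact hlab.symm

/-- Both entries equal their product. Multiplying the first by the row of `a'`, or the second by the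
row of `a`, leaves a single term by `mul_old_eq`. So each block depends only on the product of its
indices. -/
theorem old_eq {k : K} (a a' b : A k) :
    q (D.root (.old k a)) (D.root (.old k b)) =
      q (D.root (.old k a')) (D.root (.old k (a * a' * b))) := by
  have aux : ∀ {b b' : A k}, a * a' = b * b' → b' = a * a' * b := by
    intro b b' hb
    rw [hb, mul_comm b b', mul_assoc, D.mul_self, mul_one]
  have h1 : q (D.root (.old k a)) (D.root (.old k b)) =
      q (D.root (.old k a)) (D.root (.old k b)) *
        q (D.root (.old k a')) (D.root (.old k (a * a' * b))) := by
    conv_lhs => rw [← mul_one (q _ _), ← h.row (D.root (.old k a')), Finset.mul_sum]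
    refine Finset.sum_eq_single _ (fun y _ hy => ?_) fun h => absurd (Finset.mem_univ _) h
    by_contra hne
    obtain ⟨b', rfl⟩ := hD.eq_root_old h (right_ne_zero_of_mul hne)
    exact hy (by rw [aux (hD.mul_old_eq h hne)])
  have h2 : q (D.root (.old k a')) (D.root (.old k (a * a' * b))) =
      q (D.root (.old k a)) (D.root (.old k b)) *
        q (D.root (.old k a')) (D.root (.old k (a * a' * b))) := by
    conv_lhs => rw [← one_mul (q _ _), ← h.row (D.root (.old k a)), Finset.sum_mul]
    refine Finset.sum_eq_single _ (fun y _ hy => ?_) fun h => absurd (Finset.mem_univ _) h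
    by_contra hne
    obtain ⟨b', rfl⟩ := hD.eq_root_old h (left_ne_zero_of_mul hne)
    have h3 := aux (hD.mul_old_eq h hne)
    exact hy (by rw [mul_left_cancel h3])
  rw [h1, ← h2]

theorem old_eq_firstRow {k : K} (a b : A k) :
    q (D.root (.old k a)) (D.root (.old k b)) = D.firstRow q k (a * b) := by
  rw [hD.old_eq h a 1 b, mul_one]
  rfl

theorem firstRow_eq {k : K} (c a : A k) :
    D.firstRow q k c = q (D.root (.old k a)) (D.root (.old k (c * a))) := by
  rw [hD.old_eq_firstRow h, mul_comm c, ← mul_assoc, D.mul_self, one_mul]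

/-- The projection `D.firstRow q k c` acts as the translation by `c` on the whole part, because by
`firstRow_eq` it is the entry from `a` to `c * a` for every `a`. For a group element this is
orthogonality in its row; a subdividing vertex is fixed by its two ends; a path vertex is fixed by
its predecessor and its position. -/
theorem mul_firstRow (x : D.Vertex) {k : K} (hx : x.base.part = k) (c : A k) (y : D.Vertex)
    (hne : q x y * D.firstRow q k c ≠ 0) : y = D.move k c x := by
  obtain ⟨b, j, hj⟩ := x
  induction j generalizing y with
  | zero =>
    rcases b with ⟨l, a⟩ | ⟨l, s, hs⟩ <;> obtain rfl : l = k := hx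
    · obtain ⟨b, rfl⟩ := hD.eq_root_old h (left_ne_zero_of_mul hne)
      change q (D.root (.old l a)) (D.root (.old l b)) * D.firstRow q l c ≠ 0 at hne
      rw [hD.firstRow_eq h c a] at hne
      change _ = D.move l c (D.root (.old l a))
      rw [D.move_root_old]
      by_contra hy
      exact hne (h.mul_row _ hy)
    · induction s with
      | _ a b =>
        change q (D.root (.sub l s(a, b) hs)) y * D.firstRow q l c ≠ 0 at hne
        change _ = D.move l c (D.root (.sub l s(a, b) hs))
        rw [D.move_root_sub]
        obtain ⟨t, ht, -, rfl⟩ := hD.eq_root_sub h (left_ne_zero_of_mul hne)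
        -- The same projection is rewritten as the entry from `d` to `c * d` for each end `d`, so
        -- the image of the subdividing vertex is adjacent to both translated ends.
        have key : ∀ d ∈ s(a, b), c * d ∈ t := by
          intro d hd
          rw [hD.firstRow_eq h c d] at hne
          exact D.baseGraph_old_sub.mp (D.graph_root_root.mp
            ((h.mul_ne_zero_adj hne).mp (D.graph_root_root.mpr
              (D.baseGraph_old_sub.mpr hd)).symm).symm)
        have hab : c * a ≠ c * b := fun hab => hs (by
          rw [Sym2.label_mk, mul_left_cancel hab, D.mul_self])
        obtain rfl := (Sym2.mem_and_mem_iff hab).mp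
          ⟨key a (Sym2.mem_mk_left _ _), key b (Sym2.mem_mk_right _ _)⟩
        rfl
  | succ j ih =>
    have hj' : j ≤ D.len b := (Nat.le_succ j).trans hj
    set x' : D.Vertex := ⟨b, j, hj'⟩
    -- By induction only one term of the row of the predecessor `x'` survives. It can be placed next
    -- to `q x y`, which makes `y` adjacent to the translate of `x'`.
    have h1 : D.firstRow q k c = q x' (D.move k c x') * D.firstRow q k c := by
      conv_lhs => rw [← h.sum_row_mul x' (D.firstRow q k c)]
      refine Finset.sum_eq_single _ (fun y _ hy => ?_) fun h => absurd (Finset.mem_univ _) h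
      by_contra hne
      exact hy (ih y hj' hx hne)
    rw [h1, ← mul_assoc] at hne
    have hne := left_ne_zero_of_mul hne
    have hpos := hD.pos_eq h (left_ne_zero_of_mul hne)
    have hadj := (h.mul_ne_zero_adj hne).mp (Or.inr ⟨rfl, Or.inr rfl⟩)
    rcases PathPoint.adj_iff.mp hadj with h2 | h2
    · exact absurd (hpos.trans h2.1) (Nat.succ_ne_zero j)
    · exact PathPoint.ext h2.1 hpos.symm

variable [∀ k, Fintype (A k)]

/-- The row of the unit of `A k` vanishes outside `A k`, so its entries there already sum to `1`. -/
theorem compatiblePVM : D.CompatiblePVM (D.firstRow q) where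
  star_eq k c := h.star_eq _ _
  idem k c := h.idem _ _
  sum_eq k := by
    classical
    rw [← h.row (D.root (.old k 1))]
    simp only [firstRow]
    rw [← Finset.sum_image (s := Finset.univ) (g := fun c : A k => D.root (.old k c))
      (f := fun y => q (D.root (.old k 1)) y)]
    · refine Finset.sum_subset (Finset.subset_univ _) fun y _ hy => ?_
      by_contra hne
      obtain ⟨b, rfl⟩ := hD.eq_root_old h hne
      exact hy (Finset.mem_image_of_mem _ (Finset.mem_univ b))
    · intro c _ d _ hcd
      by_contra hne
      exact D.root_old_ne' hne hcd
  compat {k l c d} hkl hne a b := by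
    -- The base points can be chosen freely, so one nonzero product controls the adjacency of all
    -- pairs `a`, `b`.
    rw [hD.firstRow_eq h c a, hD.firstRow_eq h d b] at hne
    have := h.mul_ne_zero_adj hne
    rw [D.graph_root_root, D.graph_root_root, D.baseGraph_old_old, D.baseGraph_old_old] at this
    simpa [hkl] using this

/-- A quantum automorphism of the model graph is determined by the first rows of its blocks. -/
theorem eq_quantumAut : q = D.quantumAut (D.firstRow q) := by
  classical
  funext x y
  have hP := hD.compatiblePVM h
  -- Multiply `q x y` by the resolution of `1`: the term of `c` is the whole projection if `c` maps
  -- `x` to `y`, and zero otherwise.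
  conv_lhs => rw [← mul_one (q x y), ← hP.sum_eq x.base.part, Finset.mul_sum]
  unfold quantumAut
  refine Finset.sum_congr rfl fun c _ => ?_
  split_ifs with hc
  · subst hc
    conv_rhs => rw [← h.sum_row_mul x (D.firstRow q x.base.part c)]
    symm
    refine Finset.sum_eq_single _ (fun y _ hy => ?_) fun h => absurd (Finset.mem_univ _) h
    by_contra hne
    exact hy (hD.mul_firstRow h x rfl c y hne)
  · by_contra hne
    exact hc (hD.mul_firstRow h x rfl c y hne).symm

end Admissible

end PartData

/-! ### Joint spectral projections of commuting symmetries -/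

/-- The joint spectral projection of the commuting symmetries `x i` for the eigenvalues `γ i`, in
a commutative ring with the element `h = 1/2`. -/
def symmetryProj {ι : Type u} [Fintype ι] {C : Type v} [CommRing C] (h : C) (x : ι → C)
    (γ : ι → ℤˣ) : C :=
  ∏ i, (h * (1 + ((γ i : ℤ) : C) * x i))

section SymmetryProj

variable {ι : Type u} [Fintype ι] {C : Type v} [CommRing C] {h : C} {x : ι → C}

theorem symmetryProj_idem (hh : h + h = 1) (hx : ∀ i, x i * x i = 1) (γ : ι → ℤˣ) :
    symmetryProj h x γ * symmetryProj h x γ = symmetryProj h x γ := by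
  rw [symmetryProj, ← Finset.prod_mul_distrib]
  refine Finset.prod_congr rfl fun i _ => ?_
  have h2 := hx i
  rcases Int.units_eq_one_or (γ i) with h1 | h1 <;> rw [h1] <;> push_cast
  · linear_combination h * h * h2 + h * (1 + x i) * hh
  · linear_combination h * h * h2 + h * (1 - x i) * hh

theorem mul_symmetryProj (hx : ∀ i, x i * x i = 1) (γ : ι → ℤˣ) (i : ι) :
    x i * symmetryProj h x γ = ((γ i : ℤ) : C) * symmetryProj h x γ := by
  classical
  have key : x i * (h * (1 + ((γ i : ℤ) : C) * x i)) =
      ((γ i : ℤ) : C) * (h * (1 + ((γ i : ℤ) : C) * x i)) := by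
    have h2 := hx i
    rcases Int.units_eq_one_or (γ i) with h1 | h1 <;> rw [h1] <;> push_cast
    · linear_combination h * h2
    · linear_combination - h * h2
  rw [symmetryProj, ← Finset.mul_prod_erase _ _ (Finset.mem_univ i), ← mul_assoc, key, mul_assoc]

/-- For each `i` the two spectral projections of `x i` sum to `1`; expand the product of these sums.
-/
theorem sum_symmetryProj [DecidableEq ι] (hh : h + h = 1) : ∑ γ, symmetryProj h x γ = 1 := by
  have key : ∀ i, ∑ ε : ℤˣ, h * (1 + ((ε : ℤ) : C) * x i) = 1 := fun i => by
    rw [show (Finset.univ : Finset ℤˣ) = {1, -1} from rfl, Finset.sum_pair (by decide)]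
    push_cast
    linear_combination hh
  have := Finset.prod_univ_sum (fun _ : ι => (Finset.univ : Finset ℤˣ))
    (fun i ε => h * (1 + ((ε : ℤ) : C) * x i))
  simp only [key, Finset.prod_const_one, Fintype.piFinset_univ] at this
  exact this.symm

theorem star_symmetryProj [StarRing C] (hs : star h = h) (hxs : ∀ i, star (x i) = x i)
    (γ : ι → ℤˣ) : star (symmetryProj h x γ) = symmetryProj h x γ := by
  rw [symmetryProj, star_prod]
  refine Finset.prod_congr rfl fun i _ => ?_
  rw [star_mul', star_add, star_one, star_mul', star_intCast, hs, hxs]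

end SymmetryProj

/-- The symmetries generate a commutative star subalgebra, in which the products of the projections
`(1 + γ i * x i) / 2` can be formed without regard to order. -/
theorem exists_jointSpectralProjections {ι : Type u} [Fintype ι] [DecidableEq ι] {B : Type v}
    [CStarAlgebra B] (x : ι → B) (hstar : ∀ i, star (x i) = x i) (hsq : ∀ i, x i * x i = 1)
    (hcomm : ∀ i j, x i * x j = x j * x i) :
    ∃ P : (ι → ℤˣ) → B, (∀ γ, star (P γ) = P γ) ∧ (∀ γ, P γ * P γ = P γ) ∧ (∑ γ, P γ = 1) ∧
      ∀ i γ, x i * P γ = ((γ i : ℤ) : B) * P γ := by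
  obtain ⟨C, _, hC⟩ : ∃ C : StarSubalgebra ℂ B, IsMulCommutative C ∧ ∀ i, x i ∈ C :=
    ⟨StarAlgebra.adjoin ℂ (Set.range x), StarAlgebra.isMulCommutative_adjoin ℂ
      (by rintro _ ⟨i, rfl⟩ _ ⟨j, rfl⟩; exact hcomm i j)
      (by rintro _ ⟨i, rfl⟩ _ ⟨j, rfl⟩; rw [hstar]; exact hcomm i j),
      fun i => StarAlgebra.subset_adjoin ℂ _ ⟨i, rfl⟩⟩
  let _ : CommRing C :=
    { (inferInstance : Ring C) with mul_comm := fun a b => IsMulCommutative.is_comm.comm a b }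
  let y : ι → C := fun i => ⟨x i, hC i⟩
  let h : C := algebraMap ℂ C (1 / 2)
  have hh : h + h = 1 := by
    rw [← map_add, ← map_one (algebraMap ℂ C)]
    norm_num
  have hs : star h = h := by
    refine (algebraMap_star_comm (1 / 2 : ℂ)).symm.trans ?_
    norm_num [h]
  have hy : ∀ i, y i * y i = 1 := fun i => Subtype.ext (hsq i)
  have hys : ∀ i, star (y i) = y i := fun i => Subtype.ext (hstar i)
  refine ⟨fun γ => (symmetryProj h y γ : C), fun γ => ?_, fun γ => ?_, ?_, fun i γ => ?_⟩
  · exact congrArg Subtype.val (star_symmetryProj hs hys γ)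
  · exact congrArg Subtype.val (symmetryProj_idem hh hy γ)
  · have := congrArg C.subtype (sum_symmetryProj (x := y) hh)
    rwa [map_sum, map_one] at this
  · have := congrArg C.subtype (mul_symmetryProj (h := h) hy γ i)
    rwa [map_mul, map_mul, map_intCast] at this

/-! ### Solutions of a linear system and families of projection-valued measures -/

section System

variable {m : Type v} {n : Type u} [Fintype n]

theorem mem_equationSupport {M : Matrix m n (ZMod 2)} {k : m} {i : n} :
    i ∈ equationSupport M k ↔ M k i = 1 := by
  simp [equationSupport]

/-- The sign functions on `S_k` with product `1`. -/
def signGroup (M : Matrix m n (ZMod 2)) (k : m) : Subgroup (equationSupport M k → ℤˣ) where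
  carrier := {α | ∏ i, α i = 1}
  one_mem' := by simp
  mul_mem' {α β} hα hβ := by
    simp only [Set.mem_ofPred_eq] at hα hβ ⊢
    simp only [Pi.mul_apply, Finset.prod_mul_distrib, hα, hβ, mul_one]
  inv_mem' {α} hα := by
    simp only [Set.mem_ofPred_eq] at hα ⊢
    simp only [Pi.inv_apply, Finset.prod_inv_distrib, hα, inv_one]

instance (M : Matrix m n (ZMod 2)) (k : m) : Fintype (signGroup M k) := Fintype.ofFinite _

/-- An element of the sign group of the equation `k`, as a vertex of the graph of the system. -/
def signVertex (M : Matrix m n (ZMod 2)) {k : m} (a : signGroup M k) : SystemVertex M 0 :=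
  ⟨k, a.1, by rw [Pi.zero_apply, if_pos rfl]; exact a.2⟩

theorem signVertex_surjective {M : Matrix m n (ZMod 2)} (v : SystemVertex M 0) :
    ∃ (k : m) (a : signGroup M k), v = signVertex M a := by
  obtain ⟨k, α, hα⟩ := v
  exact ⟨k, ⟨α, by rwa [Pi.zero_apply, if_pos rfl] at hα⟩, rfl⟩

theorem signVertex_eq_iff {M : Matrix m n (ZMod 2)} {k l : m} {a : signGroup M k} {b : signGroup M l} :
    signVertex M a = signVertex M b ↔ PartData.Base.old (A := fun k => signGroup M k) k a =
      .old l b := by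
  constructor
  · intro h
    obtain rfl : k = l := congrArg Sigma.fst h
    congr 1
    exact Subtype.ext (congrArg Subtype.val (eq_of_heq (Sigma.mk.inj h).2))
  · intro h
    cases h
    rfl

variable {M : Matrix m n (ZMod 2)}

variable {B : Type w} [CStarAlgebra B]

/-- The projections `P k γ` project to the joint eigenspaces of the `x i`. -/
def IsSpectral (x : n → B) (P : ∀ k, signGroup M k → B) : Prop :=
  ∀ k (i : n) (hi : i ∈ equationSupport M k) (γ : signGroup M k),
    x i * P k γ = ((γ.1 ⟨i, hi⟩ : ℤ) : B) * P k γ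

theorem units_cast_mul_self (ε : ℤˣ) : ((ε : ℤ) : B) * ((ε : ℤ) : B) = 1 := by
  rw [← Int.cast_mul, ← Units.val_mul, Int.units_mul_self, Units.val_one, Int.cast_one]

theorem eq_zero_of_units_cast_ne {ε δ : ℤˣ} (h : ε ≠ δ) {b : B}
    (hb : ((ε : ℤ) : B) * b = ((δ : ℤ) : B) * b) : b = 0 := by
  have : ∀ b : B, b = -b → b = 0 := fun b hb => by
    have h2 : (2 : ℂ) • b = 0 := by
      rw [two_smul]
      nth_rewrite 1 [hb]
      exact neg_add_cancel b
    exact (smul_eq_zero.mp h2).resolve_left two_ne_zero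
  rcases Int.units_eq_one_or ε with rfl | rfl <;> rcases Int.units_eq_one_or δ with rfl | rfl
  · exact absurd rfl h
  · exact this b (by simpa using hb)
  · exact this b (by simpa using hb.symm)
  · exact absurd rfl h

theorem list_prod_mul {ι : Type u} {y : ι → B} {ε : ι → ℤˣ} {p : B} (l : List ι)
    (h : ∀ i ∈ l, y i * p = ((ε i : ℤ) : B) * p) :
    (l.map y).prod * p = (((l.map ε).prod : ℤ) : B) * p := by
  induction l with
  | nil => simp
  | cons i l ih =>
    rw [List.map_cons, List.prod_cons, List.map_cons, List.prod_cons, mul_assoc,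
      ih fun j hj => h j (List.mem_cons_of_mem i hj), ← mul_assoc, ← (Int.cast_commute _ _).eq,
      mul_assoc, h i List.mem_cons_self, Units.val_mul, Int.cast_mul, ← mul_assoc,
      (Int.cast_commute _ _).eq]

/-- The extension of a sign function by `1`. -/
def signExtend {M : Matrix m n (ZMod 2)} {k : m} (γ : equationSupport M k → ℤˣ) (i : n) : ℤˣ :=
  open Classical in if hi : i ∈ equationSupport M k then γ ⟨i, hi⟩ else 1

theorem signExtend_of_mem {k : m} (γ : equationSupport M k → ℤˣ) {i : n}
    (hi : i ∈ equationSupport M k) : signExtend γ i = γ ⟨i, hi⟩ := dif_pos hi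

theorem list_prod_signExtend {k : m} (γ : equationSupport M k → ℤˣ) {l : List n} (hl : l.Nodup)
    (h : ∀ i, i ∈ l ↔ M k i = 1) : (l.map (signExtend γ)).prod = ∏ i, γ i := by
  classical
  rw [← List.prod_toFinset _ hl]
  have : l.toFinset = equationSupport M k := by
    ext i
    rw [List.mem_toFinset, h, mem_equationSupport]
  rw [this, ← Finset.prod_coe_sort]
  exact Finset.prod_congr rfl fun i _ => signExtend_of_mem γ i.2

namespace IsSpectral

variable {x : n → B} {P : ∀ k, signGroup M k → B} (h : IsSpectral x P)
include h

theorem mul_left (hx : ∀ i, star (x i) = x i) (hP : ∀ k c, star (P k c) = P k c) {k : m} {i : n}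
    (hi : i ∈ equationSupport M k) (γ : signGroup M k) :
    P k γ * x i = ((γ.1 ⟨i, hi⟩ : ℤ) : B) * P k γ := by
  have := congrArg star (h k i hi γ)
  rw [star_mul, star_mul, hx, hP, star_intCast] at this
  rw [this]
  exact ((Int.cast_commute _ _).eq).symm

/-- Place `x i` between the two projections: acting to the left and to the right it gives different
signs. The equations `k` and `l` may differ; this yields both orthogonality inside one equation and
compatibility between two. -/
theorem mul_eq_zero (hx : ∀ i, star (x i) = x i) (hP : ∀ k c, star (P k c) = P k c)
    {Q : ∀ k, signGroup M k → B} (hQ : IsSpectral x Q) {k l : m} {γ : signGroup M k}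
    {δ : signGroup M l} {i : n} (hk : i ∈ equationSupport M k) (hl : i ∈ equationSupport M l)
    (hne : γ.1 ⟨i, hk⟩ ≠ δ.1 ⟨i, hl⟩) : P k γ * Q l δ = 0 := by
  refine eq_zero_of_units_cast_ne hne ?_
  rw [← mul_assoc, ← h.mul_left hx hP hk, mul_assoc, hQ l i hl, ← mul_assoc, ← mul_assoc,
    (Int.cast_commute _ _).eq]

/-- The spectral projections are unique. -/
theorem unique (hx : ∀ i, star (x i) = x i) (hP : ∀ k c, star (P k c) = P k c)
    (hPsum : ∀ k, ∑ c, P k c = 1)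
    {Q : ∀ k, signGroup M k → B} (hQ : IsSpectral x Q)
    (hQsum : ∀ k, ∑ c, Q k c = 1) : P = Q := by
  have key : ∀ k (γ δ : signGroup M k), γ ≠ δ → P k γ * Q k δ = 0 := by
    intro k γ δ hne
    obtain ⟨⟨i, hi⟩, hi'⟩ := Function.ne_iff.mp fun h' => hne (Subtype.ext h')
    exact h.mul_eq_zero hx hP hQ hi hi hi'
  funext k γ
  have h1 : P k γ * Q k γ = P k γ := by
    conv_rhs => rw [← mul_one (P k γ), ← hQsum k, Finset.mul_sum]
    exact (Finset.sum_eq_single γ (fun δ _ hδ => key k γ δ hδ.symm)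
      fun h => absurd (Finset.mem_univ _) h).symm
  have h2 : P k γ * Q k γ = Q k γ := by
    conv_rhs => rw [← one_mul (Q k γ), ← hPsum k, Finset.sum_mul]
    exact (Finset.sum_eq_single γ (fun δ _ hδ => key k δ γ hδ)
      fun h => absurd (Finset.mem_univ _) h).symm
  exact h1.symm.trans h2

end IsSpectral

/-- An identity may be checked on the ranges of the projections, where the symmetries are scalars.
-/
theorem mul_spectral_ext {P : ∀ k, signGroup M k → B} {k : m} (hPsum : ∑ c, P k c = 1) {y z : B}
    (h : ∀ c, y * P k c = z * P k c) : y = z := by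
  rw [← mul_one y, ← mul_one z, ← hPsum, Finset.mul_sum, Finset.mul_sum]
  exact Finset.sum_congr rfl fun c _ => h c

variable [DecidableEq n]

/-- The model graph of the reduced graph of a homogeneous linear system. -/
def systemData (M : Matrix m n (ZMod 2)) (ℓV : m → ℕ) (ℓE : ReducedColor n → ℕ) :
    PartData m (fun k => signGroup M k) where
  mul_self _ := Subtype.ext (funext fun _ => Int.units_mul_self _)
  cross a b := (reducedSystemGraph M 0).graph.Adj (signVertex M a) (signVertex M b)
  cross_symm h := h.symm
  lenV := ℓV
  lenE {k} a := ℓE (some (signProduct (signVertex M a) (signVertex M (1 : signGroup M k))))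

theorem systemData_cross {ℓV : m → ℕ} {ℓE : ReducedColor n → ℕ}
    {k l : m} {a : signGroup M k} {b : signGroup M l} : (systemData M ℓV ℓE).cross a b ↔
      (reducedSystemGraph M 0).graph.Adj (signVertex M a) (signVertex M b) := Iff.rfl

/-- The systems in which every equation has at least two variables, every variable occurs in at
least two equations, and two equations have at most one common variable. -/
structure IsIncidenceSystem (M : Matrix m n (ZMod 2)) : Prop where
  exists_mem : ∀ i, ∃ k, i ∈ equationSupport M k
  exists_ne : ∀ {k i}, i ∈ equationSupport M k → ∃ l, k ≠ l ∧ i ∈ equationSupport M l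
  exists_ne_mem : ∀ {k i}, i ∈ equationSupport M k → ∃ j ∈ equationSupport M k, j ≠ i
  nonempty : ∀ k, (equationSupport M k).Nonempty
  eq_of_mem : ∀ {k l i j}, k ≠ l → i ∈ equationSupport M k → i ∈ equationSupport M l →
    j ∈ equationSupport M k → j ∈ equationSupport M l → i = j

variable {ℓV : m → ℕ} {ℓE : ReducedColor n → ℕ}

theorem IsIncidenceSystem.cross_iff (hM : IsIncidenceSystem M) {k l : m} (hkl : k ≠ l) {i : n}
    (hk : i ∈ equationSupport M k) (hl : i ∈ equationSupport M l) (a : signGroup M k)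
    (b : signGroup M l) : (systemData M ℓV ℓE).cross a b ↔ a.1 ⟨i, hk⟩ * b.1 ⟨i, hl⟩ = -1 := by
  rw [systemData_cross]
  constructor
  · intro h
    exact h.2 hkl ⟨i, Finset.mem_inter.mpr ⟨hk, hl⟩⟩
  · intro h
    refine ⟨⟨fun h' => hkl (congrArg Sigma.fst h'), ⟨i, Finset.mem_inter.mpr ⟨hk, hl⟩⟩⟩,
      fun _ j => ?_⟩
    obtain ⟨j, hj⟩ := j
    obtain ⟨hj1, hj2⟩ := Finset.mem_inter.mp hj
    obtain rfl := hM.eq_of_mem hkl hk hl hj1 hj2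
    exact h

theorem exists_mem_of_cross {k l : m} {a : signGroup M k} {b : signGroup M l}
    (h : (systemData M ℓV ℓE).cross a b) : ∃ i ∈ equationSupport M k, i ∈ equationSupport M l := by
  obtain ⟨i, hi⟩ := (systemData_cross.mp h).1.2
  exact ⟨i, Finset.mem_inter.mp hi⟩

/-- Self-adjoint elements that satisfy the relations of the homogeneous solution group. -/
structure IsSolution (M : Matrix m n (ZMod 2)) {B : Type w} [CStarAlgebra B] (x : n → B) :
    Prop where
  star_eq : ∀ i, star (x i) = x i
  sq : ∀ i, x i * x i = 1
  comm : ∀ {k i j}, i ∈ equationSupport M k → j ∈ equationSupport M k → x i * x j = x j * x i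
  prod : ∀ k (l : List n), l.Nodup → (∀ i, i ∈ l ↔ M k i = 1) → (l.map x).prod = 1

/-- The spectral projections of a solution. -/
theorem IsSolution.exists_spectral (hM : IsIncidenceSystem M) {x : n → B} (hx : IsSolution M x) :
    ∃ P : ∀ k, signGroup M k → B, (systemData M ℓV ℓE).CompatiblePVM P ∧ IsSpectral x P := by
  have h1 : ∀ k, ∃ P : signGroup M k → B, (∀ γ, star (P γ) = P γ) ∧ (∀ γ, P γ * P γ = P γ) ∧
      (∑ γ, P γ = 1) ∧ ∀ i (hi : i ∈ equationSupport M k) γ,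
        x i * P γ = ((γ.1 ⟨i, hi⟩ : ℤ) : B) * P γ := by
    intro k
    obtain ⟨P, hs, hi, hsum, hP⟩ := exists_jointSpectralProjections
      (fun i : equationSupport M k => x i.1) (fun i => hx.star_eq _) (fun i => hx.sq _)
      (fun i j => hx.comm i.2 j.2)
    refine ⟨fun γ => P γ.1, fun γ => hs _, fun γ => hi _, ?_, fun i hi γ => hP ⟨i, hi⟩ γ.1⟩
    rw [← hsum]
    -- The product of the `x i` over `S_k` is `1`, but it acts on the range of `P γ` as the product
    -- of the signs of `γ`. A sign function with product `-1` therefore has zero projection and can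
    -- be dropped.
    have hz : ∀ γ, γ ∉ signGroup M k → P γ = 0 := by
      intro γ hγ
      have hmem : ∀ i, i ∈ (equationSupport M k).toList ↔ M k i = 1 := fun i => by
        rw [Finset.mem_toList, mem_equationSupport]
      have h2 := list_prod_mul (y := x) (ε := signExtend γ) (p := P γ) (equationSupport M k).toList
        fun i hi => by
          rw [signExtend_of_mem γ (Finset.mem_toList.mp hi)]
          exact hP ⟨i, Finset.mem_toList.mp hi⟩ γ
      rw [hx.prod k _ (Finset.nodup_toList _) hmem,
        list_prod_signExtend γ (Finset.nodup_toList _) hmem] at h2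
      refine eq_zero_of_units_cast_ne (ε := 1) (δ := ∏ i, γ i) (fun h => hγ h.symm) ?_
      simpa using h2
    rw [← Finset.sum_subset (Finset.subset_univ ((Finset.univ : Finset (signGroup M k)).image
      Subtype.val))]
    · exact (Finset.sum_image fun _ _ _ _ h => Subtype.ext h).symm
    · exact fun γ _ hγ => hz γ fun h => hγ
        (Finset.mem_image.mpr ⟨(⟨γ, h⟩ : signGroup M k), Finset.mem_univ _, rfl⟩)
  choose P hs hi hsum hP using h1
  have hP : IsSpectral x P := hP
  refine ⟨P, ⟨hs, hi, hsum, fun {k l c d} hkl hne a b => ?_⟩, hP⟩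
  -- A nonzero product forces `c` and `d` to agree at a common variable, so translating by them
  -- leaves the sign that decides adjacency unchanged.
  have key : ∀ i (hk : i ∈ equationSupport M k) (hl : i ∈ equationSupport M l),
      c.1 ⟨i, hk⟩ * d.1 ⟨i, hl⟩ = 1 := by
    intro i hk hl
    by_contra h
    refine hne (hP.mul_eq_zero hx.star_eq hs hP hk hl fun h' => h ?_)
    rw [h', Int.units_mul_self]
  have key' : ∀ i (hk : i ∈ equationSupport M k) (hl : i ∈ equationSupport M l),
      (systemData M ℓV ℓE).cross a b ↔ (systemData M ℓV ℓE).cross (c * a) (d * b) := by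
    intro i hk hl
    rw [hM.cross_iff hkl hk hl, hM.cross_iff hkl hk hl]
    change _ ↔ c.1 ⟨i, hk⟩ * a.1 ⟨i, hk⟩ * (d.1 ⟨i, hl⟩ * b.1 ⟨i, hl⟩) = -1
    rw [mul_mul_mul_comm, key, one_mul]
  refine ⟨fun h => ?_, fun h => ?_⟩ <;> obtain ⟨i, hk, hl⟩ := exists_mem_of_cross h
  · exact (key' i hk hl).mp h
  · exact (key' i hk hl).mpr h

/-- The symmetry with the eigenvalue `γ i` on the range of `P k γ`. -/
def spectralSymmetry (P : ∀ k, signGroup M k → B) (k : m) (i : n) : B :=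
  ∑ γ : signGroup M k, ((signExtend γ.1 i : ℤ) : B) * P k γ

namespace PartData.CompatiblePVM

variable {P : ∀ k, signGroup M k → B} (hP : (systemData M ℓV ℓE).CompatiblePVM P)
include hP

theorem spectralSymmetry_mul (k : m) (i : n) (γ : signGroup M k) :
    spectralSymmetry P k i * P k γ = ((signExtend γ.1 i : ℤ) : B) * P k γ := by
  rw [spectralSymmetry, Finset.sum_mul, Finset.sum_eq_single γ]
  · rw [mul_assoc, hP.idem]
  · intro δ _ hδ
    rw [mul_assoc, hP.mul_eq_zero k hδ, mul_zero]
  · exact fun h => absurd (Finset.mem_univ _) h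

/-- Expand both symmetries over all products `P k c * P l d`. Compatibility makes `c` and `d` agree
at `i` whenever the product is nonzero, so the coefficients coincide. -/
theorem spectralSymmetry_eq (hM : IsIncidenceSystem M) {k l : m} {i : n}
    (hk : i ∈ equationSupport M k) (hl : i ∈ equationSupport M l) :
    spectralSymmetry P k i = spectralSymmetry P l i := by
  by_cases hkl : k = l
  · rw [hkl]
  have h1 : spectralSymmetry P k i = ∑ c : signGroup M k, ∑ d : signGroup M l,
      ((signExtend c.1 i : ℤ) : B) * (P k c * P l d) := by
    refine Finset.sum_congr rfl fun c _ => ?_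
    rw [← Finset.mul_sum, ← Finset.mul_sum, hP.sum_eq, mul_one]
  have h2 : spectralSymmetry P l i = ∑ c : signGroup M k, ∑ d : signGroup M l,
      ((signExtend d.1 i : ℤ) : B) * (P k c * P l d) := by
    rw [Finset.sum_comm]
    refine Finset.sum_congr rfl fun d _ => ?_
    rw [← Finset.mul_sum, ← Finset.sum_mul, hP.sum_eq, one_mul]
  rw [h1, h2]
  refine Finset.sum_congr rfl fun c _ => Finset.sum_congr rfl fun d _ => ?_
  by_cases h0 : P k c * P l d = 0
  · rw [h0, mul_zero, mul_zero]
  -- The units `1`, `1` are not adjacent, since their signs multiply to `1`; hence `c` and `d` are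
  -- not adjacent either.
  · have h3 := hP.compat hkl h0 1 1
    rw [hM.cross_iff hkl hk hl, hM.cross_iff hkl hk hl, mul_one, mul_one] at h3
    have h4 : ¬ (c.1 ⟨i, hk⟩ * d.1 ⟨i, hl⟩ = -1) := fun h => by
      have := h3.mpr h
      simp at this
    rw [signExtend_of_mem c.1 hk, signExtend_of_mem d.1 hl]
    rcases Int.units_eq_one_or (c.1 ⟨i, hk⟩) with h5 | h5 <;>
      rcases Int.units_eq_one_or (d.1 ⟨i, hl⟩) with h6 | h6 <;> rw [h5, h6] at h4 <;> rw [h5, h6]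
    · exact absurd (one_mul _) h4
    · exact absurd (mul_one _) h4

/-- The symmetries of a compatible family of projection-valued measures solve the system. -/
theorem exists_solution (hM : IsIncidenceSystem M) :
    ∃ x : n → B, IsSolution M x ∧ IsSpectral x P ∧
      ∀ k i, i ∈ equationSupport M k → x i = spectralSymmetry P k i := by
  -- Any equation containing the variable may be used, by `spectralSymmetry_eq`.
  choose e he using hM.exists_mem
  let x : n → B := fun i => spectralSymmetry P (e i) i
  have hx : ∀ k i, i ∈ equationSupport M k → x i = spectralSymmetry P k i :=
    fun k i hi => hP.spectralSymmetry_eq hM (he i) hi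
  have hxP : ∀ k i, i ∈ equationSupport M k → ∀ γ : signGroup M k,
      x i * P k γ = ((signExtend γ.1 i : ℤ) : B) * P k γ := fun k i hi γ => by
    rw [hx k i hi, hP.spectralSymmetry_mul]
  refine ⟨x, ⟨fun i => ?_, fun i => ?_, fun {k i j} hi hj => ?_, fun k l hl h => ?_⟩,
    fun k i hi γ => ?_, hx⟩
  · change star (∑ γ, _) = ∑ γ, _
    rw [star_sum]
    refine Finset.sum_congr rfl fun γ _ => ?_
    rw [star_mul, star_intCast, hP.star_eq, (Int.cast_commute _ _).eq]
  · refine mul_spectral_ext (hP.sum_eq (e i)) fun γ => ?_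
    rw [mul_assoc, hxP _ i (he i), ← mul_assoc, ← (Int.cast_commute _ _).eq, mul_assoc,
      hxP _ i (he i), ← mul_assoc, units_cast_mul_self]
  · refine mul_spectral_ext (hP.sum_eq k) fun γ => ?_
    rw [mul_assoc, hxP _ j hj, ← mul_assoc, ← (Int.cast_commute _ _).eq, mul_assoc,
      hxP _ i hi, mul_assoc, hxP _ i hi, ← mul_assoc (x j), ← (Int.cast_commute _ _).eq,
      mul_assoc _ (x j), hxP _ j hj, ← mul_assoc, ← mul_assoc, (Int.cast_commute _ _).eq]
  -- On the range of `P k γ` the product of the symmetries is the product of the signs of `γ`, which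
  -- is `1` by the definition of `signGroup`.
  · refine mul_spectral_ext (hP.sum_eq k) fun γ => ?_
    rw [list_prod_mul l fun i hi => hxP k i (mem_equationSupport.mpr ((h i).mp hi)) γ,
      list_prod_signExtend γ.1 hl h, show ∏ i, γ.1 i = 1 from γ.2, Units.val_one, Int.cast_one]
  · rw [hxP k i hi, signExtend_of_mem γ.1 hi]

end PartData.CompatiblePVM

end System

theorem attachPaths_edgeColor {V : Type u} {C : Type w} {D : Type v} (G : ColoredGraph V C D)
    (ℓ : C → ℕ) (c₀ : D) (x y : PathVertex G ℓ) : (G.attachPaths ℓ c₀).edgeColor s(x, y) =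
      if (x.2 : ℕ) = 0 ∧ (y.2 : ℕ) = 0 then G.edgeColor s(x.1, y.1) else c₀ := rfl

/-! ### Incidence systems give admissible data. -/

section System

variable {m : Type v} {n : Type u} [Fintype n] [DecidableEq n] {M : Matrix m n (ZMod 2)}
  {ℓV : m → ℕ} {ℓE : ReducedColor n → ℕ}

namespace IsIncidenceSystem

variable (hM : IsIncidenceSystem M)
include hM

/-- To get the sign `-1` at `i` while keeping the product `1`, flip the sign at a second variable of
the equation as well. -/
theorem exists_sign {k : m} {i : n} (hi : i ∈ equationSupport M k) (ε : ℤˣ) :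
    ∃ a : signGroup M k, a.1 ⟨i, hi⟩ = ε := by
  rcases Int.units_eq_one_or ε with rfl | rfl
  · exact ⟨1, rfl⟩
  · obtain ⟨j, hj, hji⟩ := hM.exists_ne_mem hi
    let σ (j : equationSupport M k) : equationSupport M k → ℤˣ := Pi.mulSingle j (-1)
    refine ⟨⟨σ ⟨i, hi⟩ * σ ⟨j, hj⟩, ?_⟩, ?_⟩
    · have hσ : ∀ j, ∏ x, σ j x = -1 := fun j => by
        rw [Finset.prod_pi_mulSingle' j, if_pos (Finset.mem_univ j)]
      change ∏ x, (σ ⟨i, hi⟩ x * σ ⟨j, hj⟩ x) = 1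
      rw [Finset.prod_mul_distrib, hσ, hσ]
      rfl
    · change σ ⟨i, hi⟩ ⟨i, hi⟩ * σ ⟨j, hj⟩ ⟨i, hi⟩ = -1
      simp only [σ]
      rw [Pi.mulSingle_eq_same, Pi.mulSingle_eq_of_ne, mul_one]
      exact fun h => hji (congrArg Subtype.val h).symm

theorem exists_cross {k l : m} (hkl : k ≠ l) {i : n} (hk : i ∈ equationSupport M k)
    (hl : i ∈ equationSupport M l) (a : signGroup M k) :
    ∃ b : signGroup M l, (systemData M ℓV ℓE).cross a b := by
  obtain ⟨b, hb⟩ := hM.exists_sign hl (- a.1 ⟨i, hk⟩)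
  refine ⟨b, (hM.cross_iff hkl hk hl a b).mpr ?_⟩
  rw [hb, mul_neg, Int.units_mul_self]

/-- The color contains its domain `S_k`, which determines `k`: it has at least two elements, and
different equations share at most one. Multiplying by the unit leaves `a` itself as the sign
function. -/
theorem eq_of_signProduct_eq {k l : m} {a : signGroup M k} {b : signGroup M l}
    (h : signProduct (signVertex M a) (signVertex M (1 : signGroup M k)) =
      signProduct (signVertex M b) (signVertex M (1 : signGroup M l))) :
    (⟨k, a⟩ : Σ k, signGroup M k) = ⟨l, b⟩ := by
  have h1 : equationSupport M k = equationSupport M l := by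
    have := congrArg Sigma.fst h
    simpa [signProduct, signVertex] using this
  obtain rfl : k = l := by
    by_contra hkl
    obtain ⟨i, hi⟩ := hM.nonempty k
    obtain ⟨j, hj, hji⟩ := hM.exists_ne_mem hi
    exact hji (hM.eq_of_mem hkl hj (h1 ▸ hj) hi (h1 ▸ hi))
  have h2 := eq_of_heq (Sigma.mk.inj h).2
  congr 1
  refine Subtype.ext (funext fun i => ?_)
  have h3 := congrFun h2 ⟨i.1, Finset.mem_inter.mpr ⟨i.2, i.2⟩⟩
  change a.1 i * 1 = b.1 i * 1 at h3
  simpa using h3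

theorem adj_signVertex {k : m} {a b : signGroup M k} (hab : a ≠ b) :
    (reducedSystemGraph M 0).graph.Adj (signVertex M a) (signVertex M b) := by
  obtain ⟨i, hi⟩ := hM.nonempty k
  refine ⟨⟨fun h => hab ?_, ⟨i, Finset.mem_inter.mpr ⟨hi, hi⟩⟩⟩, fun h => absurd rfl h⟩
  have := eq_of_heq (Sigma.mk.inj h).2
  exact Subtype.ext (congrArg Subtype.val this)

omit hM in
theorem edgeColor_signVertex {k : m} (a b : signGroup M k) :
    (reducedSystemGraph M 0).edgeColor s(signVertex M a, signVertex M b) =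
      some (signProduct (signVertex M a) (signVertex M b)) := if_pos rfl

/-- Two variables of the equation `k` occur in two further equations. These are different because no
equation other than `k` contains both variables, so every element has neighbours in two other parts.
-/
theorem admissible (hV : Function.Injective ℓV)
    (hE : Set.InjOn ℓE ((reducedSystemGraph M 0).colors \ {none})) :
    (systemData M ℓV ℓE).Admissible where
  nontrivial k := by
    obtain ⟨i, hi⟩ := hM.nonempty k
    obtain ⟨a, ha⟩ := hM.exists_sign hi (-1)
    refine ⟨a, ?_⟩
    rintro rfl
    change (1 : ℤˣ) = -1 at ha
    exact absurd ha (by decide)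
  two_cross k a := by
    obtain ⟨i, hi⟩ := hM.nonempty k
    obtain ⟨j, hj, hji⟩ := hM.exists_ne_mem hi
    obtain ⟨l, hkl, hil⟩ := hM.exists_ne hi
    obtain ⟨l', hkl', hjl⟩ := hM.exists_ne hj
    obtain ⟨b, hb⟩ := hM.exists_cross (ℓV := ℓV) (ℓE := ℓE) hkl hi hil a
    obtain ⟨b', hb'⟩ := hM.exists_cross (ℓV := ℓV) (ℓE := ℓE) hkl' hj hjl a
    refine ⟨l, l', b, b', hkl, hkl', ?_, hb, hb'⟩
    rintro rfl
    exact hji (hM.eq_of_mem hkl hj hjl hi hil)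
  lenV_injective := hV
  -- The edge between `a ≠ 1` and `1` shows that the color belonging to `a` really occurs, so the
  -- injectivity on occurring colors suffices.
  lenE_injective {k l} a b ha hb hab := by
    refine hM.eq_of_signProduct_eq (Option.some_injective _ (hE ?_ ?_ hab))
    · exact ⟨⟨_, hM.adj_signVertex ha, edgeColor_signVertex a 1⟩, by simp⟩
    · exact ⟨⟨_, hM.adj_signVertex hb, edgeColor_signVertex b 1⟩, by simp⟩

end IsIncidenceSystem

/-! ### The decolored graph is the model graph -/

/-- The color of an edge inside a part depends only on the product of its ends, so a path length
that depends only on the label can encode it. -/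
theorem signProduct_signVertex {k : m} (a b : signGroup M k) :
    signProduct (signVertex M a) (signVertex M b) =
      signProduct (signVertex M (a * b)) (signVertex M (1 : signGroup M k)) := by
  refine congrArg (Sigma.mk _) (funext fun i => ?_)
  change _ = (a.1 _ * b.1 _) * 1
  rw [mul_one]
  rfl

variable (M ℓV) in
/-- A vertex of a sign group, as a vertex of the graph with paths. -/
def pathVertex {k : m} (a : signGroup M k) : PathVertex (reducedSystemGraph M 0) ℓV :=
  ⟨signVertex M a, ⟨0, Nat.succ_pos _⟩⟩

theorem edgeColor_map_pathVertex {k : m} (s : Sym2 (signGroup M k)) :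
    ((reducedSystemGraph M 0).attachPaths ℓV none).edgeColor (s.map (pathVertex M ℓV)) =
      some (signProduct (signVertex M s.label) (signVertex M (1 : signGroup M k))) := by
  induction s with
  | _ a b =>
    have h : ((reducedSystemGraph M 0).attachPaths ℓV none).edgeColor
        s(pathVertex M ℓV a, pathVertex M ℓV b) =
        (reducedSystemGraph M 0).edgeColor s(signVertex M a, signVertex M b) :=
      (attachPaths_edgeColor _ _ _ _ _).trans (if_pos ⟨rfl, rfl⟩)
    rw [Sym2.map_mk, h, IsIncidenceSystem.edgeColor_signVertex, signProduct_signVertex]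
    rfl

theorem map_pathVertex_mem (hM : IsIncidenceSystem M) {k : m} {s : Sym2 (signGroup M k)}
    (hs : s.label ≠ 1) : s.map (pathVertex M ℓV) ∈
      ((reducedSystemGraph M 0).attachPaths ℓV none).graph.edgeSet ∧
      ((reducedSystemGraph M 0).attachPaths ℓV none).edgeColor (s.map (pathVertex M ℓV)) ≠ none := by
  refine ⟨?_, by rw [edgeColor_map_pathVertex]; exact Option.some_ne_none _⟩
  induction s with
  | _ a b =>
    refine Or.inl ⟨rfl, rfl, hM.adj_signVertex ?_⟩
    rintro rfl
    exact hs (Subtype.ext (funext fun _ => Int.units_mul_self _))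

variable (ℓV ℓE) in
/-- The map from the model graph to the decolored graph. -/
def toDecolor (hM : IsIncidenceSystem M) : (systemData M ℓV ℓE).Vertex →
    SubdivisionVertex ((reducedSystemGraph M 0).attachPaths ℓV none) ℓE none
  | ⟨.old _ a, j, hj⟩ => Sum.inl ⟨signVertex M a, ⟨j, Nat.lt_succ_of_le hj⟩⟩
  | ⟨.sub _ s hs, j, hj⟩ => Sum.inr ⟨⟨s.map (pathVertex M ℓV), map_pathVertex_mem hM hs⟩,
      ⟨j, Nat.lt_succ_of_le (by rw [edgeColor_map_pathVertex]; exact hj)⟩⟩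

theorem pathVertex_injective {k l : m} {a : signGroup M k} {b : signGroup M l}
    (h : pathVertex M ℓV a = pathVertex M ℓV b) : (⟨k, a⟩ : Σ k, signGroup M k) = ⟨l, b⟩ := by
  have h1 : signVertex M a = signVertex M b := congrArg Sigma.fst h
  obtain rfl : k = l := congrArg Sigma.fst h1
  congr 1
  exact Subtype.ext (congrArg Subtype.val (eq_of_heq (Sigma.mk.inj h1).2))

theorem map_pathVertex_eq_iff {k l : m} {s : Sym2 (signGroup M k)} {t : Sym2 (signGroup M l)}
    {hs : s.label ≠ 1} {ht : t.label ≠ 1} :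
    s.map (pathVertex M ℓV) = t.map (pathVertex M ℓV) ↔
      PartData.Base.sub (A := fun k => signGroup M k) k s hs = .sub l t ht := by
  constructor
  · intro h
    have h4 : k = l := by
      induction s with
      | _ a b => induction t with
        | _ c d =>
          rcases Sym2.eq_iff.mp h with h5 | h5
          · exact congrArg Sigma.fst (pathVertex_injective h5.1)
          · exact congrArg Sigma.fst (pathVertex_injective h5.1)
    subst h4
    obtain rfl : s = t := Sym2.map.injective (fun a b hab =>
      eq_of_heq (Sigma.mk.inj (pathVertex_injective hab)).2) h
    rfl
  · intro h
    cases h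
    rfl

theorem mem_map_pathVertex_iff {k l : m} {a : signGroup M k} {t : Sym2 (signGroup M l)}
    {ht : t.label ≠ 1} (i : Fin (ℓV k + 1)) :
    (⟨signVertex M a, i⟩ : PathVertex (reducedSystemGraph M 0) ℓV) ∈ t.map (pathVertex M ℓV) ↔
      (i : ℕ) = 0 ∧ (systemData M ℓV ℓE).baseGraph.Adj (.old k a) (.sub l t ht) := by
  rw [Sym2.mem_map]
  constructor
  · rintro ⟨b, hb, h⟩
    have hi : (0 : ℕ) = i := congrArg (fun x : PathVertex (reducedSystemGraph M 0) ℓV => (x.2 : ℕ)) h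
    obtain ⟨i, hi'⟩ := i
    obtain rfl : 0 = i := hi
    refine ⟨rfl, ?_⟩
    have h1 := pathVertex_injective h
    obtain rfl : l = k := congrArg Sigma.fst h1
    obtain rfl : b = a := eq_of_heq (Sigma.mk.inj h1).2
    exact (PartData.baseGraph_old_sub _).mpr hb
  · rintro ⟨hi, h⟩
    obtain rfl : k = l := PartData.baseGraph_old_sub_part _ h
    refine ⟨a, (PartData.baseGraph_old_sub (systemData M ℓV ℓE)).mp h, ?_⟩
    obtain ⟨i, hi'⟩ := i
    obtain rfl : i = 0 := hi
    rfl

theorem toDecolor_injective (hM : IsIncidenceSystem M) :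
    Function.Injective (toDecolor ℓV ℓE hM) := by
  rintro ⟨⟨k, a⟩ | ⟨k, s, hs⟩, i, hi⟩ ⟨⟨l, b⟩ | ⟨l, t, ht⟩, j, hj⟩ h
  · have h1 := Sum.inl_injective h
    exact PathPoint.ext (signVertex_eq_iff.mp (congrArg Sigma.fst h1))
      (congrArg (fun x : PathVertex (reducedSystemGraph M 0) ℓV => (x.2 : ℕ)) h1)
  · exact absurd h Sum.inl_ne_inr
  · exact absurd h Sum.inr_ne_inl
  · have h1 := Sum.inr_injective h
    exact PathPoint.ext (map_pathVertex_eq_iff.mp (congrArg (fun e => e.1.1) h1))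
      (congrArg (fun e => (e.2 : ℕ)) h1)

theorem toDecolor_surjective (hM : IsIncidenceSystem M) :
    Function.Surjective (toDecolor ℓV ℓE hM) := by
  rintro (⟨v, j⟩ | ⟨⟨e, he⟩, j⟩)
  · obtain ⟨k, a, rfl⟩ := signVertex_surjective v
    exact ⟨⟨.old k a, j, Nat.le_of_lt_succ j.2⟩, rfl⟩
  · obtain ⟨k, s, hs, rfl⟩ : ∃ (k : m) (s : Sym2 (signGroup M k)), s.label ≠ 1 ∧
        e = s.map (pathVertex M ℓV) := by
      induction e with
      | _ x y =>
        obtain ⟨hadj, hcol⟩ := he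
        -- An edge with a color other than `none` is not a path edge, so both ends have position
        -- `0`; and it does not join different parts.
        rw [attachPaths_edgeColor] at hcol
        obtain ⟨⟨hx, hy⟩, hcol⟩ := ite_ne_right_iff.mp hcol
        obtain ⟨v, i, hi⟩ := x
        obtain ⟨w, i', hi'⟩ := y
        obtain rfl : i = 0 := hx
        obtain rfl : i' = 0 := hy
        obtain ⟨k, a, rfl⟩ := signVertex_surjective v
        obtain ⟨l, b, rfl⟩ := signVertex_surjective w
        obtain rfl : k = l := by
          by_contra hkl
          exact hcol (if_neg hkl)
        refine ⟨k, s(a, b), fun h => ?_, rfl⟩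
        obtain rfl : a = b := (systemData M ℓV ℓE).eq_of_mul_eq_one h
        exact SimpleGraph.irrefl _ ((SimpleGraph.mem_edgeSet _).mp hadj)
    refine ⟨⟨.sub k s hs, j, ?_⟩, rfl⟩
    have := Nat.le_of_lt_succ j.2
    simp only [edgeColor_map_pathVertex] at this
    exact this

theorem toDecolor_adj (hM : IsIncidenceSystem M) (x y : (systemData M ℓV ℓE).Vertex) :
    ((reducedSystemGraph M 0).decolor ℓV ℓE none).Adj (toDecolor ℓV ℓE hM x)
      (toDecolor ℓV ℓE hM y) ↔ (systemData M ℓV ℓE).graph.Adj x y := by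
  rw [PathPoint.adj_iff]
  obtain ⟨⟨k, a⟩ | ⟨k, s, hs⟩, i, hi⟩ := x <;> obtain ⟨⟨l, b⟩ | ⟨l, t, ht⟩, j, hj⟩ := y
  -- The edges that are not subdivided are those between different parts and those of the paths at
  -- the vertices; the edges inside a part carry a color `some _`.
  · change ((i = 0 ∧ j = 0 ∧ (reducedSystemGraph M 0).graph.Adj (signVertex M a) (signVertex M b)) ∨
      (signVertex M a = signVertex M b ∧ (i + 1 = j ∨ j + 1 = i))) ∧
      (if i = 0 ∧ j = 0 then (reducedSystemGraph M 0).edgeColor s(signVertex M a, signVertex M b)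
        else none) = none ↔ _
    rw [signVertex_eq_iff]
    constructor
    · rintro ⟨⟨h1, h2, h3⟩ | h, hc⟩
      · rw [if_pos ⟨h1, h2⟩] at hc
        refine Or.inl ⟨h1, h2, ?_, h3⟩
        rintro rfl
        rw [IsIncidenceSystem.edgeColor_signVertex] at hc
        exact absurd hc (Option.some_ne_none _)
      · exact Or.inr h
    · rintro (⟨h1, h2, h3, h4⟩ | h)
      · refine ⟨Or.inl ⟨h1, h2, h4⟩, ?_⟩
        rw [if_pos ⟨h1, h2⟩]
        exact if_neg h3
      · refine ⟨Or.inr h, if_neg fun h0 => ?_⟩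
        have h2 : i + 1 = j ∨ j + 1 = i := h.2
        omega
  · refine (and_congr_left' (mem_map_pathVertex_iff (ℓE := ℓE) (ht := ht)
      ⟨i, Nat.lt_succ_of_le hi⟩)).trans ?_
    simp only [reduceCtorEq, false_and, or_false]
    exact ⟨fun h => ⟨h.1.1, h.2, h.1.2⟩, fun h => ⟨⟨h.1, h.2.2⟩, h.2.1⟩⟩
  · refine (and_congr_left' (mem_map_pathVertex_iff (ℓE := ℓE) (ht := hs)
      ⟨j, Nat.lt_succ_of_le hj⟩)).trans ?_
    simp only [reduceCtorEq, false_and, or_false]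
    exact ⟨fun h => ⟨h.2, h.1.1, h.1.2.symm⟩, fun h => ⟨⟨h.2.1, h.2.2.symm⟩, h.1⟩⟩
  · change (⟨s.map (pathVertex M ℓV), _⟩ : {e : Sym2 _ // _}) = ⟨t.map (pathVertex M ℓV), _⟩ ∧
      (i + 1 = j ∨ j + 1 = i) ↔ _
    rw [Subtype.mk.injEq, map_pathVertex_eq_iff (hs := hs) (ht := ht)]
    exact ⟨Or.inr, fun h => h.resolve_left fun h => h.2.2⟩

/-- The model graph is isomorphic to the decolored graph. -/
def decolorEquiv (hM : IsIncidenceSystem M) : (systemData M ℓV ℓE).Vertex ≃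
    SubdivisionVertex ((reducedSystemGraph M 0).attachPaths ℓV none) ℓE none :=
  Equiv.ofBijective (toDecolor ℓV ℓE hM) ⟨toDecolor_injective hM, toDecolor_surjective hM⟩

theorem decolorEquiv_adj (hM : IsIncidenceSystem M) (x y : (systemData M ℓV ℓE).Vertex) :
    ((reducedSystemGraph M 0).decolor ℓV ℓE none).Adj (decolorEquiv hM x) (decolorEquiv hM y) ↔
      (systemData M ℓV ℓE).graph.Adj x y :=
  toDecolor_adj hM x y

/-! ### Incidence matrices -/

section Incidence

variable {V : Type u} [Fintype V] [DecidableEq V] (H : SimpleGraph V) [DecidableRel H.Adj]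

theorem mem_equationSupport_incidenceMatrix {k : V} {i : H.edgeSet} :
    i ∈ equationSupport (incidenceMatrix H) k ↔ k ∈ i.1 := by
  rw [mem_equationSupport]
  change H.incMatrix (ZMod 2) k i.1 = 1 ↔ _
  rw [SimpleGraph.incMatrix_apply_eq_one_iff]
  exact ⟨fun h => h.2, fun h => ⟨i.2, h⟩⟩

/-- Variables are edges and equations are vertices: an edge has two ends, two vertices span at most
one edge, and the degree condition provides a second edge at every vertex. -/
theorem isIncidenceSystem_incidenceMatrix (hH : ∀ v, 2 ≤ H.degree v) :
    IsIncidenceSystem (incidenceMatrix H) where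
  exists_mem i := by
    obtain ⟨e, he⟩ := i
    induction e with
    | _ a b => exact ⟨a, (mem_equationSupport_incidenceMatrix H).mpr (Sym2.mem_mk_left _ _)⟩
  exists_ne {k i} hi := by
    rw [mem_equationSupport_incidenceMatrix] at hi
    refine ⟨Sym2.Mem.other hi, (SimpleGraph.edge_other_ne H i.2 hi).symm, ?_⟩
    rw [mem_equationSupport_incidenceMatrix]
    exact Sym2.other_mem hi
  exists_ne_mem {k i} hi := by
    rw [mem_equationSupport_incidenceMatrix] at hi
    -- A neighbour of `k` different from the other end of the given edge.
    obtain ⟨l, hl, hne⟩ := Finset.exists_mem_ne (lt_of_lt_of_le one_lt_two (hH k))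
      (Sym2.Mem.other hi)
    rw [SimpleGraph.mem_neighborFinset] at hl
    refine ⟨⟨s(k, l), hl⟩, (mem_equationSupport_incidenceMatrix H).mpr (Sym2.mem_mk_left _ _), ?_⟩
    rintro rfl
    refine hne ?_
    have := Sym2.other_spec hi
    exact (Sym2.congr_right.mp this).symm
  nonempty k := by
    obtain ⟨l, hl⟩ := Finset.card_pos.mp (lt_of_lt_of_le two_pos (hH k))
    rw [SimpleGraph.mem_neighborFinset] at hl
    exact ⟨⟨s(k, l), hl⟩, (mem_equationSupport_incidenceMatrix H).mpr (Sym2.mem_mk_left _ _)⟩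
  eq_of_mem {k l i j} hkl hki hli hkj hlj := by
    rw [mem_equationSupport_incidenceMatrix] at hki hli hkj hlj
    exact Subtype.ext (((Sym2.mem_and_mem_iff hkl).mp ⟨hki, hli⟩).trans
      ((Sym2.mem_and_mem_iff hkl).mp ⟨hkj, hlj⟩).symm)

end Incidence

end System

/-! ### Homomorphisms from universal `C*`-algebras -/

/-- Star homomorphisms are contractive and the polynomials in the generators are dense. -/
theorem UniversalCStarAlgebra.hom_ext {X : Type u} {R : Set (FreeStarAlgebra X)}
    [BoundedRelations R] {B : Type v} [CStarAlgebra B] {f g : UniversalCStarAlgebra R →⋆ₐ[ℂ] B}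
    (h : ∀ x, f (of R x) = g (of R x)) : f = g := by
  have hf : Continuous f :=
    AddMonoidHomClass.continuous_of_bound f 1 fun a => by
      rw [one_mul]; exact NonUnitalStarAlgHom.norm_apply_le f a
  have hg : Continuous g :=
    AddMonoidHomClass.continuous_of_bound g 1 fun a => by
      rw [one_mul]; exact NonUnitalStarAlgHom.norm_apply_le g a
  refine DFunLike.coe_injective ((denseRange_mk R).equalizer hf hg (funext fun a => ?_))
  change f (mk R a) = g (mk R a)
  induction a using FreeStarAlgebra.induct with
  | hsc z => rw [AlgHomClass.commutes, AlgHomClass.commutes, AlgHomClass.commutes]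
  | hgen x => exact h x
  | hgenStar x =>
    rw [← FreeStarAlgebra.star_gen, StarHomClass.map_star, StarHomClass.map_star,
      StarHomClass.map_star]
    exact congrArg star (h x)
  | hadd a b ha hb => rw [map_add, map_add, map_add, ha, hb]
  | hmul a b ha hb => rw [map_mul, map_mul, map_mul, ha, hb]

theorem qut_comul {W : Type u} [Fintype W] (G : SimpleGraph W) (i j : W) :
    (qut G).comul (qutMatrix G i j) =
      MinTensor.mk (QutAlgebra G) (QutAlgebra G) (qutComulGen G (i, j)) :=
  UniversalCStarAlgebra.lift_of _ (qutComulGen_relations G) (i, j)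

/-! ### Group C*-algebras and unitary representations. -/

section GroupHom

variable {Γ : Type u} [Group Γ] {B : Type v} [CStarAlgebra B]

theorem eval_groupRelations (ρ : Γ →* unitary B) (r : FreeStarAlgebra Γ)
    (hr : r ∈ groupRelations Γ) : FreeStarAlgebra.eval (fun g => (ρ g : B)) r = 0 := by
  cases hr with
  | star_mul g =>
    rw [map_sub, map_mul, StarHomClass.map_star, FreeStarAlgebra.eval_gen, map_one,
      Unitary.coe_star_mul_self, sub_self]
  | mul_star g =>
    rw [map_sub, map_mul, StarHomClass.map_star, FreeStarAlgebra.eval_gen, map_one,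
      Unitary.mul_star_self_of_mem (ρ g).2, sub_self]
  | mul g h =>
    rw [map_sub, map_mul, FreeStarAlgebra.eval_gen, FreeStarAlgebra.eval_gen,
      FreeStarAlgebra.eval_gen, map_mul, Submonoid.coe_mul, sub_self]
  | inv g =>
    rw [map_sub, StarHomClass.map_star, FreeStarAlgebra.eval_gen, FreeStarAlgebra.eval_gen,
      map_inv, sub_eq_zero]
    rfl

/-- The `*`-homomorphism of the group `C*`-algebra defined by a unitary representation. -/
def groupHom (ρ : Γ →* unitary B) : GroupCStarAlgebra Γ →⋆ₐ[ℂ] B :=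
  UniversalCStarAlgebra.lift (fun g => (ρ g : B)) (eval_groupRelations ρ)

theorem groupHom_groupUnitary (ρ : Γ →* unitary B) (g : Γ) :
    groupHom ρ (groupUnitary g) = ρ g :=
  UniversalCStarAlgebra.lift_of _ _ g

theorem groupDual_comul (g : Γ) : (groupDual Γ).comul (groupUnitary g) =
    MinTensor.mk (GroupCStarAlgebra Γ) (GroupCStarAlgebra Γ) (groupUnitary g ⊗ₜ groupUnitary g) :=
  UniversalCStarAlgebra.lift_of _ groupComul_relations g

theorem groupUnitary_one : groupUnitary (1 : Γ) = 1 := by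
  have h := groupUnitary_star_mul (1 : Γ)
  rw [← groupUnitary_inv, ← groupUnitary_mul, mul_one, inv_one] at h
  exact h

theorem groupUnitary_list_prod (l : List Γ) :
    groupUnitary l.prod = (l.map groupUnitary).prod := by
  induction l with
  | nil => exact groupUnitary_one
  | cons g l ih => rw [List.prod_cons, groupUnitary_mul, ih, List.map_cons, List.prod_cons]

end GroupHom

/-! ### Solutions of the system as representations of the solution group. -/

section SolutionGroup

variable {m : Type v} {n : Type u} {M : Matrix m n (ZMod 2)} {B : Type w}
  [CStarAlgebra B]

variable (M) in
/-- The canonical unitary of a generator of the solution group. -/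
def solutionUnitary (i : n) : GroupCStarAlgebra (HomogeneousSolutionGroup M) :=
  groupUnitary (PresentedGroup.of i)

theorem solution_hom_ext {f g : GroupCStarAlgebra (HomogeneousSolutionGroup M) →⋆ₐ[ℂ] B}
    (h : ∀ i, f (solutionUnitary M i) = g (solutionUnitary M i)) : f = g := by
  refine UniversalCStarAlgebra.hom_ext fun x => ?_
  change f (groupUnitary x) = g (groupUnitary x)
  induction x using PresentedGroup.induction_on with
  | _ z =>
    induction z using FreeGroup.induction_on with
    | C1 => rw [map_one, groupUnitary_one, map_one, map_one]
    | of i => exact h i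
    | inv_of i hi =>
      rw [map_inv, groupUnitary_inv, StarHomClass.map_star, StarHomClass.map_star]
      exact congrArg star hi
    | mul a b ha hb => rw [map_mul, groupUnitary_mul, map_mul, map_mul, ha, hb]

variable [Fintype n]

variable (M) in
theorem isSolution_solutionUnitary : IsSolution M (solutionUnitary M) := by
  have hsq : ∀ i, solutionUnitary M i * solutionUnitary M i = 1 := fun i => by
    rw [solutionUnitary, ← groupUnitary_mul, ← groupUnitary_one]
    congr 1
    have := PresentedGroup.one_of_mem (rels := {r | SolutionRel M r}) (SolutionRel.sq i)
    rw [map_pow, sq] at this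
    exact this
  refine ⟨fun i => ?_, hsq, fun {k i j} hi hj => ?_, fun k l hl h => ?_⟩
  · have h1 := groupUnitary_star_mul (PresentedGroup.of (rels := {r | SolutionRel M r}) i)
    change star (solutionUnitary M i) * solutionUnitary M i = 1 at h1
    -- A unitary of square `1` is self-adjoint.
    rw [← mul_one (star _), ← hsq i, ← mul_assoc, h1, one_mul]
  · rw [solutionUnitary, solutionUnitary, ← groupUnitary_mul, ← groupUnitary_mul]
    congr 1
    have := PresentedGroup.one_of_mem (rels := {r | SolutionRel M r})
      (SolutionRel.comm k i j (mem_equationSupport.mp hi) (mem_equationSupport.mp hj))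
    rw [map_mul, map_mul, map_mul, map_inv, map_inv] at this
    exact mul_inv_eq_iff_eq_mul.mp (mul_inv_eq_one.mp this)
  · have := PresentedGroup.one_of_mem (rels := {r | SolutionRel M r}) (SolutionRel.prod k l hl h)
    rw [map_list_prod, List.map_map] at this
    rw [← groupUnitary_one, ← this, groupUnitary_list_prod, List.map_map]
    rfl

namespace IsSolution

variable {x : n → B} (hx : IsSolution M x)

/-- The elements of a solution, as unitaries. -/
def toUnitary (i : n) : unitary B :=
  ⟨x i, Unitary.mem_iff.mpr ⟨by rw [hx.star_eq, hx.sq], by rw [hx.star_eq, hx.sq]⟩⟩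

theorem lift_eq_one (r : FreeGroup n) (hr : r ∈ {r | SolutionRel M r}) :
    FreeGroup.lift hx.toUnitary r = 1 := by
  cases hr with
  | sq i =>
    rw [map_pow, FreeGroup.lift_apply_of, pow_two]
    exact Subtype.ext (hx.sq i)
  | comm k i j hi hj =>
    rw [map_mul, map_mul, map_mul, map_inv, map_inv, FreeGroup.lift_apply_of,
      FreeGroup.lift_apply_of, mul_inv_eq_one, mul_inv_eq_iff_eq_mul]
    exact Subtype.ext (hx.comm (mem_equationSupport.mpr hi) (mem_equationSupport.mpr hj))
  | prod k l hl h =>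
    rw [map_list_prod, List.map_map]
    refine Subtype.ext (Eq.trans ?_ (hx.prod k l hl h))
    rw [Submonoid.coe_list_prod, List.map_map]
    congr 1
    refine List.map_congr_left fun i _ => ?_
    simp [toUnitary]

/-- The `*`-homomorphism of the group `C*`-algebra of the solution group defined by a solution. -/
def hom : GroupCStarAlgebra (HomogeneousSolutionGroup M) →⋆ₐ[ℂ] B :=
  groupHom (PresentedGroup.toGroup hx.lift_eq_one)

theorem hom_solutionUnitary (i : n) : hx.hom (solutionUnitary M i) = x i := by
  rw [hom, solutionUnitary, groupHom_groupUnitary, PresentedGroup.toGroup.of]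
  rfl

end IsSolution

end SolutionGroup

/-! ### Compatibility with the comultiplications. -/

section System

variable {m : Type v} {n : Type u} [Fintype n] {M : Matrix m n (ZMod 2)} {B : Type w}
  [CStarAlgebra B]

theorem signExtend_mul {k : m} (α β : equationSupport M k → ℤˣ) (i : n) :
    signExtend (α * β) i = signExtend α i * signExtend β i := by
  by_cases hi : i ∈ equationSupport M k
  · simp only [signExtend_of_mem _ hi, Pi.mul_apply]
  · simp only [signExtend, dif_neg hi, mul_one]

theorem IsSpectral.spectralSymmetry_eq {x : n → B} {P : ∀ k, signGroup M k → B}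
    (hP : IsSpectral x P) {k : m} (hsum : ∑ c, P k c = 1) {i : n}
    (hi : i ∈ equationSupport M k) : spectralSymmetry P k i = x i := by
  conv_rhs => rw [← mul_one (x i), ← hsum, Finset.mul_sum]
  refine Finset.sum_congr rfl fun c _ => ?_
  rw [hP k i hi, signExtend_of_mem c.1 hi]

theorem map_spectralSymmetry {B' : Type*} [CStarAlgebra B'] (f : B →⋆ₐ[ℂ] B')
    (P : ∀ k, signGroup M k → B) (k : m) (i : n) :
    f (spectralSymmetry P k i) = spectralSymmetry (fun k c => f (P k c)) k i := by
  simp only [spectralSymmetry, map_sum, map_mul, map_intCast]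

/-- The symmetries are multiplicative with respect to the convolution comultiplication of the
spectral projections. -/
theorem sum_spectralSymmetry_tmul (P : ∀ k, signGroup M k → B) (k : m) (i : n)
    (hsq : ∀ a : signGroup M k, a * a = 1) :
    ∑ γ : signGroup M k, ((signExtend γ.1 i : ℤ) : B ⊗[ℂ] B) *
      ∑ δ : signGroup M k, P k δ ⊗ₜ[ℂ] P k (δ * γ) =
      spectralSymmetry P k i ⊗ₜ[ℂ] spectralSymmetry P k i := by
  simp only [spectralSymmetry, TensorProduct.sum_tmul, Finset.mul_sum]
  rw [Finset.sum_comm]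
  refine Finset.sum_congr rfl fun δ _ => ?_
  rw [TensorProduct.tmul_sum]
  -- Substituting `δ * γ` for `γ` turns the convolution into a product, as evaluation at `i` is a
  -- character and `δ * δ = 1`.
  rw [← Equiv.sum_comp (Equiv.mulLeft δ)]
  refine Finset.sum_congr rfl fun γ _ => ?_
  have h1 : ∀ (z : ℤ) (b : B), ((z : B) * P k δ) ⊗ₜ[ℂ] b =
      (z : B ⊗[ℂ] B) * (P k δ ⊗ₜ[ℂ] b) := fun z b => by
    rw [← zsmul_eq_mul, ← zsmul_eq_mul]
    exact map_zsmul ((TensorProduct.mk ℂ B B).flip b) z (P k δ)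
  have h2 : ∀ (z : ℤ) (b : B), b ⊗ₜ[ℂ] ((z : B) * P k γ) =
      (z : B ⊗[ℂ] B) * (b ⊗ₜ[ℂ] P k γ) := fun z b => by
    rw [← zsmul_eq_mul, ← zsmul_eq_mul]
    exact map_zsmul (TensorProduct.mk ℂ B B b) z _
  have h3 : signExtend (δ * γ).1 i = signExtend γ.1 i * signExtend δ.1 i := by
    rw [mul_comm]
    exact signExtend_mul γ.1 δ.1 i
  have h4 : δ * (δ * γ) = γ := by rw [← mul_assoc, hsq, one_mul]
  simp only [Equiv.coe_mulLeft]
  rw [h2, h1, h4, h3, ← mul_assoc, ← Int.cast_mul, ← Units.val_mul]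

/-- A homomorphism that acts on spectral projections by convolution sends the symmetries to
group-like tensors. -/
theorem map_spectralSymmetry_eq_mk_tmul {B' : Type*} [CStarAlgebra B']
    {P : ∀ k, signGroup M k → B} {R : ∀ k, signGroup M k → B'} (F : B' →⋆ₐ[ℂ] MinTensor B B)
    {k : m} {i : n}
    (hF : ∀ c, F (R k c) = MinTensor.mk B B (∑ d : signGroup M k, P k d ⊗ₜ[ℂ] P k (d * c)))
    (hsq : ∀ a : signGroup M k, a * a = 1) : F (spectralSymmetry R k i) =
      MinTensor.mk B B (spectralSymmetry P k i ⊗ₜ[ℂ] spectralSymmetry P k i) := by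
  rw [map_spectralSymmetry, ← sum_spectralSymmetry_tmul P k i hsq, map_sum, spectralSymmetry]
  exact Finset.sum_congr rfl fun c _ => by rw [map_mul, map_intCast, hF]

end System

theorem PartData.map_quantumAut {K : Type u} {A : K → Type v} [∀ k, CommGroup (A k)]
    (D : PartData K A) [∀ k, Fintype (A k)] {B B' : Type*} [CStarAlgebra B] [CStarAlgebra B']
    (f : B →⋆ₐ[ℂ] B') (P : ∀ k, A k → B) (x y : D.Vertex) :
    f (D.quantumAut P x y) = D.quantumAut (fun k c => f (P k c)) x y := by
  classical
  simp only [PartData.quantumAut, map_sum]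
  refine Finset.sum_congr rfl fun c _ => ?_
  split_ifs
  · rfl
  · exact map_zero f

open Classical in
/-- The sum over a row of a quantum automorphism of the form `quantumAut P`, starting at a vertex
of a group, only involves the vertices of this group. -/
theorem PartData.sum_quantumAut_tmul {K : Type u} {A : K → Type v} [∀ k, CommGroup (A k)]
    (D : PartData K A) [∀ k, Fintype (A k)] [Fintype D.Vertex] {B : Type w} [CStarAlgebra B]
    (P : ∀ k, A k → B) {k : K} (c : A k) :
    ∑ z, D.quantumAut P (D.root (.old k 1)) z ⊗ₜ[ℂ] D.quantumAut P z (D.root (.old k c)) =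
      ∑ d : A k, P k d ⊗ₜ[ℂ] P k (d * c) := by
  have h1 : ∑ d : A k, P k d ⊗ₜ[ℂ] P k (d * c) = ∑ z ∈ Finset.univ.image
      (fun d : A k => D.root (.old k d)), D.quantumAut P (D.root (.old k 1)) z ⊗ₜ[ℂ]
        D.quantumAut P z (D.root (.old k c)) := by
    rw [Finset.sum_image]
    · refine Finset.sum_congr rfl fun d _ => ?_
      rw [CompatiblePVM.quantumAut_old, CompatiblePVM.quantumAut_old, one_mul]
    · intro d _ d' _ h
      by_contra hne
      exact D.root_old_ne' hne h
  rw [h1]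
  symm
  refine Finset.sum_subset (Finset.subset_univ _) fun z _ hz => ?_
  by_cases h0 : D.quantumAut P (D.root (.old k 1)) z = 0
  · rw [h0, TensorProduct.zero_tmul]
  · obtain ⟨b, rfl⟩ := CompatiblePVM.quantumAut_old_ne D P 1 h0
    exact absurd (Finset.mem_image_of_mem _ (Finset.mem_univ b)) hz

/-- The quantum automorphism group of the decolored graph of an incidence system is the dual of
its solution group. -/
theorem IsIncidenceSystem.isomorphic {m n : Type u} [Fintype m] [Fintype n] [DecidableEq n]
    {M : Matrix m n (ZMod 2)} (hM : IsIncidenceSystem M) {ℓV : m → ℕ}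
    (hV : Function.Injective ℓV) {ℓE : ReducedColor n → ℕ}
    (hE : Set.InjOn ℓE ((reducedSystemGraph M 0).colors \ {none})) :
    (qut ((reducedSystemGraph M 0).decolor ℓV ℓE none)).Isomorphic
      (groupDual (HomogeneousSolutionGroup M)) := by
  let G := (reducedSystemGraph M 0).decolor ℓV ℓE none
  let D := systemData M ℓV ℓE
  let e := decolorEquiv (ℓV := ℓV) (ℓE := ℓE) hM
  let _ : Fintype D.Vertex := Fintype.ofEquiv _ e.symm
  have he : ∀ x y, G.Adj (e x) (e y) ↔ D.graph.Adj x y := decolorEquiv_adj hM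
  have hD : D.Admissible := hM.admissible hV hE
  have hx := isSolution_solutionUnitary M
  -- The spectral projections of the canonical unitaries define a quantum automorphism over the
  -- group algebra, and with it `φ`.
  obtain ⟨P, hP, hxP⟩ := hx.exists_spectral (ℓV := ℓV) (ℓE := ℓE) hM
  have hC : IsQuantumAut G (fun x y => D.quantumAut P (e.symm x) (e.symm y)) :=
    hP.isQuantumAut.comp_equiv e.symm fun x y => by
      rw [← he, e.apply_symm_apply, e.apply_symm_apply]
  let φ : QutAlgebra G →⋆ₐ[ℂ] GroupCStarAlgebra (HomogeneousSolutionGroup M) :=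
    UniversalCStarAlgebra.lift _ hC.eval_relations
  have hφ : ∀ x y, φ (qutMatrix G (e x) (e y)) = D.quantumAut P x y := fun x y => by
    refine (UniversalCStarAlgebra.lift_of _ _ _).trans ?_
    simp only [e.symm_apply_apply]
  have hQ : IsQuantumAut D.graph (fun x y => qutMatrix G (e x) (e y)) :=
    (qutMatrix_isQuantumAut G).comp_equiv e he
  -- In the other direction, the first rows of the fundamental representation yield a solution of
  -- the system, and with it `ψ`.
  let R := D.firstRow (fun x y => qutMatrix G (e x) (e y))
  have hR : D.CompatiblePVM R := hD.compatiblePVM hQ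
  obtain ⟨y, hy, hyR, hyeq⟩ := hR.exists_solution hM
  let ψ : GroupCStarAlgebra (HomogeneousSolutionGroup M) →⋆ₐ[ℂ] QutAlgebra G := hy.hom
  have hψ : ∀ i, ψ (solutionUnitary M i) = y i := hy.hom_solutionUnitary
  have hφR : ∀ k c, φ (R k c) = P k c := fun k c => by
    refine (hφ _ _).trans ?_
    rw [PartData.CompatiblePVM.quantumAut_old, one_mul]
  have hφy : ∀ i, φ (y i) = solutionUnitary M i := fun i => by
    obtain ⟨k, hk⟩ := hM.exists_mem i
    rw [hyeq k i hk, map_spectralSymmetry]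
    simp only [hφR]
    exact hxP.spectralSymmetry_eq (hP.sum_eq k) hk
  -- Both families are spectral for the solution `y`, so they agree by uniqueness. By rigidity this
  -- determines `ψ ∘ φ` on every entry of the fundamental representation.
  have hψP : (fun k c => ψ (P k c)) = R := by
    refine IsSpectral.unique (x := y) (fun k i hi γ => ?_) hy.star_eq (fun k c => ?_) (fun k => ?_)
      hyR hR.sum_eq
    · rw [← hψ, ← map_mul, hxP k i hi, map_mul, map_intCast]
    · rw [← StarHomClass.map_star, hP.star_eq]
    · rw [← map_sum, hP.sum_eq, map_one]
  have hφψ : φ.comp ψ = StarAlgHom.id ℂ _ := solution_hom_ext fun i => by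
    change φ (ψ _) = _
    rw [hψ, hφy]
    rfl
  have hψφ : ψ.comp φ = StarAlgHom.id ℂ _ := UniversalCStarAlgebra.hom_ext fun z => by
    obtain ⟨x, hx⟩ := e.surjective z.1
    obtain ⟨y, hy⟩ := e.surjective z.2
    have hz : z = (e x, e y) := by rw [hx, hy]
    rw [hz]
    change ψ (φ (qutMatrix G (e x) (e y))) = qutMatrix G (e x) (e y)
    rw [hφ, D.map_quantumAut, hψP]
    exact (congrFun (congrFun (hD.eq_quantumAut hQ) x) y).symm
  let C := GroupCStarAlgebra (HomogeneousSolutionGroup M)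
  let ΔG : QutAlgebra G →⋆ₐ[ℂ] MinTensor (QutAlgebra G) (QutAlgebra G) := (qut G).comul
  let ΔΓ : C →⋆ₐ[ℂ] MinTensor C C := (groupDual (HomogeneousSolutionGroup M)).comul
  let F : QutAlgebra G →⋆ₐ[ℂ] MinTensor C C := (MinTensor.map φ φ).comp ΔG
  have hF : ∀ k c, F (R k c) =
      MinTensor.mk C C (∑ d : signGroup M k, P k d ⊗ₜ[ℂ] P k (d * c)) := fun k c => by
    have h : ΔG (R k c) = MinTensor.mk _ _ (qutComulGen G
        (e (D.root (.old k 1)), e (D.root (.old k c)))) := qut_comul G _ _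
    change MinTensor.map φ φ (ΔG (R k c)) = _
    rw [h, MinTensor.map_mk]
    congr 1
    rw [← D.sum_quantumAut_tmul, qutComulGen, map_sum, ← e.sum_comp]
    refine Finset.sum_congr rfl fun z _ => ?_
    rw [MinTensor.algMap_tmul, hφ, hφ]
  -- The comultiplications are compared after transport to the group algebra, where only the
  -- generators of the solution group need to be checked; composing with `φ` then gives the required
  -- identity.
  have hcomul : ΔΓ = F.comp ψ := solution_hom_ext fun i => by
    obtain ⟨k, hk⟩ := hM.exists_mem i
    change ΔΓ (solutionUnitary M i) = F (ψ (solutionUnitary M i))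
    rw [hψ, hyeq k i hk, map_spectralSymmetry_eq_mk_tmul F (hF k) D.mul_self,
      hxP.spectralSymmetry_eq (hP.sum_eq k) hk]
    exact groupDual_comul _
  refine ⟨StarAlgEquiv.ofStarAlgHom φ ψ hψφ hφψ, fun a => ?_⟩
  have h1 : ΔΓ (φ a) = F (ψ (φ a)) := DFunLike.congr_fun hcomul (φ a)
  have h2 : ψ (φ a) = a := DFunLike.congr_fun hψφ a
  rw [h2] at h1
  exact h1

end

theorem theorem5p5 {V : Type*} [Fintype V] [DecidableEq V]
    (H : SimpleGraph V) [DecidableRel H.Adj] (hH : ∀ v, 2 ≤ H.degree v)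
    (ℓV : V → ℕ) (hV : Function.Injective ℓV)
    (ℓE : ReducedColor H.edgeSet → ℕ)
    (hE : Set.InjOn ℓE ((reducedSystemGraph (incidenceMatrix H) 0).colors \ {none})) :
    (qut ((reducedSystemGraph (incidenceMatrix H) 0).decolor ℓV ℓE none)).Isomorphic
      (groupDual (HomogeneousSolutionGroup (incidenceMatrix H))) :=
  (isIncidenceSystem_incidenceMatrix H hH).isomorphic hV hE
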